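/- **Theorem (quantitative isoperimetric inequality for the biharmonic Steklov problem).** Let $N\ge 2$ and let $\tau>0$ be fixed. For a bounded domain (bounded, connected, nonempty open set) $\Omega\subset\mathbb R^N$ of class $C^1$, consider the biharmonic Steklov problem $$ \Delta^2u-\tau\Delta u=0\ \text{in }\Omega,\qquad \frac{\partial^2u}{\partial\nu^2}=0,\quad \tau\frac{\partial u}{\partial\nu}-\mathrm{div}_{\partial\Omega}(D^2u\cdot\nu)-\frac{\partial\Delta u}{\partial\nu}=\lambda u\ \text{on }\partial\Omega, $$ in its weak form: $\lambda\in\mathbb R$ is an eigenvalue if there is $u\in H^2(\Omega)$, $u\neq0$, such that $$ \int_\Omega D^2u:D^2\varphi+\tau\,\nabla u\cdot\nabla\varphi\,dx=\lambda\int_{\partial\Omega}u\,\varphi\,d\sigma\qquad\text{for all }\varphi\in H^2(\Omega), $$ where $D^2u:D^2\varphi=\sum_{i,j}\frac{\partial^2 u}{\partial x_i\partial x_j}\frac{\partial^2\varphi}{\partial x_i\partial x_j}$, $\sigma$ is the surface measure on $\partial\Omega$, and boundary values are understood as traces. For every such $\Omega$ there is a smallest positive eigenvalue, denoted by $\lambda_2(\Omega)$.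 If $\Omega^*$ is any ball with $|\Omega^*|=|\Omega|$, then $$ \lambda_2(\Omega)\le\lambda_2(\Omega^*)\left(1-\delta_N\,\mathcal A(\Omega)^2\right),\qquad \delta_N=\frac{N+1}{8N}\left(\sqrt[N]{2}-1\right), $$ where $$ \mathcal A(\Omega)=\inf\left\{\frac{\|\chi_\Omega-\chi_B\|_{L^1(\mathbb R^N)}}{|\Omega|}\ :\ B\text{ a ball with }|B|=|\Omega|\right\} $$ is the Fraenkel asymmetry of $\Omega$. -/

import Mathlib

open MeasureTheory Set Filter Topology
open scoped ContDiff RealInnerProductSpace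

namespace BiharmonicSteklov

noncomputable section

/-- `Ω ⊆ ℝ^N` is a bounded domain (bounded, connected, nonempty open set) of class `C^1`: near each
boundary point, after a choice of a vertical unit direction `e`, the set `Ω` is the region strictly
above the graph of a `C^1` function defined on the hyperplane orthogonal to `e`. -/
structure IsBoundedC1Domain {N : ℕ} (Ω : Set (EuclideanSpace ℝ (Fin N))) : Prop where
  isOpen : IsOpen Ω
  isConnected : IsConnected Ω
  isBounded : Bornology.IsBounded Ω
  locally_graph : ∀ p ∈ frontier Ω, ∃ e : EuclideanSpace ℝ (Fin N), ‖e‖ = 1 ∧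
    ∃ γ : (ℝ ∙ e)ᗮ → ℝ, ContDiff ℝ 1 γ ∧ ∃ r : ℝ, 0 < r ∧
      ∀ x ∈ Metric.ball p r, x ∈ Ω ↔ γ ((ℝ ∙ e)ᗮ.orthogonalProjectionOnto x) < ⟪e, x⟫

/-- The surface measure on `∂Ω`: the `(N-1)`-dimensional Hausdorff measure (with the normalization
that agrees with Lebesgue measure on `(N-1)`-dimensional Euclidean spaces) restricted to `∂Ω`. -/
def surfaceMeasure {N : ℕ} (Ω : Set (EuclideanSpace ℝ (Fin N))) :
    Measure (EuclideanSpace ℝ (Fin N)) :=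
  (μHE[N - 1]).restrict (frontier Ω)

/-- The classical partial derivative `∂φ/∂x_i`. -/
def partialDeriv {N : ℕ} (i : Fin N) (φ : EuclideanSpace ℝ (Fin N) → ℝ)
    (x : EuclideanSpace ℝ (Fin N)) : ℝ :=
  fderiv ℝ φ x (EuclideanSpace.single i 1)

/-- `v` is the weak partial derivative `∂u/∂x_i` in the open set `Ω`. -/
def IsWeakPartial {N : ℕ} (Ω : Set (EuclideanSpace ℝ (Fin N))) (i : Fin N)
    (u v : EuclideanSpace ℝ (Fin N) → ℝ) : Prop :=
  ∀ φ : EuclideanSpace ℝ (Fin N) → ℝ, ContDiff ℝ ∞ φ → HasCompactSupport φ → tsupport φ ⊆ Ω →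
    ∫ x in Ω, u x * partialDeriv i φ x = -∫ x in Ω, v x * φ x

/-- An element of the (real) Sobolev space `H²(Ω) = W^{2,2}(Ω)`, given by a representative together
with representatives of its weak derivatives of order one and two (these are determined almost
everywhere in `Ω` by the function). -/
structure H2 {N : ℕ} (Ω : Set (EuclideanSpace ℝ (Fin N))) where
  toFun : EuclideanSpace ℝ (Fin N) → ℝ
  grad : Fin N → EuclideanSpace ℝ (Fin N) → ℝ
  hess : Fin N → Fin N → EuclideanSpace ℝ (Fin N) → ℝ
  memLp_toFun : MemLp toFun 2 (volume.restrict Ω)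
  memLp_grad : ∀ i, MemLp (grad i) 2 (volume.restrict Ω)
  memLp_hess : ∀ i j, MemLp (hess i j) 2 (volume.restrict Ω)
  isWeakPartial_grad : ∀ i, IsWeakPartial Ω i toFun (grad i)
  isWeakPartial_hess : ∀ i j, IsWeakPartial Ω j (grad i) (hess i j)

/-- `g ∈ L²(∂Ω)` is the trace of `u` on `∂Ω`: it is the `L²(∂Ω)`-limit of the restrictions to `∂Ω`
of smooth functions that converge to `u` in `H¹(Ω)`. On a bounded domain of class `C^1` every `u`
has a trace, and it is unique almost everywhere on `∂Ω`. -/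
def IsTrace {N : ℕ} {Ω : Set (EuclideanSpace ℝ (Fin N))} (u : H2 Ω)
    (g : EuclideanSpace ℝ (Fin N) → ℝ) : Prop :=
  MemLp g 2 (surfaceMeasure Ω) ∧
  ∃ w : ℕ → EuclideanSpace ℝ (Fin N) → ℝ, (∀ n, ContDiff ℝ ∞ (w n)) ∧
    Tendsto (fun n => eLpNorm (fun x => w n x - u.toFun x) 2 (volume.restrict Ω)) atTop (𝓝 0) ∧
    (∀ i, Tendsto (fun n => eLpNorm (fun x => partialDeriv i (w n) x - u.grad i x) 2
      (volume.restrict Ω)) atTop (𝓝 0)) ∧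
    Tendsto (fun n => eLpNorm (fun x => w n x - g x) 2 (surfaceMeasure Ω)) atTop (𝓝 0)

/-- The bilinear form `∫_Ω D²u : D²φ + τ ∇u · ∇φ dx`. -/
def energy {N : ℕ} {Ω : Set (EuclideanSpace ℝ (Fin N))} (τ : ℝ) (u φ : H2 Ω) : ℝ :=
  ∫ x in Ω, ((∑ i, ∑ j, u.hess i j x * φ.hess i j x) + τ * ∑ i, u.grad i x * φ.grad i x)

/-- `lam` is an eigenvalue of the biharmonic Steklov problem with parameter `τ` in its weak form:
there is `u ∈ H²(Ω)`, `u ≠ 0`, with `∫_Ω D²u : D²φ + τ ∇u · ∇φ dx = lam ∫_∂Ω u φ dσ` for all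
`φ ∈ H²(Ω)`, where the boundary values are traces. -/
def IsSteklovEigenvalue {N : ℕ} (τ : ℝ) (Ω : Set (EuclideanSpace ℝ (Fin N))) (lam : ℝ) : Prop :=
  ∃ (u : H2 Ω) (g : EuclideanSpace ℝ (Fin N) → ℝ), IsTrace u g ∧
    ¬ (∀ᵐ x ∂(volume.restrict Ω), u.toFun x = 0) ∧
    ∀ (φ : H2 Ω) (h : EuclideanSpace ℝ (Fin N) → ℝ), IsTrace φ h →
      energy τ u φ = lam * ∫ x, g x * h x ∂(surfaceMeasure Ω)

/-- The set of positive eigenvalues of the biharmonic Steklov problem. -/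
def positiveEigenvalues {N : ℕ} (τ : ℝ) (Ω : Set (EuclideanSpace ℝ (Fin N))) : Set ℝ :=
  {lam | 0 < lam ∧ IsSteklovEigenvalue τ Ω lam}

/-- The first positive eigenvalue `λ₂(Ω)` of the biharmonic Steklov problem. -/
def lambda2 {N : ℕ} (τ : ℝ) (Ω : Set (EuclideanSpace ℝ (Fin N))) : ℝ :=
  sInf (positiveEigenvalues τ Ω)

/-- The Fraenkel asymmetry: the infimum of `‖χ_Ω - χ_B‖_{L¹} / |Ω|` over balls `B` with
`|B| = |Ω|`. -/
def fraenkelAsymmetry {N : ℕ} (Ω : Set (EuclideanSpace ℝ (Fin N))) : ℝ :=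
  sInf {a : ℝ | ∃ (c : EuclideanSpace ℝ (Fin N)) (r : ℝ), 0 < r ∧
    volume (Metric.ball c r) = volume Ω ∧
    a = (∫ x, |Ω.indicator (fun _ => (1 : ℝ)) x -
      (Metric.ball c r).indicator (fun _ => (1 : ℝ)) x|) / (volume Ω).toReal}

/-- The constant `δ_N = (N + 1) / (8 N) * (2^{1/N} - 1)`. -/
def deltaConst (N : ℕ) : ℝ :=
  ((N : ℝ) + 1) / (8 * (N : ℝ)) * ((2 : ℝ) ^ (1 / (N : ℝ)) - 1)

end

end BiharmonicSteklov

/-!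
The proof compares `λ₂(Ω)` and `λ₂(B)`, for a ball `B` of radius `R` and volume `|Ω|`, through the
quantity `τ / R`.

*Lower bound for the ball* (`le_lambda2_ball`): `τ / R ≤ λ₂(B)`. An eigenfunction for a positive
eigenvalue has mean zero on the boundary. Dropping the Hessian from its energy, the bound is the
sharp Steklov inequality `∫_∂B w² ≤ R ∫_B |∇w|²` for functions of mean zero on the sphere
(`steklov_ball`). Spherical harmonics are avoided. For a function odd with respect to a hyperplane
through the centre, the inequality is Picone's inequality with the linear function vanishing on that
hyperplane (`steklov_ball_odd`). In general, passing to the even part with respect to a reflection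
does not increase the defect of the inequality, and if the reflection exchanges two points at which
the values differ by `ε`, it lowers the boundary norm by a fixed amount. Finitely many such
symmetrisations make the function nearly constant on the sphere, hence nearly zero there.

*Upper bound for the domain* (`exists_lambda2_mul_integral_le`, `integral_norm_le`). The coordinates
centred at the barycentre `m` of the boundary are test functions, and give
`λ₂(Ω) ∫_∂Ω |x - m|² ≤ N τ |Ω|`. The divergence theorem for the field `|x - m| (x - m)` gives
`(N + 1) ∫_Ω |x - m| ≤ ∫_∂Ω |x - m|²`. With `B` centred at `m` and `s = |Ω \ B| / |Ω|`, the first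
moments of `Ω ∩ B` and `Ω ∪ B` are bounded below by those of the centred balls of the same volumes
(`le_integral_norm_sub`), so that

  `(N + 1) ∫_Ω |x - m| ≥ N R |Ω| ((1 + s)^(1 + 1/N) + (1 - s)^(1 + 1/N) - 1)`.

The last factor is at least `1 + (1 + 1/N) (1/N) s²` (`two_add_le_rpow_add_rpow`), and the asymmetry
of `Ω` is at most `2 s` (`fraenkelAsymmetry_mul_le`). The constant `δ_N` comes out of
`2^(1/N) - 1 ≤ 1/N`.

*Existence of `λ₂`* (`exists_isLeast_positiveEigenvalues`). Functions in `H²(Ω)` with a trace form a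
closed subspace of a product of `L²` spaces (`h2Graph`). On its part of boundary mean zero the
energy is coercive and the boundary form compact, so the Rayleigh quotient has a minimiser
(`exists_rayleigh_minimizer`), and the minimum is the least positive eigenvalue. This needs, for
`C^1` functions on a `C^1` domain:
* the area formula for graphs (`comap_graphMap`), by local bi-Lipschitz comparison of the Hausdorff
  measure with Lebesgue measure;
* the divergence theorem with respect to the Hausdorff measure (`exists_normal`), from the area
  formula by flattening the boundary and a partition of unity, and from it the trace inequality
  (`trace_inequality`);
* Rellich's theorem (`rellich`), by comparing functions with their averages over balls, which stay
  inside `Ω` by the cone condition (`exists_cone`);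
* Poincaré's inequality (`poincare`) and the compactness of traces (`rellich_trace`), which follow.
-/

namespace BiharmonicSteklov

/-! ### The area formula for graphs -/

/-- A local comparison of two measures on a second countable space is a global one. -/
theorem measure_le_smul_of_local {X : Type*} [TopologicalSpace X] [SecondCountableTopology X]
    [MeasurableSpace X] [BorelSpace X] {μ₁ μ₂ : Measure X} (C : ENNReal)
    (h : ∀ x, ∃ U ∈ 𝓝 x, ∀ A ⊆ U, MeasurableSet A → μ₁ A ≤ C * μ₂ A) (A : Set X)
    (hA : MeasurableSet A) : μ₁ A ≤ C * μ₂ A := by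
  choose U hU hU' using h
  obtain ⟨s, hsc, hs⟩ := TopologicalSpace.countable_cover_nhds (fun x => interior_mem_nhds.2 (hU x))
  rcases s.eq_empty_or_nonempty with rfl | hne
  · have : A = ∅ := by
      apply Set.eq_empty_of_subset_empty
      intro x _
      have : x ∈ (⋃ x ∈ (∅ : Set X), interior (U x)) := hs ▸ mem_univ x
      simp at this
    simp [this]
  obtain ⟨f, rfl⟩ := hsc.exists_eq_range hne
  set D : ℕ → Set X := disjointed (fun n => interior (U (f n))) with hD
  have hDm : ∀ n, MeasurableSet (D n) :=
    fun n => MeasurableSet.disjointed (fun n => isOpen_interior.measurableSet) n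
  have hDd : Pairwise (Function.onFun Disjoint fun n => A ∩ D n) := fun i j hij =>
    ((disjoint_disjointed _) hij).mono inter_subset_right inter_subset_right
  have hcov : A = ⋃ n, A ∩ D n := by
    rw [← inter_iUnion, hD, iUnion_disjointed]
    have : (⋃ n, interior (U (f n))) = univ := by rw [← hs]; simp
    rw [this, inter_univ]
  rw [hcov, measure_iUnion hDd (fun n => hA.inter (hDm n)),
    measure_iUnion hDd (fun n => hA.inter (hDm n)), ← ENNReal.tsum_mul_left]
  refine ENNReal.tsum_le_tsum fun n => hU' (f n) _ ?_ (hA.inter (hDm n))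
  exact inter_subset_right.trans ((disjointed_subset _ n).trans interior_subset)

/-- An inequality up to a factor `κ ^ d` for every `κ > 1` holds without the factor. -/
theorem ennreal_le_of_forall_pow_mul {a b : ENNReal} (d : ℕ)
    (h : ∀ κ : NNReal, 1 < κ → a ≤ (κ : ENNReal) ^ d * b) : a ≤ b := by
  have ht : Tendsto (fun κ : NNReal => (κ : ENNReal) ^ d * b) (𝓝[>] 1)
      (𝓝 (((1 : NNReal) : ENNReal) ^ d * b)) := by
    have h1 : Tendsto (fun κ : NNReal => (κ : ENNReal) ^ d) (𝓝[>] 1)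
        (𝓝 (((1 : NNReal) : ENNReal) ^ d)) := by
      have : Continuous fun κ : NNReal => (κ : ENNReal) ^ d := by
        simp_rw [← ENNReal.coe_pow]
        exact ENNReal.continuous_coe.comp (continuous_pow d)
      exact (this.tendsto 1).mono_left nhdsWithin_le_nhds
    exact ENNReal.Tendsto.mul_const h1 (Or.inl (by simp))
  have := ge_of_tendsto ht (eventually_nhdsWithin_of_forall fun κ hκ => h κ hκ)
  simpa using this

theorem euclideanHausdorffMeasure_image_le {X Y : Type*} [EMetricSpace X] [MeasurableSpace X]
    [BorelSpace X] [EMetricSpace Y] [MeasurableSpace Y] [BorelSpace Y] {K : NNReal} {f : X → Y}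
    {s : Set X} (h : LipschitzOnWith K f s) (d : ℕ) :
    μHE[d] (f '' s) ≤ (K : ENNReal) ^ d * μHE[d] s := by
  simp_rw [Measure.euclideanHausdorffMeasure_def, Measure.smul_apply]
  have := h.hausdorffMeasure_image_le (d := d) (by positivity)
  rw [ENNReal.rpow_natCast] at this
  rw [mul_smul_comm]
  gcongr

section area

variable {F V : Type*} [NormedAddCommGroup F] [InnerProductSpace ℝ F] [FiniteDimensional ℝ F]
  [MeasurableSpace F] [BorelSpace F] [NormedAddCommGroup V] [InnerProductSpace ℝ V]
  [MeasurableSpace V] [BorelSpace V]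

/-- Area comparison for a map that is `κ`-close to the linear isomorphism `T` in the bi-Lipschitz
sense on `A`. -/
theorem euclideanHausdorffMeasure_image_bilipschitz {Γ : F → V} {A : Set F} {T : F →ₗ[ℝ] F}
    (hT : LinearMap.det T ≠ 0) {κ : NNReal}
    (hup : ∀ y ∈ A, ∀ z ∈ A, ‖Γ y - Γ z‖ ≤ κ * ‖T (y - z)‖)
    (hlo : ∀ y ∈ A, ∀ z ∈ A, ‖T (y - z)‖ ≤ κ * ‖Γ y - Γ z‖) :
    μHE[Module.finrank ℝ F] (Γ '' A) ≤
      (κ : ENNReal) ^ Module.finrank ℝ F * (ENNReal.ofReal |LinearMap.det T| * volume A) ∧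
    ENNReal.ofReal |LinearMap.det T| * volume A ≤
      (κ : ENNReal) ^ Module.finrank ℝ F * μHE[Module.finrank ℝ F] (Γ '' A) := by
  set T' := LinearEquiv.ofIsUnitDet (f := T) (v := Module.finBasis ℝ F) (v' := Module.finBasis ℝ F)
    (by rw [LinearMap.det_toMatrix]; exact isUnit_iff_ne_zero.2 hT) with hT'
  have hTT : ∀ x, T' x = T x := fun x => by simp [hT']
  have hvol : ENNReal.ofReal |LinearMap.det T| * volume A = μHE[Module.finrank ℝ F] (T '' A) := by
    rw [InnerProductSpace.euclideanHausdorffMeasure_eq_volume, Measure.addHaar_image_linearMap]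
  rw [hvol]
  constructor
  · have hL : LipschitzOnWith κ (Γ ∘ T'.symm) (T '' A) := by
      refine LipschitzOnWith.of_dist_le_mul ?_
      rintro _ ⟨y, hy, rfl⟩ _ ⟨z, hz, rfl⟩
      simp only [Function.comp, ← hTT, LinearEquiv.symm_apply_apply]
      rw [dist_eq_norm, dist_eq_norm, hTT, hTT, ← map_sub]
      exact hup y hy z hz
    have := euclideanHausdorffMeasure_image_le hL (Module.finrank ℝ F)
    rwa [← image_comp, show (Γ ∘ T'.symm) ∘ T = Γ by ext x; simp [← hTT]] at this
  · classical
    have hinj : InjOn Γ A := fun y hy z hz h => by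
      have := hlo y hy z hz
      rw [h, sub_self, norm_zero, mul_zero, ← hTT] at this
      have h0 : T' (y - z) = 0 := norm_le_zero_iff.1 this
      exact sub_eq_zero.1 ((LinearEquiv.map_eq_zero_iff T').1 h0)
    rcases A.eq_empty_or_nonempty with rfl | ⟨a, _⟩
    · simp
    have : Nonempty F := ⟨a⟩
    have hL : LipschitzOnWith κ (T ∘ Function.invFunOn Γ A) (Γ '' A) := by
      refine LipschitzOnWith.of_dist_le_mul ?_
      rintro _ ⟨y, hy, rfl⟩ _ ⟨z, hz, rfl⟩
      simp only [Function.comp]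
      rw [hinj.leftInvOn_invFunOn hy, hinj.leftInvOn_invFunOn hz, dist_eq_norm, dist_eq_norm,
        ← map_sub]
      exact hlo y hy z hz
    have := euclideanHausdorffMeasure_image_le hL (Module.finrank ℝ F)
    rwa [image_comp, hinj.leftInvOn_invFunOn.image_image] at this

/-- Area formula for an injective map `Γ` into a Hilbert space which near each point `y` is
bi-Lipschitz close to a linear map of Jacobian `J y`. -/
theorem comap_euclideanHausdorffMeasure {Γ : F → V} (hΓ : MeasurableEmbedding Γ) {J : F → ℝ}
    (hJ : Continuous J) (hJ0 : ∀ y, 0 < J y)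
    (h : ∀ y₀, ∃ T : F →ₗ[ℝ] F, LinearMap.det T = J y₀ ∧ ∀ κ : NNReal, 1 < κ → ∃ U ∈ 𝓝 y₀,
      ∀ y ∈ U, ∀ z ∈ U, ‖Γ y - Γ z‖ ≤ κ * ‖T (y - z)‖ ∧ ‖T (y - z)‖ ≤ κ * ‖Γ y - Γ z‖) :
    (μHE[Module.finrank ℝ F] : Measure V).comap Γ
      = volume.withDensity (fun y => ENNReal.ofReal (J y)) := by
  set d := Module.finrank ℝ F with hd
  -- near each point the two measures agree up to the factor `κ ^ (d + 1)`: `κ ^ d` for the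
  -- distortion of the map, and one more `κ` for the variation of `J`
  have key : ∀ κ : NNReal, 1 < κ → ∀ y₀ : F, ∃ U ∈ 𝓝 y₀, ∀ A ⊆ U, MeasurableSet A →
      (μHE[d] : Measure V).comap Γ A ≤ (κ : ENNReal) ^ (d + 1) *
        volume.withDensity (fun y => ENNReal.ofReal (J y)) A ∧
      volume.withDensity (fun y => ENNReal.ofReal (J y)) A ≤
        (κ : ENNReal) ^ (d + 1) * (μHE[d] : Measure V).comap Γ A := by
    intro κ hκ y₀
    obtain ⟨T, hT, hT'⟩ := h y₀
    obtain ⟨U, hU, hU'⟩ := hT' κ hκ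
    have hκ' : (1 : ℝ) < κ := by exact_mod_cast hκ
    have h1 : ∀ᶠ y in 𝓝 y₀, J y < κ * J y₀ :=
      hJ.continuousAt.eventually_lt_const (by nlinarith [hJ0 y₀])
    have h2 : ∀ᶠ y in 𝓝 y₀, J y₀ < κ * J y :=
      (continuous_const.mul hJ).continuousAt.eventually_const_lt
        (show J y₀ < κ * J y₀ by nlinarith [hJ0 y₀])
    refine ⟨U ∩ {y | J y < κ * J y₀ ∧ J y₀ < κ * J y}, inter_mem hU (h1.and h2), ?_⟩
    intro A hA hAm
    have hbl := euclideanHausdorffMeasure_image_bilipschitz (Γ := Γ) (A := A) (T := T)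
      (by rw [hT]; exact (hJ0 y₀).ne') (κ := κ)
      (fun y hy z hz => (hU' y (hA hy).1 z (hA hz).1).1)
      (fun y hy z hz => (hU' y (hA hy).1 z (hA hz).1).2)
    rw [hT, abs_of_pos (hJ0 y₀)] at hbl
    rw [hΓ.comap_apply, withDensity_apply _ hAm]
    have hJm : ∀ y ∈ A, ENNReal.ofReal (J y₀) ≤ κ * ENNReal.ofReal (J y) := fun y hy => by
      rw [← ENNReal.ofReal_coe_nnreal, ← ENNReal.ofReal_mul (by positivity)]
      exact ENNReal.ofReal_le_ofReal (hA hy).2.2.le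
    have hJm' : ∀ y ∈ A, ENNReal.ofReal (J y) ≤ κ * ENNReal.ofReal (J y₀) := fun y hy => by
      rw [← ENNReal.ofReal_coe_nnreal, ← ENNReal.ofReal_mul (by positivity)]
      exact ENNReal.ofReal_le_ofReal (hA hy).2.1.le
    have hJmeas : Measurable fun y => ENNReal.ofReal (J y) := hJ.measurable.ennreal_ofReal
    have hI1 : ENNReal.ofReal (J y₀) * volume A ≤ κ * ∫⁻ y in A, ENNReal.ofReal (J y) := by
      rw [← lintegral_const_mul _ hJmeas, ← setLIntegral_const]
      exact setLIntegral_mono (hJmeas.const_mul _) hJm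
    have hI2 : ∫⁻ y in A, ENNReal.ofReal (J y) ≤ κ * (ENNReal.ofReal (J y₀) * volume A) := by
      rw [← setLIntegral_const, ← lintegral_const_mul _ measurable_const]
      exact setLIntegral_mono (measurable_const.const_mul _) hJm'
    constructor
    · calc _ ≤ _ := hbl.1
        _ ≤ (κ : ENNReal) ^ d * (κ * ∫⁻ y in A, ENNReal.ofReal (J y)) := by gcongr
        _ = _ := by rw [pow_succ, mul_assoc]
    · calc _ ≤ _ := hI2
        _ ≤ κ * ((κ : ENNReal) ^ d * μHE[d] (Γ '' A)) := mul_le_mul_right hbl.2 _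
        _ = _ := by rw [pow_succ']; ring
  ext A hA
  apply le_antisymm
  · refine ennreal_le_of_forall_pow_mul (d + 1) fun κ hκ => ?_
    refine measure_le_smul_of_local _ (fun x => ?_) A hA
    obtain ⟨U, hU, h⟩ := key κ hκ x
    exact ⟨U, hU, fun A hA hm => (h A hA hm).1⟩
  · refine ennreal_le_of_forall_pow_mul (d + 1) fun κ hκ => ?_
    refine measure_le_smul_of_local _ (fun x => ?_) A hA
    obtain ⟨U, hU, h⟩ := key κ hκ x
    exact ⟨U, hU, fun A hA hm => (h A hA hm).2⟩

end area

section graph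

variable {V : Type*} [NormedAddCommGroup V] [InnerProductSpace ℝ V]

/-- The graph map of `γ` over the hyperplane orthogonal to `e`. -/
noncomputable def graphMap (e : V) (γ : (ℝ ∙ e)ᗮ → ℝ) (y : (ℝ ∙ e)ᗮ) : V := (y : V) + γ y • e

/-- The area density `√(1 + |∇γ|²)` of the graph of `γ`. -/
noncomputable def graphJacobian {F : Type*} [NormedAddCommGroup F] [InnerProductSpace ℝ F]
    (γ : F → ℝ) (y : F) : ℝ := √(1 + ‖fderiv ℝ γ y‖ ^ 2)

theorem inner_orthogonal_coe (e : V) (y : (ℝ ∙ e)ᗮ) : ⟪e, (y : V)⟫ = 0 :=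
  Submodule.mem_orthogonal_singleton_iff_inner_right.1 y.2

theorem norm_add_smul_sq {e : V} (he : ‖e‖ = 1) (y : (ℝ ∙ e)ᗮ) (t : ℝ) :
    ‖(y : V) + t • e‖ ^ 2 = ‖y‖ ^ 2 + t ^ 2 := by
  rw [norm_add_sq_real, inner_smul_right, real_inner_comm, inner_orthogonal_coe, norm_smul, he]
  simp

theorem inner_graphMap {e : V} (he : ‖e‖ = 1) (γ : (ℝ ∙ e)ᗮ → ℝ) (y : (ℝ ∙ e)ᗮ) :
    ⟪e, graphMap e γ y⟫ = γ y := by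
  rw [graphMap, inner_add_right, inner_orthogonal_coe, inner_smul_right, real_inner_self_eq_norm_sq,
    he]
  simp

theorem orthogonalProjectionOnto_add_smul (e : V) (y : (ℝ ∙ e)ᗮ) (t : ℝ) :
    (ℝ ∙ e)ᗮ.orthogonalProjectionOnto ((y : V) + t • e) = y := by
  rw [map_add, map_smul, Submodule.orthogonalProjectionOnto_mem_subspace_eq_self]
  have : (ℝ ∙ e)ᗮ.orthogonalProjectionOnto e = 0 :=
    Submodule.orthogonalProjectionOnto_orthogonalComplement_singleton_eq_zero e
  rw [this]; simp

theorem eq_orthogonalProjectionOnto_add_smul {e : V} (he : ‖e‖ = 1) (x : V) :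
    ((ℝ ∙ e)ᗮ.orthogonalProjectionOnto x : V) + ⟪e, x⟫ • e = x := by
  have := Submodule.starProjection_add_starProjection_orthogonal (K := (ℝ ∙ e)) x
  rw [Submodule.starProjection_unit_singleton ℝ he, add_comm] at this
  exact this

theorem measurableEmbedding_graphMap [FiniteDimensional ℝ V] [MeasurableSpace V] [BorelSpace V]
    (e : V) {γ : (ℝ ∙ e)ᗮ → ℝ} (hγ : Continuous γ) : MeasurableEmbedding (graphMap e γ) := by
  have hc : Continuous (graphMap e γ) := by unfold graphMap; fun_prop
  refine hc.measurableEmbedding fun y z h => ?_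
  have := congrArg ((ℝ ∙ e)ᗮ.orthogonalProjectionOnto) h
  rwa [graphMap, graphMap, orthogonalProjectionOnto_add_smul, orthogonalProjectionOnto_add_smul]
    at this

/-- The lengths `√(m² + s²)` and `√(m² + t²)` have ratio at most `1 + ε` if `|s - t| ≤ ε m`. It
compares the increments of a graph map with those of its linearisation. -/
theorem sqrt_add_sq_le {A B m s t ε : ℝ} (hB0 : 0 ≤ B) (hε : 0 ≤ ε)
    (hA : A ^ 2 = m ^ 2 + s ^ 2) (hB : B ^ 2 = m ^ 2 + t ^ 2) (hst : |s - t| ≤ ε * m) :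
    A ≤ (1 + ε) * B := by
  have h1 : |s| ≤ |t| + ε * m := by
    have := abs_add_le t (s - t)
    rw [add_sub_cancel] at this
    linarith
  have h2 : s ^ 2 ≤ (|t| + ε * m) ^ 2 := by
    rw [← sq_abs s]; gcongr
  have h3 : |t| * m ≤ B ^ 2 := by
    nlinarith [sq_nonneg (|t| - m), sq_abs t, sq_nonneg t, sq_nonneg m]
  have h4 : A ^ 2 ≤ ((1 + ε) * B) ^ 2 := by
    rw [hA]
    have h5 : ε * (|t| * m) ≤ ε * B ^ 2 := by gcongr
    have h6 : ε ^ 2 * m ^ 2 ≤ ε ^ 2 * B ^ 2 := by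
      gcongr ?_ * ?_
      nlinarith [sq_nonneg t]
    nlinarith [sq_abs t]
  exact le_of_sq_le_sq h4 (by positivity)

/-- Area formula for the graph of a `C^1` function over a hyperplane. -/
theorem comap_graphMap [FiniteDimensional ℝ V] [MeasurableSpace V] [BorelSpace V]
    {e : V} (he : ‖e‖ = 1) {γ : (ℝ ∙ e)ᗮ → ℝ} (hγ : ContDiff ℝ 1 γ) :
    (μHE[Module.finrank ℝ V - 1] : Measure V).comap (graphMap e γ)
      = volume.withDensity (fun y => ENNReal.ofReal (graphJacobian γ y)) := by
  have hrank : Module.finrank ℝ V - 1 = Module.finrank ℝ (ℝ ∙ e)ᗮ := by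
    have h1 := (ℝ ∙ e).finrank_add_finrank_orthogonal
    rw [finrank_span_singleton (by rintro rfl; simp at he)] at h1
    omega
  rw [hrank]
  have hcd : Continuous (fderiv ℝ γ) := hγ.continuous_fderiv one_ne_zero
  refine comap_euclideanHausdorffMeasure (measurableEmbedding_graphMap e hγ.continuous)
    (by unfold graphJacobian; fun_prop) (fun y => Real.sqrt_pos.2 (by positivity)) fun y₀ => ?_
  set a := (InnerProductSpace.toDual ℝ _).symm (fderiv ℝ γ y₀) with ha
  have haf : ∀ v, fderiv ℝ γ y₀ v = ⟪a, v⟫ := fun v => by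
    rw [ha, InnerProductSpace.toDual_symm_apply]
  have hna : ‖fderiv ℝ γ y₀‖ = ‖a‖ := by rw [ha, LinearIsometryEquiv.norm_map]
  set J := graphJacobian γ y₀ with hJ
  have hJ2 : J ^ 2 = 1 + ‖a‖ ^ 2 := by
    rw [hJ, graphJacobian, Real.sq_sqrt (by positivity), hna]
  have hJ0 : 0 < J := Real.sqrt_pos.2 (by positivity)
  -- `T` is the symmetric square root of `1 + a ⊗ a`;
  -- its determinant is the Jacobian, and `‖T v‖` is the length of the tangent vector over `v`
  set T := LinearMap.transvection (fderiv ℝ γ y₀ : _ →ₗ[ℝ] ℝ) ((1 + J)⁻¹ • a) with hT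
  have hTn : ∀ v, ‖T v‖ ^ 2 = ‖v‖ ^ 2 + (fderiv ℝ γ y₀ v) ^ 2 := fun v => by
    have : T v = v + ((fderiv ℝ γ y₀ v) * (1 + J)⁻¹) • a := by
      rw [hT, LinearMap.transvection.apply, smul_smul]; rfl
    rw [this, norm_add_sq_real, inner_smul_right, real_inner_comm, ← haf, norm_smul, mul_pow,
      Real.norm_eq_abs, sq_abs, show ‖a‖ ^ 2 = J ^ 2 - 1 by linarith]
    field_simp
    ring
  refine ⟨T, ?_, fun κ hκ => ?_⟩
  · rw [hT, LinearMap.transvection.det]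
    change 1 + fderiv ℝ γ y₀ ((1 + J)⁻¹ • a) = J
    rw [haf, inner_smul_right, real_inner_self_eq_norm_sq, show ‖a‖ ^ 2 = J ^ 2 - 1 by linarith]
    field_simp
    ring
  · have hκ' : (0 : ℝ) < κ - 1 := by
      have : (1 : ℝ) < κ := by exact_mod_cast hκ
      linarith
    have hs : HasStrictFDerivAt γ (fderiv ℝ γ y₀) y₀ :=
      hγ.contDiffAt.hasStrictFDerivAt one_ne_zero
    have := hs.isLittleO.def hκ'
    rw [nhds_prod_eq, Filter.Eventually, mem_prod_self_iff] at this
    obtain ⟨U, hU, hU'⟩ := this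
    refine ⟨U, hU, fun y hy z hz => ?_⟩
    have h1 := hU' (mk_mem_prod hy hz)
    simp only [mem_ofPred_eq] at h1
    rw [Real.norm_eq_abs] at h1
    have hG : ‖graphMap e γ y - graphMap e γ z‖ ^ 2 = ‖y - z‖ ^ 2 + (γ y - γ z) ^ 2 := by
      rw [← norm_add_smul_sq he, graphMap, graphMap]
      congr 2
      push_cast
      module
    have e1 : (κ : ℝ) = 1 + (κ - 1) := by ring
    constructor
    · rw [e1]
      exact sqrt_add_sq_le (norm_nonneg _) hκ'.le hG (hTn _) h1
    · rw [e1]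
      rw [abs_sub_comm] at h1
      exact sqrt_add_sq_le (norm_nonneg _) hκ'.le (hTn _) hG h1

end graph

/-! ### Flattening, and integration above a graph -/

section flatten

variable {V : Type*} [NormedAddCommGroup V] [InnerProductSpace ℝ V]

/-- The coordinates `(y, s) ↦ y + (γ y + s) e` which flatten the graph of `γ` to `{s = 0}` and the
region above it to `{s > 0}`. -/
noncomputable def flatten {e : V} (he : ‖e‖ = 1) {γ : (ℝ ∙ e)ᗮ → ℝ} (hγ : Continuous γ) :
    ((ℝ ∙ e)ᗮ × ℝ) ≃ₜ V where
  toFun q := (q.1 : V) + (γ q.1 + q.2) • e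
  invFun x := ((ℝ ∙ e)ᗮ.orthogonalProjectionOnto x,
    ⟪e, x⟫ - γ ((ℝ ∙ e)ᗮ.orthogonalProjectionOnto x))
  left_inv q := by
    ext1
    · simp only [orthogonalProjectionOnto_add_smul]
    · simp only [orthogonalProjectionOnto_add_smul]
      rw [inner_add_right, inner_orthogonal_coe, inner_smul_right, real_inner_self_eq_norm_sq, he]
      ring
  right_inv x := by
    simp only [add_sub_cancel]
    exact eq_orthogonalProjectionOnto_add_smul he x
  continuous_toFun := by fun_prop
  continuous_invFun := by fun_prop

theorem flatten_apply {e : V} (he : ‖e‖ = 1) {γ : (ℝ ∙ e)ᗮ → ℝ} (hγ : Continuous γ)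
    (q : (ℝ ∙ e)ᗮ × ℝ) : flatten he hγ q = (q.1 : V) + (γ q.1 + q.2) • e := rfl

theorem proj_flatten {e : V} (he : ‖e‖ = 1) {γ : (ℝ ∙ e)ᗮ → ℝ} (hγ : Continuous γ)
    (q : (ℝ ∙ e)ᗮ × ℝ) : (ℝ ∙ e)ᗮ.orthogonalProjectionOnto (flatten he hγ q) = q.1 :=
  orthogonalProjectionOnto_add_smul _ _ _

theorem inner_flatten {e : V} (he : ‖e‖ = 1) {γ : (ℝ ∙ e)ᗮ → ℝ} (hγ : Continuous γ)
    (q : (ℝ ∙ e)ᗮ × ℝ) : ⟪e, flatten he hγ q⟫ = γ q.1 + q.2 := by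
  rw [flatten_apply, inner_add_right, inner_orthogonal_coe, inner_smul_right,
    real_inner_self_eq_norm_sq, he]
  ring

variable [FiniteDimensional ℝ V] [MeasurableSpace V] [BorelSpace V]

theorem measurePreserving_flatten {e : V} (he : ‖e‖ = 1) {γ : (ℝ ∙ e)ᗮ → ℝ} (hγ : Continuous γ) :
    MeasurePreserving (flatten he hγ) := by
  let L : WithLp 2 ((ℝ ∙ e)ᗮ × ℝ) ≃ₗᵢ[ℝ] V := LinearIsometryEquiv.ofSurjective
    { toFun := fun q => (q.fst : V) + q.snd • e
      map_add' := fun p q => by simp only [WithLp.add_fst, WithLp.add_snd]; push_cast; module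
      map_smul' := fun c q => by
        simp only [WithLp.smul_fst, WithLp.smul_snd, smul_eq_mul, RingHom.id_apply]; push_cast
        module
      norm_map' := fun q => by
        change ‖(q.fst : V) + q.snd • e‖ = ‖q‖
        rw [← sq_eq_sq₀ (norm_nonneg _) (norm_nonneg _), norm_add_smul_sq he,
          WithLp.prod_norm_sq_eq_of_L2, Real.norm_eq_abs, sq_abs] }
    (fun x => ⟨WithLp.toLp 2 ((ℝ ∙ e)ᗮ.orthogonalProjectionOnto x, ⟪e, x⟫),
      eq_orthogonalProjectionOnto_add_smul he x⟩)
  have h1 : MeasurePreserving (fun q : (ℝ ∙ e)ᗮ × ℝ => L (WithLp.toLp 2 q)) :=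
    L.measurePreserving.comp (WithLp.volume_preserving_toLp _ _)
  have h2 : MeasurePreserving (fun q : (ℝ ∙ e)ᗮ × ℝ => (q.1, γ q.1 + q.2)) := by
    refine (MeasurePreserving.id volume).skew_product (μc := volume) (μd := volume)
      (g := fun y s => γ y + s) ?_ ?_
    · exact ((hγ.comp continuous_fst).add continuous_snd).measurable
    · exact Eventually.of_forall fun y => (measurePreserving_add_left volume (γ y)).map_eq
  exact h1.comp h2

theorem measurableEmbedding_flatten {e : V} (he : ‖e‖ = 1) {γ : (ℝ ∙ e)ᗮ → ℝ}
    (hγ : Continuous γ) : MeasurableEmbedding (flatten he hγ) :=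
  (flatten he hγ).measurableEmbedding

/-- The integral of a derivative of a compactly supported `C^1` function vanishes. -/
theorem integral_fderiv_apply_eq_zero {F : Type*} [NormedAddCommGroup F] [NormedSpace ℝ F]
    [FiniteDimensional ℝ F] [MeasurableSpace F] [BorelSpace F] (μ : Measure F)
    [μ.IsAddHaarMeasure] {f : F → ℝ} (hf : ContDiff ℝ 1 f) (hc : HasCompactSupport f) (v : F) :
    ∫ x, fderiv ℝ f x v ∂μ = 0 := by
  have hcd : Continuous fun x => fderiv ℝ f x v :=
    (hf.continuous_fderiv one_ne_zero).clm_apply continuous_const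
  have := integral_mul_fderiv_eq_neg_fderiv_mul_of_integrable (μ := μ) (f := f) (g := fun _ => 1)
    (v := v) (by simpa using hcd.integrable_of_hasCompactSupport (hc.fderiv_apply ℝ v))
    (by simp) (by simpa using hf.continuous.integrable_of_hasCompactSupport hc)
    (fun x _ => hf.differentiable one_ne_zero x) (fun x _ => by fun_prop)
  simpa using this

/-- Integral of a directional derivative over the region above the graph of `γ`, expressed in the
parametrisation of the graph. -/
theorem integral_fderiv_above_graph {e : V} (he : ‖e‖ = 1) {γ : (ℝ ∙ e)ᗮ → ℝ}
    (hγ : ContDiff ℝ 1 γ) {η : V → ℝ} (hη : ContDiff ℝ 1 η) (hc : HasCompactSupport η) (v : V) :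
    ∫ x in {x | γ ((ℝ ∙ e)ᗮ.orthogonalProjectionOnto x) < ⟪e, x⟫}, fderiv ℝ η x v =
      -∫ y, (⟪e, v⟫ - fderiv ℝ γ y ((ℝ ∙ e)ᗮ.orthogonalProjectionOnto v)) *
        η (graphMap e γ y) := by
  set Ψ := flatten he hγ.continuous with hΨ
  set v₀ := (ℝ ∙ e)ᗮ.orthogonalProjectionOnto v with hv₀
  set a := ⟪e, v⟫ with ha
  have hv : (v₀ : V) + a • e = v := eq_orthogonalProjectionOnto_add_smul he v
  have hΨd : ContDiff ℝ 1 Ψ := by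
    have : (Ψ : (ℝ ∙ e)ᗮ × ℝ → V) = fun q => (q.1 : V) + (γ q.1 + q.2) • e := rfl
    rw [this]
    have hs : ContDiff ℝ 1 fun q : (ℝ ∙ e)ᗮ × ℝ => (q.1 : V) :=
      ((ℝ ∙ e)ᗮ.subtypeL.contDiff).comp contDiff_fst
    exact hs.add (((hγ.comp contDiff_fst).add contDiff_snd).smul contDiff_const)
  set H : (ℝ ∙ e)ᗮ × ℝ → ℝ := η ∘ Ψ with hH
  have hHd : ContDiff ℝ 1 H := hη.comp hΨd
  have hHc : HasCompactSupport H := hc.comp_homeomorph Ψ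
  have hHf : Continuous (fderiv ℝ H) := hHd.continuous_fderiv one_ne_zero
  have hpre : Ψ ⁻¹' {x | γ ((ℝ ∙ e)ᗮ.orthogonalProjectionOnto x) < ⟪e, x⟫} = univ ×ˢ Ioi 0 := by
    ext q
    simp only [mem_preimage, mem_ofPred_eq, mem_prod, mem_univ, true_and, mem_Ioi]
    rw [hΨ, proj_flatten, inner_flatten]
    simp
  rw [← (measurePreserving_flatten he hγ.continuous).setIntegral_preimage_emb
    (measurableEmbedding_flatten he hγ.continuous), ← hΨ, hpre]
  have hder : ∀ q w b, fderiv ℝ H q (w, b) =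
      fderiv ℝ η (Ψ q) ((w : V) + (fderiv ℝ γ q.1 w + b) • e) := by
    intro q w b
    have h1 : HasFDerivAt Ψ ((ℝ ∙ e)ᗮ.subtypeL.comp (ContinuousLinearMap.fst ℝ _ ℝ) +
        (((fderiv ℝ γ q.1).comp (ContinuousLinearMap.fst ℝ _ ℝ)) +
          ContinuousLinearMap.snd ℝ _ ℝ).smulRight e) q := by
      have hγ1 : HasFDerivAt γ (fderiv ℝ γ q.1) q.1 :=
        (hγ.differentiable one_ne_zero q.1).hasFDerivAt
      have h2 := ((hγ1.comp q hasFDerivAt_fst).add hasFDerivAt_snd).smul_const e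
      exact (((ℝ ∙ e)ᗮ.subtypeL.hasFDerivAt).comp q hasFDerivAt_fst).add h2
    have h3 := ((hη.differentiable one_ne_zero (Ψ q)).hasFDerivAt).comp q h1
    rw [hH, h3.fderiv]
    simp
  have hsplit : ∀ q : (ℝ ∙ e)ᗮ × ℝ, fderiv ℝ η (Ψ q) v =
      fderiv ℝ H q (v₀, 0) + (a - fderiv ℝ γ q.1 v₀) * fderiv ℝ H q (0, 1) := by
    intro q
    rw [hder, hder, ← smul_eq_mul, ← map_smul, ← map_add]
    congr 1
    conv_lhs => rw [← hv]
    simp only [map_zero, Submodule.coe_zero]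
    module
  simp_rw [hsplit]
  have hc1 : Continuous fun q => fderiv ℝ H q (v₀, 0) := hHf.clm_apply continuous_const
  have hc2 : Continuous fun q => fderiv ℝ H q (0, 1) := hHf.clm_apply continuous_const
  have hγc : Continuous fun q : (ℝ ∙ e)ᗮ × ℝ => a - fderiv ℝ γ q.1 v₀ :=
    continuous_const.sub
      (((hγ.continuous_fderiv one_ne_zero).comp continuous_fst).clm_apply continuous_const)
  have hi1 : Integrable fun q => fderiv ℝ H q (v₀, 0) :=
    hc1.integrable_of_hasCompactSupport (hHc.fderiv_apply ℝ _)
  have hi2 : Integrable fun q => (a - fderiv ℝ γ q.1 v₀) * fderiv ℝ H q (0, 1) :=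
    (hγc.mul hc2).integrable_of_hasCompactSupport ((hHc.fderiv_apply ℝ _).mul_left)
  rw [integral_add hi1.integrableOn hi2.integrableOn]
  have e1 : ∫ q in univ ×ˢ Ioi 0, fderiv ℝ H q (v₀, 0) = 0 := by
    rw [Measure.volume_eq_prod, ← Measure.prod_restrict, Measure.restrict_univ, integral_prod_symm]
    · refine integral_eq_zero_of_ae (Eventually.of_forall fun s => ?_)
      have hemb : IsClosedEmbedding fun y : (ℝ ∙ e)ᗮ => (y, s) := by
        refine IsClosedEmbedding.of_continuous_injective_isClosedMap (by fun_prop)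
          (fun a b h => (Prod.ext_iff.1 h).1) ?_
        intro C hC
        have : (fun y : (ℝ ∙ e)ᗮ => (y, s)) '' C = C ×ˢ {s} := by
          ext ⟨x, t⟩
          constructor
          · rintro ⟨a, ha, h⟩
            obtain ⟨rfl, rfl⟩ := Prod.mk.inj h
            exact ⟨ha, rfl⟩
          · rintro ⟨hx, rfl⟩
            exact ⟨x, hx, rfl⟩
        rw [this]
        exact hC.prod isClosed_singleton
      have hd : ContDiff ℝ 1 fun y : (ℝ ∙ e)ᗮ => H (y, s) := by fun_prop
      have := integral_fderiv_apply_eq_zero volume hd (hHc.comp_isClosedEmbedding hemb) v₀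
      refine Eq.trans (integral_congr_ae (Eventually.of_forall fun y => ?_)) this
      have h1 : HasFDerivAt (fun y : (ℝ ∙ e)ᗮ => (y, s)) (ContinuousLinearMap.inl ℝ _ ℝ) y :=
        (hasFDerivAt_id y).prodMk (hasFDerivAt_const s y)
      have h2 := ((hHd.differentiable one_ne_zero (y, s)).hasFDerivAt).comp y h1
      have h3 := h2.fderiv
      simp only [Function.comp_def] at h3
      simp [h3]
    · have := hi1.integrableOn (s := univ ×ˢ Ioi (0 : ℝ))
      rwa [IntegrableOn, Measure.volume_eq_prod, ← Measure.prod_restrict, Measure.restrict_univ]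
        at this
  have e2 : ∫ q in univ ×ˢ Ioi 0, (a - fderiv ℝ γ q.1 v₀) * fderiv ℝ H q (0, 1) =
      -∫ y, (a - fderiv ℝ γ y v₀) * η (graphMap e γ y) := by
    rw [Measure.volume_eq_prod, setIntegral_prod _ hi2.integrableOn, Measure.restrict_univ,
      ← integral_neg]
    refine integral_congr_ae (Eventually.of_forall fun y => ?_)
    simp only
    rw [integral_const_mul]
    have hemb : IsClosedEmbedding fun s : ℝ => (y, s) := by
        refine IsClosedEmbedding.of_continuous_injective_isClosedMap (by fun_prop)
          (fun a b h => (Prod.ext_iff.1 h).2) ?_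
        intro C hC
        have : (fun s : ℝ => (y, s)) '' C = {y} ×ˢ C := by
          ext ⟨x, t⟩
          constructor
          · rintro ⟨a, ha, h⟩
            obtain ⟨rfl, rfl⟩ := Prod.mk.inj h
            exact ⟨rfl, ha⟩
          · rintro ⟨rfl, hx⟩
            exact ⟨t, hx, rfl⟩
        rw [this]
        exact isClosed_singleton.prod hC
    have hd : ContDiff ℝ 1 fun s : ℝ => H (y, s) := by fun_prop
    have := (hHc.comp_isClosedEmbedding hemb).integral_Ioi_deriv_eq hd 0
    have h4 : ∀ s, deriv (fun s => H (y, s)) s = fderiv ℝ H (y, s) (0, 1) := fun s => by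
      have h1 : HasDerivAt (fun s : ℝ => (y, s)) (0, 1) s :=
        (hasDerivAt_const s y).prodMk (hasDerivAt_id s)
      exact (((hHd.differentiable one_ne_zero (y, s)).hasFDerivAt).comp_hasDerivAt s h1).deriv
    simp_rw [← h4]
    refine (congrArg _ this).trans ?_
    simp [hH, hΨ, flatten_apply, graphMap]
  rw [e1, e2, zero_add]

end flatten

/-! ### Graph charts and the local divergence theorem -/

section chart

variable {N : ℕ} {Ω : Set (EuclideanSpace ℝ (Fin N))} {p e : EuclideanSpace ℝ (Fin N)}
  {γ : (ℝ ∙ e)ᗮ → ℝ} {r : ℝ}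

/-- In the ball of radius `r` about `p`, the set `Ω` is the region above the graph of `γ`, with `e`
pointing upwards. -/
structure IsGraphChart (Ω : Set (EuclideanSpace ℝ (Fin N))) (p e : EuclideanSpace ℝ (Fin N))
    (γ : (ℝ ∙ e)ᗮ → ℝ) (r : ℝ) : Prop where
  norm_eq : ‖e‖ = 1
  contDiff : ContDiff ℝ 1 γ
  pos : 0 < r
  mem_iff : ∀ x ∈ Metric.ball p r, x ∈ Ω ↔ γ ((ℝ ∙ e)ᗮ.orthogonalProjectionOnto x) < ⟪e, x⟫

/-- The unit normal of the graph of `γ` pointing to the region below it, extended constantly in the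
vertical direction. -/
noncomputable def graphNormal (γ : (ℝ ∙ e)ᗮ → ℝ) (x : EuclideanSpace ℝ (Fin N)) :
    EuclideanSpace ℝ (Fin N) :=
  -((graphJacobian γ ((ℝ ∙ e)ᗮ.orthogonalProjectionOnto x))⁻¹ •
    (e - ((InnerProductSpace.toDual ℝ _).symm
      (fderiv ℝ γ ((ℝ ∙ e)ᗮ.orthogonalProjectionOnto x)) : (ℝ ∙ e)ᗮ)))

theorem graphJacobian_pos {F : Type*} [NormedAddCommGroup F] [InnerProductSpace ℝ F] (γ : F → ℝ)
    (y : F) : 0 < graphJacobian γ y := Real.sqrt_pos.2 (by positivity)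

theorem continuous_graphJacobian {F : Type*} [NormedAddCommGroup F] [InnerProductSpace ℝ F]
    {γ : F → ℝ} (hγ : ContDiff ℝ 1 γ) : Continuous (graphJacobian γ) := by
  have := hγ.continuous_fderiv one_ne_zero
  unfold graphJacobian
  fun_prop

theorem continuous_graphNormal (hγ : ContDiff ℝ 1 γ) : Continuous (graphNormal γ) := by
  have h1 := continuous_graphJacobian hγ
  have h2 := hγ.continuous_fderiv one_ne_zero
  unfold graphNormal
  have h3 : Continuous fun x : EuclideanSpace ℝ (Fin N) =>
      (graphJacobian γ ((ℝ ∙ e)ᗮ.orthogonalProjectionOnto x))⁻¹ :=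
    (h1.comp (by fun_prop)).inv₀ fun x => (graphJacobian_pos _ _).ne'
  refine (h3.smul (continuous_const.sub ?_)).neg
  exact continuous_subtype_val.comp
    ((LinearIsometryEquiv.continuous _).comp (h2.comp (by fun_prop)))

theorem norm_sub_coe_sq (he : ‖e‖ = 1) (a : (ℝ ∙ e)ᗮ) :
    ‖e - (a : EuclideanSpace ℝ (Fin N))‖ ^ 2 = 1 + ‖a‖ ^ 2 := by
  rw [norm_sub_sq_real, inner_orthogonal_coe, he]; simp

theorem norm_graphNormal (he : ‖e‖ = 1) (x : EuclideanSpace ℝ (Fin N)) :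
    ‖graphNormal γ x‖ = 1 := by
  have hJ := graphJacobian_pos γ ((ℝ ∙ e)ᗮ.orthogonalProjectionOnto x)
  rw [graphNormal, norm_neg, norm_smul, norm_inv, Real.norm_of_nonneg hJ.le,
    inv_mul_eq_one₀ hJ.ne', ← sq_eq_sq₀ hJ.le (norm_nonneg _), norm_sub_coe_sq he, graphJacobian,
    Real.sq_sqrt (by positivity), LinearIsometryEquiv.norm_map]

/-- The flux density of the field `v` through the graph, in the parametrisation of the graph. -/
theorem jacobian_mul_inner_graphNormal (x v : EuclideanSpace ℝ (Fin N)) :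
    graphJacobian γ ((ℝ ∙ e)ᗮ.orthogonalProjectionOnto x) * ⟪graphNormal γ x, v⟫ =
      -(⟪e, v⟫ - fderiv ℝ γ ((ℝ ∙ e)ᗮ.orthogonalProjectionOnto x)
        ((ℝ ∙ e)ᗮ.orthogonalProjectionOnto v)) := by
  have hJ := graphJacobian_pos γ ((ℝ ∙ e)ᗮ.orthogonalProjectionOnto x)
  set a := (InnerProductSpace.toDual ℝ _).symm
    (fderiv ℝ γ ((ℝ ∙ e)ᗮ.orthogonalProjectionOnto x)) with ha
  rw [graphNormal, inner_neg_left, real_inner_smul_left, inner_sub_left, ← ha,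
    ← Submodule.inner_orthogonalProjectionOnto_eq_of_mem_left, ha,
    InnerProductSpace.toDual_symm_apply]
  field_simp

theorem inner_graphNormal_neg (he : ‖e‖ = 1) (x : EuclideanSpace ℝ (Fin N)) :
    ⟪graphNormal γ x, e⟫ < 0 := by
  have hJ := graphJacobian_pos γ ((ℝ ∙ e)ᗮ.orthogonalProjectionOnto x)
  have h := jacobian_mul_inner_graphNormal (γ := γ) x e
  have h0 : (ℝ ∙ e)ᗮ.orthogonalProjectionOnto e = 0 :=
    Submodule.orthogonalProjectionOnto_orthogonalComplement_singleton_eq_zero e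
  rw [h0, map_zero, real_inner_self_eq_norm_sq, he] at h
  by_contra hcon
  push Not at hcon
  nlinarith [mul_nonneg hJ.le hcon]

/-- In a chart, the boundary of `Ω` is the graph. -/
theorem IsGraphChart.mem_frontier_iff (h : IsGraphChart Ω p e γ r) (hΩ : IsOpen Ω)
    {x : EuclideanSpace ℝ (Fin N)} (hx : x ∈ Metric.ball p r) :
    x ∈ frontier Ω ↔ γ ((ℝ ∙ e)ᗮ.orthogonalProjectionOnto x) = ⟪e, x⟫ := by
  have hγ := h.contDiff.continuous
  have hc1 : Continuous fun x : EuclideanSpace ℝ (Fin N) =>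
    γ ((ℝ ∙ e)ᗮ.orthogonalProjectionOnto x) := by fun_prop
  have hc2 : Continuous fun x : EuclideanSpace ℝ (Fin N) => ⟪e, x⟫ := by fun_prop
  rw [hΩ.frontier_eq]
  constructor
  · rintro ⟨hcl, hnot⟩
    rw [h.mem_iff x hx, not_lt] at hnot
    refine le_antisymm ?_ hnot
    by_contra hlt
    push Not at hlt
    have hev : ∀ᶠ z in 𝓝 x, z ∉ Ω := by
      filter_upwards [hc2.continuousAt.eventually_lt hc1.continuousAt hlt,
        Metric.isOpen_ball.mem_nhds hx] with z hz hzb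
      rw [h.mem_iff z hzb]
      exact not_lt.2 hz.le
    exact (mem_closure_iff_frequently.1 hcl) hev
  · intro heq
    refine ⟨?_, by rw [h.mem_iff x hx, heq]; exact lt_irrefl _⟩
    have ht : Tendsto (fun t : ℝ => x + t • e) (𝓝[>] 0) (𝓝 x) := by
      have : Continuous fun t : ℝ => x + t • e := by fun_prop
      simpa using (this.tendsto 0).mono_left (nhdsWithin_le_nhds (s := Ioi 0))
    refine mem_closure_of_tendsto ht ?_
    filter_upwards [ht (Metric.isOpen_ball.mem_nhds hx), self_mem_nhdsWithin] with t htb ht0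
    have h0 : (ℝ ∙ e)ᗮ.orthogonalProjectionOnto e = 0 :=
      Submodule.orthogonalProjectionOnto_orthogonalComplement_singleton_eq_zero e
    rw [h.mem_iff _ htb, map_add, map_smul, h0, smul_zero, add_zero, heq, inner_add_right,
      inner_smul_right, real_inner_self_eq_norm_sq, h.norm_eq]
    have : (0 : ℝ) < t := ht0
    linarith

/-- In a chart, the surface measure is the image under the graph map of the area density. -/
theorem IsGraphChart.surfaceMeasure_restrict (h : IsGraphChart Ω p e γ r) (hΩ : IsOpen Ω) :
    (surfaceMeasure Ω).restrict (Metric.ball p r) =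
      (Measure.map (graphMap e γ) (volume.withDensity
        (fun y => ENNReal.ofReal (graphJacobian γ y)))).restrict (Metric.ball p r) := by
  have h1 := comap_graphMap h.norm_eq h.contDiff
  rw [finrank_euclideanSpace_fin] at h1
  rw [← h1, (measurableEmbedding_graphMap e h.contDiff.continuous).map_comap, surfaceMeasure,
    Measure.restrict_restrict measurableSet_ball, Measure.restrict_restrict measurableSet_ball]
  congr 1
  ext x
  constructor
  · rintro ⟨hx, hf⟩
    rw [h.mem_frontier_iff hΩ hx] at hf
    refine ⟨hx, (ℝ ∙ e)ᗮ.orthogonalProjectionOnto x, ?_⟩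
    rw [graphMap, hf]
    exact eq_orthogonalProjectionOnto_add_smul h.norm_eq x
  · rintro ⟨hx, y, rfl⟩
    refine ⟨hx, ?_⟩
    rw [h.mem_frontier_iff hΩ hx, inner_graphMap h.norm_eq, graphMap,
      orthogonalProjectionOnto_add_smul]

theorem IsGraphChart.integral_surfaceMeasure (h : IsGraphChart Ω p e γ r) (hΩ : IsOpen Ω)
    {f : EuclideanSpace ℝ (Fin N) → ℝ} (hf : ∀ x, x ∉ Metric.ball p r → f x = 0) :
    ∫ x, f x ∂(surfaceMeasure Ω) = ∫ y, graphJacobian γ y * f (graphMap e γ y) := by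
  have h0 : ∀ μ : Measure (EuclideanSpace ℝ (Fin N)),
      ∫ x, f x ∂μ = ∫ x, f x ∂(μ.restrict (Metric.ball p r)) := fun μ =>
    (setIntegral_eq_integral_of_forall_compl_eq_zero fun x hx => hf x hx).symm
  rw [h0, h.surfaceMeasure_restrict hΩ, ← h0,
    (measurableEmbedding_graphMap e h.contDiff.continuous).integral_map,
    integral_withDensity_eq_integral_toReal_smul
      (continuous_graphJacobian h.contDiff).measurable.ennreal_ofReal (by simp)]
  refine integral_congr_ae (Eventually.of_forall fun y => ?_)
  simp only [smul_eq_mul]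
  rw [ENNReal.toReal_ofReal (graphJacobian_pos _ _).le]

/-- The divergence theorem in a chart. -/
theorem IsGraphChart.integral_fderiv (h : IsGraphChart Ω p e γ r) (hΩ : IsOpen Ω)
    {η : EuclideanSpace ℝ (Fin N) → ℝ} (hη : ContDiff ℝ 1 η) (hc : HasCompactSupport η)
    (hs : tsupport η ⊆ Metric.ball p r) (v : EuclideanSpace ℝ (Fin N)) :
    ∫ x in Ω, fderiv ℝ η x v = ∫ x, η x * ⟪graphNormal γ x, v⟫ ∂(surfaceMeasure Ω) := by
  have hγ := h.contDiff.continuous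
  have h1 : ∫ x in Ω, fderiv ℝ η x v =
      ∫ x in {x | γ ((ℝ ∙ e)ᗮ.orthogonalProjectionOnto x) < ⟪e, x⟫}, fderiv ℝ η x v := by
    rw [← integral_indicator hΩ.measurableSet, ← integral_indicator]
    · congr 1
      ext x
      by_cases hx : x ∈ Metric.ball p r
      · by_cases hxΩ : x ∈ Ω
        · rw [indicator_of_mem hxΩ, indicator_of_mem]
          exact (h.mem_iff x hx).1 hxΩ
        · rw [indicator_of_notMem hxΩ, indicator_of_notMem]
          exact fun h' => hxΩ ((h.mem_iff x hx).2 h')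
      · have : fderiv ℝ η x = 0 := by
          by_contra hne
          exact hx (hs (support_fderiv_subset ℝ hne))
        simp [indicator, this]
    · exact (isOpen_lt (by fun_prop) (by fun_prop)).measurableSet
  rw [h1, integral_fderiv_above_graph h.norm_eq h.contDiff hη hc, h.integral_surfaceMeasure hΩ,
    ← integral_neg]
  · refine integral_congr_ae (Eventually.of_forall fun y => ?_)
    simp only
    have h2 := jacobian_mul_inner_graphNormal (γ := γ) (graphMap e γ y) v
    have h3 : (ℝ ∙ e)ᗮ.orthogonalProjectionOnto (graphMap e γ y) = y := by
      rw [graphMap, orthogonalProjectionOnto_add_smul]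
    rw [h3] at h2
    rw [mul_comm (η _), ← mul_assoc, h2, neg_mul]
  · intro x hx
    rw [image_eq_zero_of_notMem_tsupport fun h' => hx (hs h'), zero_mul]

theorem IsGraphChart.surfaceMeasure_closedBall_lt_top (h : IsGraphChart Ω p e γ r)
    (hΩ : IsOpen Ω) {s : ℝ} (hs : s < r) : surfaceMeasure Ω (Metric.closedBall p s) < ⊤ := by
  have h1 : surfaceMeasure Ω (Metric.closedBall p s) =
      (surfaceMeasure Ω).restrict (Metric.ball p r) (Metric.closedBall p s) := by
    rw [Measure.restrict_apply Metric.isClosed_closedBall.measurableSet,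
      inter_eq_left.2 (Metric.closedBall_subset_ball hs)]
  rw [h1, h.surfaceMeasure_restrict hΩ]
  refine (Measure.restrict_apply_le _ _).trans_lt ?_
  have hG := measurableEmbedding_graphMap e h.contDiff.continuous
  rw [hG.map_apply, withDensity_apply _ (hG.measurable measurableSet_closedBall)]
  set K := graphMap e γ ⁻¹' Metric.closedBall p s
  have hK : K ⊆ Metric.closedBall ((ℝ ∙ e)ᗮ.orthogonalProjectionOnto p) s := by
    intro y hy
    have h3 : (ℝ ∙ e)ᗮ.orthogonalProjectionOnto (graphMap e γ y) = y := by
      rw [graphMap, orthogonalProjectionOnto_add_smul]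
    rw [Metric.mem_closedBall, dist_eq_norm, ← h3, ← map_sub]
    refine (Submodule.norm_orthogonalProjectionOnto_apply_le _ _).trans ?_
    rw [← dist_eq_norm]
    exact hy
  refine (lintegral_mono_set hK).trans_lt ?_
  have hint : IntegrableOn (graphJacobian γ)
      (Metric.closedBall ((ℝ ∙ e)ᗮ.orthogonalProjectionOnto p) s) :=
    (continuous_graphJacobian h.contDiff).continuousOn.integrableOn_compact
      (isCompact_closedBall _ _)
  refine lt_of_le_of_lt (lintegral_mono fun y => ?_) hint.2
  rw [Real.enorm_of_nonneg (graphJacobian_pos _ _).le]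

end chart

/-! ### The divergence theorem and the trace inequality -/

section global

variable {N : ℕ} {Ω : Set (EuclideanSpace ℝ (Fin N))}

theorem IsBoundedC1Domain.exists_chart (hΩ : IsBoundedC1Domain Ω)
    {p : EuclideanSpace ℝ (Fin N)} (hp : p ∈ frontier Ω) :
    ∃ (e : EuclideanSpace ℝ (Fin N)) (γ : (ℝ ∙ e)ᗮ → ℝ) (r : ℝ), IsGraphChart Ω p e γ r := by
  obtain ⟨e, he, γ, hγ, r, hr, h⟩ := hΩ.locally_graph p hp
  exact ⟨e, γ, r, he, hγ, hr, h⟩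

theorem IsBoundedC1Domain.isCompact_closure (hΩ : IsBoundedC1Domain Ω) : IsCompact (closure Ω) :=
  hΩ.isBounded.isCompact_closure

theorem IsBoundedC1Domain.isCompact_frontier (hΩ : IsBoundedC1Domain Ω) : IsCompact (frontier Ω) :=
  hΩ.isCompact_closure.of_isClosed_subset isClosed_frontier frontier_subset_closure

theorem IsBoundedC1Domain.isFiniteMeasure (hΩ : IsBoundedC1Domain Ω) :
    IsFiniteMeasure (surfaceMeasure Ω) := by
  refine ⟨?_⟩
  have h1 : surfaceMeasure Ω univ = surfaceMeasure Ω (frontier Ω) := by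
    rw [surfaceMeasure, Measure.restrict_apply_univ, Measure.restrict_apply_self]
  rw [h1]
  refine hΩ.isCompact_frontier.measure_lt_top_of_nhdsWithin fun p hp => ?_
  obtain ⟨e, γ, r, h⟩ := hΩ.exists_chart hp
  exact ⟨Metric.closedBall p (r / 2), mem_nhdsWithin_of_mem_nhds
    (Metric.closedBall_mem_nhds p (half_pos h.pos)),
    h.surfaceMeasure_closedBall_lt_top hΩ.isOpen (half_lt_self h.pos)⟩

theorem ae_mem_frontier (Ω : Set (EuclideanSpace ℝ (Fin N))) :
    ∀ᵐ x ∂(surfaceMeasure Ω), x ∈ frontier Ω :=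
  ae_restrict_mem isClosed_frontier.measurableSet

/-- A smooth partition of unity on a compact set, subordinate to prescribed balls. -/
theorem exists_finite_partition {K : Set (EuclideanSpace ℝ (Fin N))} (hK : IsCompact K)
    (r : EuclideanSpace ℝ (Fin N) → ℝ) (hr : ∀ p ∈ K, 0 < r p) :
    ∃ (t : Finset (EuclideanSpace ℝ (Fin N)))
      (f : t → EuclideanSpace ℝ (Fin N) → ℝ), (∀ p ∈ t, p ∈ K) ∧
      (∀ p, ContDiff ℝ ∞ (f p) ∧ HasCompactSupport (f p) ∧
        tsupport (f p) ⊆ Metric.ball p.1 (r p) ∧ ∀ x, 0 ≤ f p x) ∧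
      ∀ x ∈ K, ∑ p, f p x = 1 := by
  obtain ⟨t, htK, hcov⟩ := hK.elim_nhds_subcover (fun p => Metric.ball p (r p))
    (fun p hp => Metric.ball_mem_nhds p (hr p hp))
  obtain ⟨f, hf⟩ := SmoothPartitionOfUnity.exists_isSubordinate
    (modelWithCornersSelf ℝ (EuclideanSpace ℝ (Fin N))) hK.isClosed
    (fun p : t => Metric.ball p.1 (r p)) (fun p => Metric.isOpen_ball)
    (by simpa [iUnion_subtype] using hcov)
  refine ⟨t, fun p => f p, htK, fun p => ⟨(f p).contMDiff.contDiff, ?_, hf p, f.nonneg p⟩, ?_⟩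
  · exact HasCompactSupport.of_support_subset_isCompact (isCompact_closedBall p.1 (r p))
      ((subset_tsupport _).trans ((hf p).trans Metric.ball_subset_closedBall))
  · intro x hx
    have := f.sum_eq_one hx
    rwa [finsum_eq_sum_of_fintype] at this

theorem fderiv_mul_apply_of_contDiff {f g : EuclideanSpace ℝ (Fin N) → ℝ} (hf : ContDiff ℝ 1 f)
    (hg : ContDiff ℝ 1 g) (x v : EuclideanSpace ℝ (Fin N)) :
    fderiv ℝ (fun x => f x * g x) x v = f x * fderiv ℝ g x v + g x * fderiv ℝ f x v := by
  rw [fderiv_fun_mul (hf.differentiable one_ne_zero x) (hg.differentiable one_ne_zero x)]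
  simp

theorem integrableOn_of_continuous (hΩ : IsBoundedC1Domain Ω)
    {f : EuclideanSpace ℝ (Fin N) → ℝ} (hf : Continuous f) : IntegrableOn f Ω :=
  (hf.continuousOn.integrableOn_compact hΩ.isCompact_closure).mono_set subset_closure

theorem memLp_of_continuous (hΩ : IsBoundedC1Domain Ω)
    {f : EuclideanSpace ℝ (Fin N) → ℝ} (hf : Continuous f) : MemLp f 2 (volume.restrict Ω) := by
  rw [memLp_two_iff_integrable_sq hf.aestronglyMeasurable]
  exact integrableOn_of_continuous hΩ (hf.pow 2)

theorem integrable_surfaceMeasure_of_continuous (hΩ : IsBoundedC1Domain Ω)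
    {f : EuclideanSpace ℝ (Fin N) → ℝ} (hf : Continuous f) : Integrable f (surfaceMeasure Ω) := by
  have := hΩ.isFiniteMeasure
  obtain ⟨C, hC⟩ := hΩ.isCompact_frontier.exists_bound_of_continuousOn hf.continuousOn
  refine Integrable.of_bound hf.aestronglyMeasurable C ?_
  filter_upwards [ae_mem_frontier Ω] with x hx using hC x hx

theorem memLp_surfaceMeasure_of_continuous (hΩ : IsBoundedC1Domain Ω)
    {f : EuclideanSpace ℝ (Fin N) → ℝ} (hf : Continuous f) : MemLp f 2 (surfaceMeasure Ω) := by
  rw [memLp_two_iff_integrable_sq hf.aestronglyMeasurable]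
  exact integrable_surfaceMeasure_of_continuous hΩ (hf.pow 2)

/-- The divergence theorem follows from its version for functions supported in small balls; the
local normals `ν p` are averaged with a partition of unity. -/
theorem integral_fderiv_of_local (hΩ : IsBoundedC1Domain Ω) (r : EuclideanSpace ℝ (Fin N) → ℝ)
    (hr : ∀ p ∈ closure Ω, 0 < r p)
    (ν : EuclideanSpace ℝ (Fin N) → EuclideanSpace ℝ (Fin N) → EuclideanSpace ℝ (Fin N))
    (hν : ∀ p ∈ closure Ω, Continuous (ν p))
    (h : ∀ p ∈ closure Ω, ∀ η : EuclideanSpace ℝ (Fin N) → ℝ, ContDiff ℝ 1 η →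
      HasCompactSupport η → tsupport η ⊆ Metric.ball p (r p) → ∀ v,
      ∫ x in Ω, fderiv ℝ η x v = ∫ x, η x * ⟪ν p x, v⟫ ∂(surfaceMeasure Ω)) :
    ∃ (t : Finset (EuclideanSpace ℝ (Fin N)))
      (f : t → EuclideanSpace ℝ (Fin N) → ℝ), (∀ p ∈ t, p ∈ closure Ω) ∧
      (∀ p, ContDiff ℝ ∞ (f p) ∧ HasCompactSupport (f p) ∧
        tsupport (f p) ⊆ Metric.ball p.1 (r p) ∧ ∀ x, 0 ≤ f p x) ∧
      (∀ x ∈ closure Ω, ∑ p, f p x = 1) ∧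
      ∀ G : EuclideanSpace ℝ (Fin N) → ℝ, ContDiff ℝ 1 G → ∀ v,
        ∫ x in Ω, fderiv ℝ G x v =
          ∫ x, G x * ⟪∑ p : t, f p x • ν p x, v⟫ ∂(surfaceMeasure Ω) := by
  obtain ⟨t, f, htK, hf, hsum⟩ := exists_finite_partition hΩ.isCompact_closure r hr
  refine ⟨t, f, htK, hf, hsum, fun G hG v => ?_⟩
  have hfC : ∀ p, ContDiff ℝ 1 (f p) := fun p => (hf p).1.of_le (by exact_mod_cast le_top)
  have h1 : ∫ x in Ω, fderiv ℝ G x v = ∫ x in Ω, ∑ p, fderiv ℝ (fun x => f p x * G x) x v := by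
    refine setIntegral_congr_fun hΩ.isOpen.measurableSet fun x hx => ?_
    have hev : G =ᶠ[𝓝 x] fun x => ∑ p, f p x * G x := by
      filter_upwards [hΩ.isOpen.mem_nhds hx] with y hy
      rw [← Finset.sum_mul, hsum y (subset_closure hy), one_mul]
    rw [hev.fderiv_eq, fderiv_fun_sum fun p _ =>
      ((hfC p).mul hG).differentiable one_ne_zero x, _root_.sum_apply]
  have hcont : ∀ p, Continuous fun x => fderiv ℝ (fun x => f p x * G x) x v := fun p =>
    (((hfC p).mul hG).continuous_fderiv one_ne_zero).clm_apply continuous_const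
  rw [h1, integral_finsetSum _ fun p _ => integrableOn_of_continuous hΩ (hcont p)]
  have h2 : ∀ p : t, ∫ x in Ω, fderiv ℝ (fun x => f p x * G x) x v =
      ∫ x, f p x * G x * ⟪ν p x, v⟫ ∂(surfaceMeasure Ω) := fun p =>
    h p (htK p p.2) _ ((hfC p).mul hG) ((hf p).2.1.mul_right)
      ((tsupport_mul_subset_left).trans (hf p).2.2.1) v
  simp_rw [h2]
  rw [← integral_finsetSum]
  · refine integral_congr_ae (Eventually.of_forall fun x => ?_)
    simp only [sum_inner, real_inner_smul_left, Finset.mul_sum]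
    exact Finset.sum_congr rfl fun p _ => by ring
  · intro p _
    refine integrable_surfaceMeasure_of_continuous hΩ ?_
    have h3 := hν p (htK p p.2)
    exact (((hfC p).continuous).mul hG.continuous).mul (h3.inner continuous_const)

/-- Local data for the divergence theorem at a point of the closure: a continuous field of unit
length which is the outward normal near the point, and a direction transversal to the boundary. -/
theorem IsBoundedC1Domain.local_normal (hΩ : IsBoundedC1Domain Ω)
    {p : EuclideanSpace ℝ (Fin N)} (hp : p ∈ closure Ω) :
    ∃ (r : ℝ) (ν : EuclideanSpace ℝ (Fin N) → EuclideanSpace ℝ (Fin N))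
      (e : EuclideanSpace ℝ (Fin N)) (c : ℝ), 0 < r ∧ Continuous ν ∧ (∀ x, ‖ν x‖ ≤ 1) ∧
      0 < c ∧ ‖e‖ ≤ 1 ∧ (∀ x ∈ frontier Ω ∩ Metric.ball p r, ⟪ν x, e⟫ ≤ -c) ∧
      ∀ η : EuclideanSpace ℝ (Fin N) → ℝ, ContDiff ℝ 1 η → HasCompactSupport η →
        tsupport η ⊆ Metric.ball p r → ∀ v,
        ∫ x in Ω, fderiv ℝ η x v = ∫ x, η x * ⟪ν x, v⟫ ∂(surfaceMeasure Ω) := by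
  by_cases hpΩ : p ∈ Ω
  · obtain ⟨r, hr, hball⟩ := Metric.isOpen_iff.1 hΩ.isOpen p hpΩ
    refine ⟨r, fun _ => 0, 0, 1, hr, continuous_const, by simp, one_pos, by simp, ?_, ?_⟩
    · rintro x ⟨hx, hxb⟩
      rw [hΩ.isOpen.frontier_eq] at hx
      exact absurd (hball hxb) hx.2
    · intro η hη hc hs v
      rw [setIntegral_eq_integral_of_forall_compl_eq_zero,
        integral_fderiv_apply_eq_zero volume hη hc v]
      · simp
      · intro x hx
        have : fderiv ℝ η x = 0 := by
          by_contra hne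
          exact hx (hball (hs (support_fderiv_subset ℝ hne)))
        simp [this]
  · have hpf : p ∈ frontier Ω := by
      rw [hΩ.isOpen.frontier_eq]
      exact ⟨hp, hpΩ⟩
    obtain ⟨e, γ, r, h⟩ := hΩ.exists_chart hpf
    have hcont := continuous_graphNormal h.contDiff
    have hce : Continuous fun x => ⟪graphNormal γ x, e⟫ := hcont.inner continuous_const
    obtain ⟨x₀, _, hx₀⟩ := (isCompact_closedBall p r).exists_isMaxOn
      ⟨p, Metric.mem_closedBall_self h.pos.le⟩ hce.continuousOn
    refine ⟨r, graphNormal γ, e, -⟪graphNormal γ x₀, e⟫, h.pos, hcont,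
      fun x => (norm_graphNormal h.norm_eq x).le,
      neg_pos.2 (inner_graphNormal_neg h.norm_eq x₀), h.norm_eq.le, ?_,
      fun η hη hc hs v => h.integral_fderiv hΩ.isOpen hη hc hs v⟩
    rintro x ⟨_, hx⟩
    rw [neg_neg]
    exact hx₀ (Metric.ball_subset_closedBall hx)

/-- The divergence theorem, with a boundary field of norm at most one (it is the outward normal). -/
theorem IsBoundedC1Domain.exists_normal (hΩ : IsBoundedC1Domain Ω) :
    ∃ n : EuclideanSpace ℝ (Fin N) → EuclideanSpace ℝ (Fin N), Continuous n ∧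
      (∀ x ∈ frontier Ω, ‖n x‖ ≤ 1) ∧
      ∀ G : EuclideanSpace ℝ (Fin N) → ℝ, ContDiff ℝ 1 G → ∀ v,
        ∫ x in Ω, fderiv ℝ G x v = ∫ x, G x * ⟪n x, v⟫ ∂(surfaceMeasure Ω) := by
  choose! r ν e c hr hν hν1 hc he hνe hdiv using fun p (hp : p ∈ closure Ω) => hΩ.local_normal hp
  obtain ⟨t, f, htK, hf, hsum, h⟩ := integral_fderiv_of_local hΩ r hr ν hν hdiv
  refine ⟨fun x => ∑ p : t, f p x • ν p x, ?_, ?_, h⟩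
  · refine continuous_finsetSum _ fun p _ => ?_
    exact (hf p).1.continuous.smul (hν p (htK p p.2))
  · intro x hx
    refine (norm_sum_le _ _).trans ?_
    rw [← hsum x (frontier_subset_closure hx)]
    refine Finset.sum_le_sum fun p _ => ?_
    rw [norm_smul, Real.norm_of_nonneg ((hf p).2.2.2 x)]
    exact mul_le_of_le_one_right ((hf p).2.2.2 x) (hν1 p (htK p p.2) x)

/-- Trace inequality: the boundary `L²` norm is controlled by an arbitrarily small multiple of the
gradient and a multiple of the function. -/
theorem IsBoundedC1Domain.trace_inequality (hΩ : IsBoundedC1Domain Ω) :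
    ∃ C : ℝ, 0 < C ∧ ∀ w : EuclideanSpace ℝ (Fin N) → ℝ, ContDiff ℝ 1 w → ∀ δ : ℝ, 0 < δ →
      ∫ x, w x ^ 2 ∂(surfaceMeasure Ω) ≤
        C * ((1 + δ⁻¹) * ∫ x in Ω, w x ^ 2) + C * (δ * ∫ x in Ω, ‖fderiv ℝ w x‖ ^ 2) := by
  choose! r ν e c hr hν hν1 hc he hνe hdiv using fun p (hp : p ∈ closure Ω) => hΩ.local_normal hp
  obtain ⟨t, f, htK, hf, hsum⟩ := exists_finite_partition hΩ.isCompact_closure r hr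
  have hfC : ∀ p, ContDiff ℝ 1 (f p) := fun p => (hf p).1.of_le (by exact_mod_cast le_top)
  have hM : ∀ p : t, ∃ M : ℝ, 1 ≤ M ∧ (∀ x ∈ closure Ω, f p x ≤ M) ∧
      ∀ x ∈ closure Ω, ‖fderiv ℝ (f p) x‖ ≤ M := fun p => by
    obtain ⟨M₁, h₁⟩ := hΩ.isCompact_closure.exists_bound_of_continuousOn
      (hfC p).continuous.continuousOn
    obtain ⟨M₂, h₂⟩ := hΩ.isCompact_closure.exists_bound_of_continuousOn
      ((hfC p).continuous_fderiv one_ne_zero).continuousOn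
    refine ⟨max 1 (max M₁ M₂), le_max_left _ _, fun x hx => ?_, fun x hx => ?_⟩
    · exact (le_abs_self _).trans ((h₁ x hx).trans ((le_max_left _ _).trans (le_max_right _ _)))
    · exact (h₂ x hx).trans ((le_max_right _ _).trans (le_max_right _ _))
  choose M hM1 hMf hMd using hM
  have hcM : ∀ p : t, 0 ≤ (c p)⁻¹ * M p := fun p =>
    mul_nonneg (inv_nonneg.2 (hc p (htK p p.2)).le) (by linarith [hM1 p])
  refine ⟨1 + ∑ p : t, (c p)⁻¹ * M p, ?_, fun w hw δ hδ => ?_⟩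
  · have := Finset.sum_nonneg fun p (_ : p ∈ Finset.univ) => hcM p
    linarith
  have hwc := hw.continuous
  have hwd := hw.continuous_fderiv one_ne_zero
  have hI1 : IntegrableOn (fun x => w x ^ 2) Ω := integrableOn_of_continuous hΩ (by fun_prop)
  have hI2 : IntegrableOn (fun x => ‖fderiv ℝ w x‖ ^ 2) Ω :=
    integrableOn_of_continuous hΩ (by fun_prop)
  set A := ∫ x in Ω, w x ^ 2 with hA
  set B := ∫ x in Ω, ‖fderiv ℝ w x‖ ^ 2 with hB
  have hA0 : 0 ≤ A := integral_nonneg fun x => sq_nonneg _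
  have hB0 : 0 ≤ B := integral_nonneg fun x => sq_nonneg _
  have hp : ∀ p : t, ∫ x, f p x * w x ^ 2 ∂(surfaceMeasure Ω) ≤
      (c p)⁻¹ * M p * ((1 + δ⁻¹) * A + δ * B) := by
    intro p
    have hpK := htK p p.2
    have hcp := hc p hpK
    have hη : ContDiff ℝ 1 fun x => f p x * (w x * w x) := (hfC p).mul (hw.mul hw)
    have hfc := (hfC p).continuous
    have hνc := hν p hpK
    -- the divergence theorem for `f w² e`, where `e` is transversal to the boundary on the support
    -- of `f`
    have h1 : c p * ∫ x, f p x * w x ^ 2 ∂(surfaceMeasure Ω) ≤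
        -∫ x, f p x * (w x * w x) * ⟪ν p x, e p⟫ ∂(surfaceMeasure Ω) := by
      rw [← integral_const_mul, ← integral_neg]
      refine integral_mono_ae (integrable_surfaceMeasure_of_continuous hΩ (by fun_prop))
        (integrable_surfaceMeasure_of_continuous hΩ (by fun_prop)) ?_
      filter_upwards [ae_mem_frontier Ω] with x hx
      by_cases hxb : x ∈ Metric.ball p.1 (r p)
      · have h2 := hνe p hpK x ⟨hx, hxb⟩
        have h3 : 0 ≤ f p x * w x ^ 2 := mul_nonneg ((hf p).2.2.2 x) (sq_nonneg _)
        nlinarith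
      · have : f p x = 0 := image_eq_zero_of_notMem_tsupport fun h' => hxb ((hf p).2.2.1 h')
        simp [this]
    rw [← hdiv p hpK _ hη (hf p).2.1.mul_right
      ((tsupport_mul_subset_left).trans (hf p).2.2.1) (e p), ← integral_neg] at h1
    have h4 : ∫ x in Ω, -fderiv ℝ (fun x => f p x * (w x * w x)) x (e p) ≤
        ∫ x in Ω, M p * ((1 + δ⁻¹) * w x ^ 2 + δ * ‖fderiv ℝ w x‖ ^ 2) := by
      have hcd : Continuous fun x => fderiv ℝ (fun x => f p x * (w x * w x)) x (e p) :=
        (hη.continuous_fderiv one_ne_zero).clm_apply continuous_const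
      refine setIntegral_mono_on (integrableOn_of_continuous hΩ hcd.neg)
        (integrableOn_of_continuous hΩ (by fun_prop)) hΩ.isOpen.measurableSet fun x hx => ?_
      rw [fderiv_mul_apply_of_contDiff (hfC p) (hw.mul hw), fderiv_mul_apply_of_contDiff hw hw]
      have hxc := subset_closure hx
      set a := fderiv ℝ w x (e p) with ha
      set b := fderiv ℝ (f p) x (e p) with hb
      have ha' : |a| ≤ ‖fderiv ℝ w x‖ :=
        ((fderiv ℝ w x).le_opNorm (e p)).trans (mul_le_of_le_one_right (norm_nonneg _) (he p hpK))
      have hb' : |b| ≤ M p :=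
        (((fderiv ℝ (f p) x).le_opNorm (e p)).trans
          (mul_le_of_le_one_right (norm_nonneg _) (he p hpK))).trans (hMd p x hxc)
      -- Young's inequality with weight `δ`
      have h5 : -(2 * (w x * a)) ≤ δ⁻¹ * w x ^ 2 + δ * ‖fderiv ℝ w x‖ ^ 2 := by
        have h6 : a ^ 2 ≤ ‖fderiv ℝ w x‖ ^ 2 := by
          rw [← sq_abs a]; gcongr
        have h7 : 0 ≤ δ * (δ⁻¹ * w x + a) ^ 2 := by positivity
        have h8 : δ * (δ⁻¹ * w x + a) ^ 2 = δ⁻¹ * w x ^ 2 + 2 * (w x * a) + δ * a ^ 2 := by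
          field_simp
          ring
        have h9 : δ * a ^ 2 ≤ δ * ‖fderiv ℝ w x‖ ^ 2 := by gcongr
        linarith
      have h5' : 0 ≤ δ⁻¹ * w x ^ 2 + δ * ‖fderiv ℝ w x‖ ^ 2 := by positivity
      have h10 : f p x * -(2 * (w x * a)) ≤
          M p * (δ⁻¹ * w x ^ 2 + δ * ‖fderiv ℝ w x‖ ^ 2) :=
        (mul_le_mul_of_nonneg_left h5 ((hf p).2.2.2 x)).trans
          (mul_le_mul_of_nonneg_right (hMf p x hxc) h5')
      have h11 : -(w x * w x * b) ≤ M p * w x ^ 2 := by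
        have := neg_abs_le b
        nlinarith [mul_self_nonneg (w x)]
      nlinarith
    have h12 : ∫ x in Ω, M p * ((1 + δ⁻¹) * w x ^ 2 + δ * ‖fderiv ℝ w x‖ ^ 2) =
        M p * ((1 + δ⁻¹) * A + δ * B) := by
      rw [integral_const_mul, integral_add (hI1.const_mul _) (hI2.const_mul _),
        integral_const_mul, integral_const_mul]
    rw [h12] at h4
    rw [mul_assoc, ← div_eq_inv_mul, le_div_iff₀ hcp, mul_comm _ (c p)]
    exact h1.trans h4
  have h13 : ∫ x, w x ^ 2 ∂(surfaceMeasure Ω) =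
      ∑ p : t, ∫ x, f p x * w x ^ 2 ∂(surfaceMeasure Ω) := by
    rw [← integral_finsetSum]
    · refine integral_congr_ae ?_
      filter_upwards [ae_mem_frontier Ω] with x hx
      rw [← Finset.sum_mul, hsum x (frontier_subset_closure hx), one_mul]
    · intro p _
      have hfc := (hfC p).continuous
      exact integrable_surfaceMeasure_of_continuous hΩ (by fun_prop)
  rw [h13]
  refine (Finset.sum_le_sum fun p _ => hp p).trans ?_
  rw [← Finset.sum_mul]
  have : 0 ≤ (1 + δ⁻¹) * A + δ * B := by positivity
  nlinarith

end global

/-! ### The first moment and the boundary; the divergence theorem on balls -/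

section weighted

variable {N : ℕ} {Ω : Set (EuclideanSpace ℝ (Fin N))}

theorem sum_inner_single (x y : EuclideanSpace ℝ (Fin N)) :
    ∑ i, x i * ⟪y, EuclideanSpace.single i (1 : ℝ)⟫ = ⟪y, x⟫ := by
  simp [PiLp.inner_apply]

theorem sum_coord_sq (x : EuclideanSpace ℝ (Fin N)) : ∑ i, x i ^ 2 = ‖x‖ ^ 2 := by
  rw [EuclideanSpace.norm_sq_eq]; simp

/-- The isoperimetric inequality for the weight `|x - c|²`, before rearrangement: the divergence
theorem for the field `|x - c| (x - c)`, which is smoothed at `c`. -/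
theorem IsBoundedC1Domain.integral_norm_le (hΩ : IsBoundedC1Domain Ω)
    (c : EuclideanSpace ℝ (Fin N)) :
    (N + 1) * ∫ x in Ω, ‖x - c‖ ≤ ∫ x, ‖x - c‖ ^ 2 ∂(surfaceMeasure Ω) := by
  obtain ⟨n, hn, hn1, hdiv⟩ := hΩ.exists_normal
  have := hΩ.isFiniteMeasure
  have hvol : volume Ω < ⊤ := hΩ.isBounded.measure_lt_top
  set S := ∫ x, ‖x - c‖ ^ 2 ∂(surfaceMeasure Ω) with hS
  set S₁ := ∫ x, ‖x - c‖ ∂(surfaceMeasure Ω) with hS₁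
  set I := ∫ x in Ω, ‖x - c‖ with hI
  have key : ∀ ε : ℝ, 0 < ε → (N + 1) * I - ε * volume.real Ω ≤ S + ε * S₁ := by
    intro ε hε
    -- the field is smoothed to `q (x - c)` with `q = √(|x - c|² + ε²)`; its divergence is
    -- `N q + |x - c|² / q`
    set q : EuclideanSpace ℝ (Fin N) → ℝ := fun x => √(‖x - c‖ ^ 2 + ε ^ 2) with hq
    have hq0 : ∀ x, 0 < q x := fun x => Real.sqrt_pos.2 (by positivity)
    have hq2 : ∀ x, q x ^ 2 = ‖x - c‖ ^ 2 + ε ^ 2 := fun x => Real.sq_sqrt (by positivity)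
    have hqle : ∀ x, q x ≤ ‖x - c‖ + ε := fun x => by
      have := norm_nonneg (x - c)
      refine Real.sqrt_le_iff.2 ⟨by positivity, by nlinarith⟩
    have hqge : ∀ x, ‖x - c‖ ≤ q x := fun x => Real.le_sqrt_of_sq_le (by nlinarith)
    have hqd : ContDiff ℝ 1 q := by
      refine ContDiff.sqrt (((contDiff_id.sub contDiff_const).norm_sq ℝ).add contDiff_const)
        fun x => by positivity
    have hqc := hqd.continuous
    have hci : ∀ i : Fin N, ContDiff ℝ 1 fun x : EuclideanSpace ℝ (Fin N) => (x - c) i := by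
      intro i
      simp only [PiLp.sub_apply]
      fun_prop
    have hcic := fun i => (hci i).continuous
    have hG : ∀ i : Fin N, ContDiff ℝ 1 fun x => q x * (x - c) i := fun i => hqd.mul (hci i)
    have hder : ∀ i x, fderiv ℝ (fun x => q x * (x - c) i) x (EuclideanSpace.single i 1) =
        q x + (x - c) i ^ 2 / q x := by
      intro i x
      rw [fderiv_mul_apply_of_contDiff hqd (hci i)]
      have h1 : HasFDerivAt (fun x : EuclideanSpace ℝ (Fin N) => (x - c) i)
          (EuclideanSpace.proj i : EuclideanSpace ℝ (Fin N) →L[ℝ] ℝ) x := by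
        simpa using ((EuclideanSpace.proj i : EuclideanSpace ℝ (Fin N) →L[ℝ] ℝ).hasFDerivAt
          (x := x)).sub_const (c i)
      have h2 : HasFDerivAt (fun x : EuclideanSpace ℝ (Fin N) => ‖x - c‖ ^ 2 + ε ^ 2)
          (2 • (innerSL ℝ (x - c)).comp (ContinuousLinearMap.id ℝ _)) x :=
        (((hasFDerivAt_id x).sub_const c).norm_sq).add_const _
      have h3 := h2.sqrt (by positivity)
      rw [h1.fderiv, h3.fderiv]
      simp only [_root_.smul_apply, smul_eq_mul,
        ContinuousLinearMap.comp_id, innerSL_apply_apply, nsmul_eq_mul,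
        EuclideanSpace.inner_single_right]
      simp only [hq]
      have := hq0 x
      simp only [hq] at this
      field_simp
      simp
      ring
    have hsum : ∑ i : Fin N, ∫ x in Ω,
        fderiv ℝ (fun x => q x * (x - c) i) x (EuclideanSpace.single i 1) =
        ∫ x, q x * ⟪n x, x - c⟫ ∂(surfaceMeasure Ω) := by
      simp_rw [fun i => hdiv _ (hG i) (EuclideanSpace.single i 1)]
      rw [← integral_finsetSum]
      · refine integral_congr_ae (Eventually.of_forall fun x => ?_)
        simp only
        rw [← sum_inner_single, Finset.mul_sum]
        exact Finset.sum_congr rfl fun i _ => by ring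
      · intro i _
        have := hcic i
        exact integrable_surfaceMeasure_of_continuous hΩ (by fun_prop)
    have hlow : (N + 1) * I - ε * volume.real Ω ≤ ∑ i : Fin N, ∫ x in Ω,
        fderiv ℝ (fun x => q x * (x - c) i) x (EuclideanSpace.single i 1) := by
      simp_rw [hder]
      have hint : ∀ i : Fin N, IntegrableOn (fun x => q x + (x - c) i ^ 2 / q x) Ω := fun i => by
        have := hcic i
        exact integrableOn_of_continuous hΩ
          (hqc.add ((this.pow 2).div hqc fun x => (hq0 x).ne'))
      rw [← integral_finsetSum _ fun i _ => hint i]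
      have h4 : (N + 1) * I - ε * volume.real Ω = ∫ x in Ω, ((N + 1) * ‖x - c‖ - ε) := by
        rw [integral_sub ((integrableOn_of_continuous hΩ (by fun_prop)).const_mul _)
          (integrableOn_const hvol.ne), integral_const_mul, setIntegral_const, smul_eq_mul,
          mul_comm ε]
      rw [h4]
      refine integral_mono (integrableOn_of_continuous hΩ (by fun_prop))
        (integrable_finsetSum _ fun i _ => hint i) fun x => ?_
      simp only [Finset.sum_add_distrib, Finset.sum_const, Finset.card_univ, Fintype.card_fin,
        nsmul_eq_mul]
      rw [← Finset.sum_div, sum_coord_sq]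
      have h5 : ‖x - c‖ - ε ≤ ‖x - c‖ ^ 2 / q x := by
        rw [le_div_iff₀ (hq0 x)]
        rcases le_total ‖x - c‖ ε with h | h
        · exact (mul_nonpos_of_nonpos_of_nonneg (by linarith) (hq0 x).le).trans (sq_nonneg _)
        · calc (‖x - c‖ - ε) * q x ≤ (‖x - c‖ - ε) * (‖x - c‖ + ε) := by
                exact mul_le_mul_of_nonneg_left (hqle x) (by linarith)
            _ ≤ _ := by nlinarith
      have h6 : (N : ℝ) * ‖x - c‖ ≤ N * q x := by gcongr; exact hqge x
      linarith
    have hup : ∫ x, q x * ⟪n x, x - c⟫ ∂(surfaceMeasure Ω) ≤ S + ε * S₁ := by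
      rw [hS, hS₁, ← integral_const_mul, ← integral_add
        (integrable_surfaceMeasure_of_continuous hΩ (by fun_prop))
        (integrable_surfaceMeasure_of_continuous hΩ (by fun_prop))]
      refine integral_mono_ae (integrable_surfaceMeasure_of_continuous hΩ (by fun_prop))
        (integrable_surfaceMeasure_of_continuous hΩ (by fun_prop)) ?_
      filter_upwards [ae_mem_frontier Ω] with x hx
      have h7 : ⟪n x, x - c⟫ ≤ ‖x - c‖ :=
        (real_inner_le_norm _ _).trans (mul_le_of_le_one_left (norm_nonneg _) (hn1 x hx))
      calc q x * ⟪n x, x - c⟫ ≤ q x * ‖x - c‖ := by gcongr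
        _ ≤ (‖x - c‖ + ε) * ‖x - c‖ := by gcongr; exact hqle x
        _ = _ := by ring
    linarith [hsum]
  have hlim : Tendsto (fun ε : ℝ => S + ε * S₁ + ε * volume.real Ω) (𝓝[>] 0) (𝓝 S) := by
    have : Continuous fun ε : ℝ => S + ε * S₁ + ε * volume.real Ω := by fun_prop
    simpa using (this.tendsto 0).mono_left (nhdsWithin_le_nhds (s := Ioi 0))
  refine ge_of_tendsto hlim (eventually_nhdsWithin_of_forall fun ε hε => ?_)
  have := key ε hε
  linarith

end weighted

section ball

variable {N : ℕ}

/-- A `C^1` function whose graph is near `p` the part of the sphere `∂B(c, R)` around `p`. -/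
theorem exists_ball_chart {c p : EuclideanSpace ℝ (Fin N)} {R : ℝ} (hR : 0 < R)
    (hp : ‖p - c‖ = R) :
    ∃ γ : (ℝ ∙ (R⁻¹ • (c - p)))ᗮ → ℝ, IsGraphChart (Metric.ball c R) p (R⁻¹ • (c - p)) γ
        (R / 2) := by
  set e := R⁻¹ • (c - p) with he
  have hen : ‖e‖ = 1 := by
    rw [he, norm_smul, norm_sub_rev, hp, norm_inv, Real.norm_of_nonneg hR.le,
        inv_mul_cancel₀ hR.ne']
  have hpe : p - c = -(R • e) := by
    rw [he, smul_smul, mul_inv_cancel₀ hR.ne', one_smul, neg_sub]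
  set P := (ℝ ∙ e)ᗮ.orthogonalProjectionOnto with hP
  have hPe : P e = 0 := Submodule.orthogonalProjectionOnto_orthogonalComplement_singleton_eq_zero e
  set m := P c with hm
  have hPp : P p = m := by
    have : P (p - c) = 0 := by rw [hpe, map_neg, map_smul, hPe, smul_zero, neg_zero]
    rwa [map_sub, sub_eq_zero] at this
  -- the function describing the lower half of the sphere is cut off outside the ball where it is
  -- used
  let χ : ContDiffBump m := ⟨R / 2, 3 * R / 4, by positivity, by linarith⟩
  refine ⟨fun y => ⟪e, c⟫ - χ y * √(R ^ 2 - ‖y - m‖ ^ 2), hen, ?_, half_pos hR, ?_⟩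
  · refine contDiff_const.sub ?_
    rw [contDiff_iff_contDiffAt]
    intro y
    by_cases hy : ‖y - m‖ < R
    · refine χ.contDiffAt.mul (ContDiffAt.sqrt (contDiffAt_const.sub
        ((contDiffAt_id.sub contDiffAt_const).norm_sq ℝ)) ?_)
      have := norm_nonneg (y - m)
      nlinarith
    · have hev : (fun y => χ y * √(R ^ 2 - ‖y - m‖ ^ 2)) =ᶠ[𝓝 y] fun _ => 0 := by
        have : ∀ᶠ z in 𝓝 y, 3 * R / 4 < ‖z - m‖ := by
          have hc : Continuous fun z => ‖z - m‖ := by fun_prop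
          exact hc.continuousAt.eventually_const_lt (by push Not at hy; linarith)
        filter_upwards [this] with z hz
        rw [χ.zero_of_le_dist (by rw [dist_eq_norm]; exact hz.le), zero_mul]
      exact contDiffAt_const.congr_of_eventuallyEq hev
  · intro x hx
    rw [mem_ball_iff_norm] at hx
    have h1 : ‖P x - m‖ < R / 2 := by
      rw [← hPp, ← map_sub]
      exact (Submodule.norm_orthogonalProjectionOnto_apply_le _ _).trans_lt hx
    have h2 : χ (P x) = 1 := χ.one_of_mem_closedBall (by
      rw [mem_closedBall_iff_norm]; exact h1.le)
    have h3 : ‖x - c‖ ^ 2 = ‖P x - m‖ ^ 2 + ⟪e, x - c⟫ ^ 2 := by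
      have := eq_orthogonalProjectionOnto_add_smul hen (x - c)
      rw [← norm_add_smul_sq hen, hm, ← map_sub, this]
    have h4 : ⟪e, x - c⟫ < 0 := by
      have h5 : ⟪e, x - c⟫ = ⟪e, x - p⟫ - R := by
        rw [show x - c = (x - p) + (p - c) by abel, inner_add_right, hpe, inner_neg_right,
          inner_smul_right, real_inner_self_eq_norm_sq, hen]
        ring
      have h6 : ⟪e, x - p⟫ ≤ ‖x - p‖ := by
        simpa [hen] using real_inner_le_norm e (x - p)
      linarith
    rw [h2, one_mul, mem_ball_iff_norm, ← sq_lt_sq₀ (norm_nonneg _) hR.le, h3, sub_lt_comm,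
      ← inner_sub_right, show ⟪e, c - x⟫ = -⟪e, x - c⟫ by rw [← inner_neg_right, neg_sub],
      Real.lt_sqrt (by linarith)]
    constructor <;> intro h <;> nlinarith

theorem isBoundedC1Domain_ball (c : EuclideanSpace ℝ (Fin N)) {R : ℝ} (hR : 0 < R) :
    IsBoundedC1Domain (Metric.ball c R) where
  isOpen := Metric.isOpen_ball
  isConnected := ⟨⟨c, Metric.mem_ball_self hR⟩, (convex_ball c R).isPreconnected⟩
  isBounded := Metric.isBounded_ball
  locally_graph p hp := by
    rw [frontier_ball c hR.ne', mem_sphere_iff_norm] at hp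
    obtain ⟨γ, h⟩ := exists_ball_chart hR hp
    exact ⟨_, h.norm_eq, γ, h.contDiff, R / 2, h.pos, h.mem_iff⟩

/-- The graph normal of a sphere is radial: the sphere equation, differentiated along the graph,
says that the radius is orthogonal to the tangent space. -/
theorem graphNormal_ball {c p e : EuclideanSpace ℝ (Fin N)} {R : ℝ} (hR : 0 < R)
    (he : e = R⁻¹ • (c - p)) {γ : (ℝ ∙ e)ᗮ → ℝ} (h : IsGraphChart (Metric.ball c R) p e γ (R / 2))
    {x : EuclideanSpace ℝ (Fin N)} (hx : x ∈ Metric.ball p (R / 2))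
    (hxf : x ∈ frontier (Metric.ball c R)) : graphNormal γ x = R⁻¹ • (x - c) := by
  have hen : ‖e‖ = 1 := h.norm_eq
  set P := (ℝ ∙ e)ᗮ.orthogonalProjectionOnto with hP
  set y := P x with hy
  have hG : graphMap e γ y = x := by
    rw [graphMap, (h.mem_frontier_iff Metric.isOpen_ball hx).1 hxf]
    exact eq_orthogonalProjectionOnto_add_smul hen x
  have hcont : Continuous (graphMap e γ) := by
    have := h.contDiff.continuous
    unfold graphMap
    fun_prop
  have hsph : ∀ᶠ z in 𝓝 y, ‖graphMap e γ z - c‖ ^ 2 = R ^ 2 := by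
    have : ∀ᶠ z in 𝓝 y, graphMap e γ z ∈ Metric.ball p (R / 2) :=
      hcont.continuousAt (Metric.isOpen_ball.mem_nhds (by rw [hG]; exact hx))
    filter_upwards [this] with z hz
    have hzf : graphMap e γ z ∈ frontier (Metric.ball c R) := by
      rw [h.mem_frontier_iff Metric.isOpen_ball hz, inner_graphMap hen, graphMap,
        orthogonalProjectionOnto_add_smul]
    rw [frontier_ball c hR.ne', mem_sphere_iff_norm] at hzf
    rw [hzf]
  set a := (InnerProductSpace.toDual ℝ _).symm (fderiv ℝ γ y) with ha
  have haf : ∀ v, fderiv ℝ γ y v = ⟪a, v⟫ := fun v => by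
    rw [ha, InnerProductSpace.toDual_symm_apply]
  have horth : ∀ w : (ℝ ∙ e)ᗮ, ⟪x - c, (w : EuclideanSpace ℝ (Fin N)) + ⟪a, w⟫ • e⟫ = 0 := by
    intro w
    have h1 : HasFDerivAt (graphMap e γ) ((ℝ ∙ e)ᗮ.subtypeL + (fderiv ℝ γ y).smulRight e) y :=
      ((ℝ ∙ e)ᗮ.subtypeL.hasFDerivAt).add
        ((h.contDiff.differentiable one_ne_zero y).hasFDerivAt.smul_const e)
    have h2 := (h1.sub_const c).norm_sq
    have h3 : HasFDerivAt (fun z => ‖graphMap e γ z - c‖ ^ 2) (0 : (ℝ ∙ e)ᗮ →L[ℝ] ℝ) y :=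
      (hasFDerivAt_const (R ^ 2) y).congr_of_eventuallyEq hsph
    have h4 := DFunLike.congr_fun (h2.unique h3) w
    rw [hG] at h4
    have h5 : 2 * ⟪x - c, (w : EuclideanSpace ℝ (Fin N)) + ⟪a, w⟫ • e⟫ = 0 := by
      rw [← haf]
      rw [inner_add_right, inner_smul_right, inner_sub_left, inner_sub_left]
      simp only [inner_sub_left, _root_.zero_apply, _root_.add_apply, _root_.smul_apply,
        ContinuousLinearMap.comp_apply, innerSL_apply_apply, ContinuousLinearMap.smulRight_apply,
        Submodule.subtypeL_apply, inner_add_right, inner_smul_right, nsmul_eq_mul, Nat.cast_ofNat]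
        at h4
      linarith
    linarith
  have hz := eq_orthogonalProjectionOnto_add_smul hen (x - c)
  set k := ⟪e, x - c⟫ with hk
  have hPz : P (x - c) = -(k • a) := by
    refine ext_inner_right ℝ fun w => ?_
    have := horth w
    rw [inner_add_right, inner_smul_right, real_inner_comm e, ← hk,
      ← Submodule.inner_orthogonalProjectionOnto_eq_of_mem_right] at this
    rw [inner_neg_left, real_inner_smul_left]
    linarith
  have hxc : x - c = k • (e - (a : EuclideanSpace ℝ (Fin N))) := by
    rw [← hz]
    change (P (x - c) : EuclideanSpace ℝ (Fin N)) + _ = _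
    rw [hPz]
    push_cast
    module
  have hJ := graphJacobian_pos γ y
  have hJn : ‖e - (a : EuclideanSpace ℝ (Fin N))‖ = graphJacobian γ y := by
    rw [← sq_eq_sq₀ (norm_nonneg _) hJ.le, norm_sub_coe_sq hen, graphJacobian,
      Real.sq_sqrt (by positivity), ha, LinearIsometryEquiv.norm_map]
  have hk0 : k < 0 := by
    have hpe : p - c = -(R • e) := by
      rw [he, smul_smul, mul_inv_cancel₀ hR.ne', one_smul, neg_sub]
    have h5 : k = ⟪e, x - p⟫ - R := by
      rw [hk, show x - c = (x - p) + (p - c) by abel, inner_add_right, hpe, inner_neg_right,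
        inner_smul_right, real_inner_self_eq_norm_sq, hen]
      ring
    have h6 : ⟪e, x - p⟫ ≤ ‖x - p‖ := by
      simpa [hen] using real_inner_le_norm e (x - p)
    rw [mem_ball_iff_norm] at hx
    linarith
  have hRk : R = -k * graphJacobian γ y := by
    rw [frontier_ball c hR.ne', mem_sphere_iff_norm, hxc, norm_smul, hJn,
        Real.norm_of_nonpos hk0.le]
      at hxf
    exact hxf.symm
  have hkR : -(graphJacobian γ y)⁻¹ = R⁻¹ * k := by
    have hJ' := hJ.ne'
    have hk' := hk0.ne
    rw [hRk, mul_inv, inv_neg, mul_assoc, mul_comm _ k, ← mul_assoc, neg_mul, inv_mul_cancel₀ hk']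
    ring
  rw [graphNormal, hxc, smul_smul, ← hkR, ← neg_smul]

/-- The divergence theorem on a ball. -/
theorem integral_fderiv_ball (c : EuclideanSpace ℝ (Fin N)) {R : ℝ} (hR : 0 < R)
    {G : EuclideanSpace ℝ (Fin N) → ℝ} (hG : ContDiff ℝ 1 G) (v : EuclideanSpace ℝ (Fin N)) :
    ∫ x in Metric.ball c R, fderiv ℝ G x v =
      ∫ x, G x * (R⁻¹ * ⟪x - c, v⟫) ∂(surfaceMeasure (Metric.ball c R)) := by
  have hB := isBoundedC1Domain_ball c hR
  have hloc : ∀ p ∈ closure (Metric.ball c R), ∃ r : ℝ, 0 < r ∧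
      ∀ η : EuclideanSpace ℝ (Fin N) → ℝ, ContDiff ℝ 1 η →
      HasCompactSupport η → tsupport η ⊆ Metric.ball p r → ∀ v,
      ∫ x in Metric.ball c R, fderiv ℝ η x v =
        ∫ x, η x * ⟪R⁻¹ • (x - c), v⟫ ∂(surfaceMeasure (Metric.ball c R)) := by
    intro p hp
    by_cases hpΩ : p ∈ Metric.ball c R
    · obtain ⟨r, hr, hball⟩ := Metric.isOpen_iff.1 Metric.isOpen_ball p hpΩ
      refine ⟨r, hr, fun η hη hc hs v => ?_⟩
      rw [setIntegral_eq_integral_of_forall_compl_eq_zero,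
        integral_fderiv_apply_eq_zero volume hη hc v]
      · symm
        refine integral_eq_zero_of_ae ?_
        filter_upwards [ae_mem_frontier _] with x hx
        rw [Metric.isOpen_ball.frontier_eq] at hx
        rw [image_eq_zero_of_notMem_tsupport fun h' => hx.2 (hball (hs h'))]
        simp
      · intro x hx
        have : fderiv ℝ η x = 0 := by
          by_contra hne
          exact hx (hball (hs (support_fderiv_subset ℝ hne)))
        simp [this]
    · have hpf : p ∈ frontier (Metric.ball c R) := by
        rw [Metric.isOpen_ball.frontier_eq]
        exact ⟨hp, hpΩ⟩
      rw [frontier_ball c hR.ne', mem_sphere_iff_norm] at hpf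
      obtain ⟨γ, h⟩ := exists_ball_chart hR hpf
      refine ⟨R / 2, h.pos, fun η hη hc hs v => ?_⟩
      rw [h.integral_fderiv Metric.isOpen_ball hη hc hs v]
      refine integral_congr_ae ?_
      filter_upwards [ae_mem_frontier _] with x hx
      by_cases hxb : x ∈ Metric.ball p (R / 2)
      · rw [graphNormal_ball hR rfl h hxb hx]
      · rw [image_eq_zero_of_notMem_tsupport fun h' => hxb (hs h')]
        simp
  choose! r hr hdiv using hloc
  obtain ⟨t, f, htK, hf, hsum, h⟩ := integral_fderiv_of_local hB r hr
    (fun _ x => R⁻¹ • (x - c)) (fun p _ => by fun_prop) hdiv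
  rw [h G hG v]
  refine integral_congr_ae ?_
  filter_upwards [ae_mem_frontier _] with x hx
  rw [← Finset.sum_smul, hsum x (frontier_subset_closure hx), one_smul, real_inner_smul_left]

end ball

/-! ### Reflections, and the Steklov inequality for odd functions on a ball -/

section reflection

variable {N : ℕ}

/-- The reflection in the hyperplane through `c` orthogonal to `v`. -/
noncomputable def hyperplaneReflection (c v : EuclideanSpace ℝ (Fin N)) :
    EuclideanSpace ℝ (Fin N) ≃ᵢ EuclideanSpace ℝ (Fin N) :=
  ((IsometryEquiv.subRight c).trans ((ℝ ∙ v)ᗮ.reflection.toIsometryEquiv)).trans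
    (IsometryEquiv.addRight c)

theorem hyperplaneReflection_apply (c v x : EuclideanSpace ℝ (Fin N)) :
    hyperplaneReflection c v x = (ℝ ∙ v)ᗮ.reflection (x - c) + c := rfl

theorem hyperplaneReflection_involutive (c v x : EuclideanSpace ℝ (Fin N)) :
    hyperplaneReflection c v (hyperplaneReflection c v x) = x := by
  simp [hyperplaneReflection_apply]

theorem norm_hyperplaneReflection_sub (c v x : EuclideanSpace ℝ (Fin N)) :
    ‖hyperplaneReflection c v x - c‖ = ‖x - c‖ := by
  rw [hyperplaneReflection_apply, add_sub_cancel_right, LinearIsometryEquiv.norm_map]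

/-- A point differs from its mirror image by twice its distance from the mirror. -/
theorem sub_hyperplaneReflection {c e : EuclideanSpace ℝ (Fin N)} (he : ‖e‖ = 1)
    (x : EuclideanSpace ℝ (Fin N)) :
    x - hyperplaneReflection c e x = (2 * ⟪x - c, e⟫) • e := by
  rw [hyperplaneReflection_apply, Submodule.reflection_orthogonal_apply,
    Submodule.reflection_singleton_apply, he, real_inner_comm]
  simp only [one_pow, RCLike.ofReal_one, div_one]
  module

theorem hyperplaneReflection_sub_eq {c x y : EuclideanSpace ℝ (Fin N)} (h : ‖x - c‖ = ‖y - c‖) :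
    hyperplaneReflection c (x - y) x = y := by
  have := Submodule.reflection_sub (F := EuclideanSpace ℝ (Fin N)) h
  rw [sub_sub_sub_cancel_right] at this
  rw [hyperplaneReflection_apply, this, sub_add_cancel]

theorem hasFDerivAt_hyperplaneReflection (c v x : EuclideanSpace ℝ (Fin N)) :
    HasFDerivAt (hyperplaneReflection c v)
      ((ℝ ∙ v)ᗮ.reflection.toContinuousLinearEquiv :
        EuclideanSpace ℝ (Fin N) →L[ℝ] EuclideanSpace ℝ (Fin N)) x := by
  have h1 := ((ℝ ∙ v)ᗮ.reflection.toContinuousLinearEquiv.hasFDerivAt (x := x - c))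
  have h2 := (h1.comp x ((hasFDerivAt_id x).sub_const c)).add_const c
  exact h2

theorem contDiff_hyperplaneReflection (c v : EuclideanSpace ℝ (Fin N)) :
    ContDiff ℝ 1 (hyperplaneReflection c v) := by
  have : (hyperplaneReflection c v : EuclideanSpace ℝ (Fin N) → EuclideanSpace ℝ (Fin N)) =
    fun x => (ℝ ∙ v)ᗮ.reflection (x - c) + c := rfl
  rw [this]
  have h := (ℝ ∙ v)ᗮ.reflection.contDiff (n := 1)
  exact (h.comp (contDiff_id.sub contDiff_const)).add contDiff_const

theorem norm_fderiv_comp_hyperplaneReflection {w : EuclideanSpace ℝ (Fin N) → ℝ}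
    (hw : ContDiff ℝ 1 w) (c v x : EuclideanSpace ℝ (Fin N)) :
    ‖fderiv ℝ (fun x => w (hyperplaneReflection c v x)) x‖ =
      ‖fderiv ℝ w (hyperplaneReflection c v x)‖ := by
  have h := ((hw.differentiable one_ne_zero (hyperplaneReflection c v x)).hasFDerivAt).comp x
    (hasFDerivAt_hyperplaneReflection c v x)
  have h1 := h.fderiv
  simp only [Function.comp_def] at h1
  rw [h1]
  exact ContinuousLinearMap.opNorm_comp_linearIsometryEquiv _ _

theorem image_hyperplaneReflection_ball (c v : EuclideanSpace ℝ (Fin N)) (R : ℝ) :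
    hyperplaneReflection c v ⁻¹' Metric.ball c R = Metric.ball c R := by
  ext x
  simp only [mem_preimage, mem_ball_iff_norm, norm_hyperplaneReflection_sub]

theorem measurePreserving_hyperplaneReflection_volume (c v : EuclideanSpace ℝ (Fin N)) (R : ℝ) :
    MeasurePreserving (hyperplaneReflection c v) (volume.restrict (Metric.ball c R))
      (volume.restrict (Metric.ball c R)) := by
  have h := (hyperplaneReflection c v).measurePreserving_euclideanHausdorffMeasure N
  rw [EuclideanSpace.euclideanHausdorffMeasure_eq_volume] at h
  have := h.restrict_preimage (s := Metric.ball c R) measurableSet_ball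
  rwa [image_hyperplaneReflection_ball] at this

theorem measurePreserving_hyperplaneReflection_surface (c v : EuclideanSpace ℝ (Fin N)) (R : ℝ) :
    MeasurePreserving (hyperplaneReflection c v) (surfaceMeasure (Metric.ball c R))
      (surfaceMeasure (Metric.ball c R)) := by
  have h := (hyperplaneReflection c v).measurePreserving_euclideanHausdorffMeasure (N - 1)
  have := h.restrict_preimage (s := frontier (Metric.ball c R)) isClosed_frontier.measurableSet
  have h2 := (hyperplaneReflection c v).toHomeomorph.preimage_frontier (Metric.ball c R)
  change hyperplaneReflection c v ⁻¹' _ = frontier (hyperplaneReflection c v ⁻¹' _) at h2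
  rw [image_hyperplaneReflection_ball] at h2
  change MeasurePreserving _ (Measure.restrict _ (hyperplaneReflection c v ⁻¹' _)) _ at this
  rw [h2] at this
  exact this

/-- The parallelogram law for linear forms on a Hilbert space. -/
theorem parallelogram_dual (f g : EuclideanSpace ℝ (Fin N) →L[ℝ] ℝ) :
    ‖(1 / 2 : ℝ) • (f + g)‖ ^ 2 + ‖(1 / 2 : ℝ) • (f - g)‖ ^ 2 = (‖f‖ ^ 2 + ‖g‖ ^ 2) / 2 := by
  have h := parallelogram_law_with_norm ℝ ((InnerProductSpace.toDual ℝ _).symm f)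
    ((InnerProductSpace.toDual ℝ _).symm g)
  rw [← map_add, ← map_sub] at h
  simp only [LinearIsometryEquiv.norm_map] at h
  rw [norm_smul, norm_smul, mul_pow, mul_pow]
  norm_num
  nlinarith

/-- Otherwise the divergence theorem for a linear function would give `|Ω| = 0`. -/
theorem surfaceMeasure_ne_zero (hN : 1 ≤ N) {Ω : Set (EuclideanSpace ℝ (Fin N))}
    (hΩ : IsBoundedC1Domain Ω) : surfaceMeasure Ω ≠ 0 := by
  intro h0
  obtain ⟨n, hn, hn1, hdiv⟩ := hΩ.exists_normal
  set v : EuclideanSpace ℝ (Fin N) := EuclideanSpace.single ⟨0, hN⟩ 1 with hv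
  have hG : ContDiff ℝ 1 fun x : EuclideanSpace ℝ (Fin N) => innerSL ℝ v x :=
    (innerSL ℝ v).contDiff
  have h1 := hdiv _ hG v
  have h2 : ∀ x, fderiv ℝ (fun x => innerSL ℝ v x) x v = 1 := fun x => by
    rw [ContinuousLinearMap.fderiv]
    simp [hv]
  simp_rw [h2] at h1
  rw [h0, integral_zero_measure, setIntegral_const, smul_eq_mul, mul_one, Measure.real,
    ENNReal.toReal_eq_zero_iff] at h1
  rcases h1 with h1 | h1
  · exact (hΩ.isOpen.measure_pos volume hΩ.isConnected.nonempty).ne' h1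
  · exact hΩ.isBounded.measure_lt_top.ne h1

/-- All spherical caps of a given radius have the same positive measure. -/
theorem exists_cap_measure_pos (hN : 1 ≤ N) (c : EuclideanSpace ℝ (Fin N)) {R : ℝ} (hR : 0 < R)
    {δ : ℝ} (hδ : 0 < δ) : ∃ m : ℝ, 0 < m ∧ ∀ x ∈ Metric.sphere c R,
      m ≤ (surfaceMeasure (Metric.ball c R)).real (Metric.ball x δ) := by
  set σ := surfaceMeasure (Metric.ball c R) with hσ
  have hB := isBoundedC1Domain_ball c hR
  have := hB.isFiniteMeasure
  have hsame : ∀ x ∈ Metric.sphere c R, ∀ y ∈ Metric.sphere c R,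
      σ (Metric.ball x δ) = σ (Metric.ball y δ) := by
    intro x hx y hy
    have hxy : ‖x - c‖ = ‖y - c‖ := by
      rw [mem_sphere_iff_norm.1 hx, mem_sphere_iff_norm.1 hy]
    have hmp := measurePreserving_hyperplaneReflection_surface c (x - y) R
    rw [hσ, ← hmp.measure_preimage (measurableSet_ball (x := y)).nullMeasurableSet,
      (hyperplaneReflection c (x - y)).preimage_ball]
    congr 2
    rw [IsometryEquiv.eq_symm_apply, hyperplaneReflection_sub_eq hxy]
  have hfr : frontier (Metric.ball c R) = Metric.sphere c R := frontier_ball c hR.ne'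
  by_cases hne : ∃ x₀ ∈ Metric.sphere c R, σ (Metric.ball x₀ δ) ≠ 0
  · obtain ⟨x₀, hx₀, hpos⟩ := hne
    refine ⟨σ.real (Metric.ball x₀ δ), ENNReal.toReal_pos hpos (measure_ne_top _ _), ?_⟩
    intro x hx
    rw [Measure.real, hsame x₀ hx₀ x hx, Measure.real]
  · push Not at hne
    exfalso
    refine surfaceMeasure_ne_zero hN hB ?_
    rw [← Measure.measure_univ_eq_zero]
    have h1 : surfaceMeasure (Metric.ball c R) univ = σ (Metric.sphere c R) := by
      rw [hσ, surfaceMeasure, hfr, Measure.restrict_apply_univ, Measure.restrict_apply_self]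
    rw [h1]
    refine (isCompact_sphere c R).measure_zero_of_nhdsWithin fun x hx => ?_
    exact ⟨Metric.ball x δ, mem_nhdsWithin_of_mem_nhds (Metric.ball_mem_nhds x hδ), hne x hx⟩

end reflection

section picone

variable {N : ℕ}

theorem exists_lipschitz_closedBall (c : EuclideanSpace ℝ (Fin N)) (R : ℝ)
    {w : EuclideanSpace ℝ (Fin N) → ℝ} (hw : ContDiff ℝ 1 w) :
    ∃ L : ℝ, 0 ≤ L ∧ ∀ x ∈ Metric.closedBall c R, ∀ y ∈ Metric.closedBall c R,
      |w x - w y| ≤ L * ‖x - y‖ := by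
  obtain ⟨L, hL⟩ := (isCompact_closedBall c R).exists_bound_of_continuousOn
    (hw.continuous_fderiv one_ne_zero).continuousOn
  refine ⟨max L 0, le_max_right _ _, fun x hx y hy => ?_⟩
  exact (convex_closedBall c R).norm_image_sub_le_of_norm_fderiv_le
    (fun z _ => hw.differentiable one_ne_zero z) (fun z hz => (hL z hz).trans (le_max_left _ _))
    hy hx

/-- The sharp Steklov inequality for functions which are odd with respect to a hyperplane through
the centre of the ball. They vanish on the hyperplane, and Picone's inequality applies with the
linear function `ℓ` vanishing there: one integrates the divergence of `(b² / ℓ) e`, regularised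
as `b² ℓ / (ℓ² + ε) e`. -/
theorem steklov_ball_odd {c e : EuclideanSpace ℝ (Fin N)} {R : ℝ} (hR : 0 < R) (he : ‖e‖ = 1)
    {b : EuclideanSpace ℝ (Fin N) → ℝ} (hb : ContDiff ℝ 1 b)
    (hodd : ∀ x, b (hyperplaneReflection c e x) = -b x) :
    ∫ x, b x ^ 2 ∂(surfaceMeasure (Metric.ball c R)) ≤
      R * ∫ x in Metric.ball c R, ‖fderiv ℝ b x‖ ^ 2 := by
  have hB := isBoundedC1Domain_ball c hR
  have := hB.isFiniteMeasure
  set σ := surfaceMeasure (Metric.ball c R) with hσ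
  obtain ⟨L, hL0, hL⟩ := exists_lipschitz_closedBall c R hb
  set ℓ : EuclideanSpace ℝ (Fin N) → ℝ := fun x => ⟪x - c, e⟫ with hℓ
  -- `b` vanishes on the mirror, so it is bounded by a multiple of the distance from it
  have hbl : ∀ x ∈ Metric.closedBall c R, b x ^ 2 ≤ L ^ 2 * ℓ x ^ 2 := by
    intro x hx
    have hx' : hyperplaneReflection c e x ∈ Metric.closedBall c R := by
      rw [mem_closedBall_iff_norm, norm_hyperplaneReflection_sub]
      exact mem_closedBall_iff_norm.1 hx
    have h1 := hL x hx _ hx'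
    rw [hodd, sub_hyperplaneReflection he, norm_smul, he, mul_one, Real.norm_eq_abs, abs_mul,
      sub_neg_eq_add, ← two_mul, abs_mul, abs_two] at h1
    have h2 : |b x| ≤ L * |ℓ x| := by simp only [hℓ]; linarith
    calc b x ^ 2 = |b x| ^ 2 := (sq_abs _).symm
      _ ≤ (L * |ℓ x|) ^ 2 := by gcongr
      _ = _ := by rw [mul_pow, sq_abs]
  have hℓd : ContDiff ℝ 1 ℓ := by
    have : ℓ = fun x => innerSL ℝ e (x - c) := by ext x; simp only [hℓ]; rw [real_inner_comm]; rfl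
    rw [this]
    exact (innerSL ℝ e).contDiff.comp (contDiff_id.sub contDiff_const)
  have hℓc := hℓd.continuous
  have hbc := hb.continuous
  have hbd := hb.continuous_fderiv one_ne_zero
  have hℓe : ∀ x, fderiv ℝ ℓ x e = 1 := fun x => by
    have : HasFDerivAt ℓ (innerSL ℝ e) x := by
      have h1 : ℓ = fun x => innerSL ℝ e (x - c) := by
        ext x; simp only [hℓ]; rw [real_inner_comm]; rfl
      rw [h1]
      exact ((innerSL ℝ e).hasFDerivAt).comp x ((hasFDerivAt_id x).sub_const c)
    rw [this.fderiv, innerSL_apply_apply, real_inner_self_eq_norm_sq, he, one_pow]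
  set D := ∫ x in Metric.ball c R, ‖fderiv ℝ b x‖ ^ 2 with hD
  set M := σ.real univ with hM
  have key : ∀ ε : ℝ, 0 < ε → ∫ x, b x ^ 2 ∂σ - L ^ 2 * ε * M ≤
      R * (D + ∫ x in Metric.ball c R, L ^ 2 * (ε * ℓ x ^ 2 / (ℓ x ^ 2 + ε) ^ 2)) := by
    intro ε hε
    have hpos : ∀ x, 0 < ℓ x ^ 2 + ε := fun x => by positivity
    have hψ : ContDiff ℝ 1 fun x => ℓ x / (ℓ x ^ 2 + ε) :=
      hℓd.div ((hℓd.pow 2).add contDiff_const) fun x => (hpos x).ne'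
    have hG : ContDiff ℝ 1 fun x => b x * b x * (ℓ x / (ℓ x ^ 2 + ε)) := (hb.mul hb).mul hψ
    have hdiv := integral_fderiv_ball c hR hG e
    have hψd : ∀ x, fderiv ℝ (fun x => ℓ x / (ℓ x ^ 2 + ε)) x e =
        (ε - ℓ x ^ 2) / (ℓ x ^ 2 + ε) ^ 2 := by
      intro x
      have h1 := (hℓd.differentiable one_ne_zero x).hasFDerivAt
      have h2 : HasDerivAt (fun s : ℝ => s / (s ^ 2 + ε))
          ((ε - ℓ x ^ 2) / (ℓ x ^ 2 + ε) ^ 2) (ℓ x) := by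
        have h3 := (hasDerivAt_id' (ℓ x)).fun_div
          (((hasDerivAt_id' (ℓ x)).fun_pow 2).add_const ε) (hpos x).ne'
        refine h3.congr_deriv ?_
        congr 1
        push_cast
        ring
      have h4 := (h2.comp_hasFDerivAt x h1).fderiv
      simp only [Function.comp_def] at h4
      rw [h4]
      simp [hℓe]
    have hfG : ∀ x ∈ Metric.ball c R,
        fderiv ℝ (fun x => b x * b x * (ℓ x / (ℓ x ^ 2 + ε))) x e ≤
        ‖fderiv ℝ b x‖ ^ 2 + L ^ 2 * (ε * ℓ x ^ 2 / (ℓ x ^ 2 + ε) ^ 2) := by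
      intro x hx
      rw [fderiv_mul_apply_of_contDiff (hb.mul hb) hψ, fderiv_mul_apply_of_contDiff hb hb, hψd]
      set a := fderiv ℝ b x e with ha
      have ha' : a ^ 2 ≤ ‖fderiv ℝ b x‖ ^ 2 := by
        have : |a| ≤ ‖fderiv ℝ b x‖ :=
          ((fderiv ℝ b x).le_opNorm e).trans (by rw [he, mul_one])
        rw [← sq_abs a]; gcongr
      have h4 : b x ^ 2 * (ε / (ℓ x ^ 2 + ε) ^ 2) ≤
          L ^ 2 * ℓ x ^ 2 * (ε / (ℓ x ^ 2 + ε) ^ 2) := by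
        have := hpos x
        gcongr
        exact hbl x (Metric.ball_subset_closedBall hx)
      have h5 : (ε - ℓ x ^ 2) / (ℓ x ^ 2 + ε) ^ 2 =
          ε / (ℓ x ^ 2 + ε) ^ 2 - (ℓ x / (ℓ x ^ 2 + ε)) ^ 2 := by
        rw [div_pow, ← sub_div]
      rw [h5]
      set ψ := ℓ x / (ℓ x ^ 2 + ε) with hψ
      have h6 : L ^ 2 * (ε * ℓ x ^ 2 / (ℓ x ^ 2 + ε) ^ 2) =
        L ^ 2 * ℓ x ^ 2 * (ε / (ℓ x ^ 2 + ε) ^ 2) := by ring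
      rw [h6]
      -- Picone: `2 a b ψ - b² ψ² ≤ a²`
      nlinarith [sq_nonneg (a - b x * ψ)]
    have hcε : Continuous fun x => ε * ℓ x ^ 2 / (ℓ x ^ 2 + ε) ^ 2 :=
      (continuous_const.mul (hℓc.pow 2)).div (((hℓc.pow 2).add continuous_const).pow 2)
        fun x => (pow_pos (hpos x) 2).ne'
    have hupper : ∫ x in Metric.ball c R,
        fderiv ℝ (fun x => b x * b x * (ℓ x / (ℓ x ^ 2 + ε))) x e ≤
        D + ∫ x in Metric.ball c R, L ^ 2 * (ε * ℓ x ^ 2 / (ℓ x ^ 2 + ε) ^ 2) := by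
      have hi1 : IntegrableOn (fun x => ‖fderiv ℝ b x‖ ^ 2) (Metric.ball c R) :=
        integrableOn_of_continuous hB (by fun_prop)
      have hi2 : IntegrableOn (fun x => L ^ 2 * (ε * ℓ x ^ 2 / (ℓ x ^ 2 + ε) ^ 2))
        (Metric.ball c R) := integrableOn_of_continuous hB (continuous_const.mul hcε)
      rw [hD, ← integral_add hi1 hi2]
      refine setIntegral_mono_on ?_ ?_ measurableSet_ball hfG
      · exact integrableOn_of_continuous hB
          ((hG.continuous_fderiv one_ne_zero).clm_apply continuous_const)
      · exact hi1.add hi2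
    rw [hdiv] at hupper
    have hψc := hψ.continuous
    have hlower : R⁻¹ * (∫ x, b x ^ 2 ∂σ - L ^ 2 * ε * M) ≤
        ∫ x, b x * b x * (ℓ x / (ℓ x ^ 2 + ε)) * (R⁻¹ * ⟪x - c, e⟫) ∂σ := by
      have h7 : ∫ x, b x ^ 2 ∂σ - L ^ 2 * ε * M = ∫ x, (b x ^ 2 - L ^ 2 * ε) ∂σ := by
        rw [integral_sub (integrable_surfaceMeasure_of_continuous hB (by fun_prop))
          (integrable_const _), integral_const, smul_eq_mul, mul_comm M]
      rw [h7, ← integral_const_mul]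
      refine integral_mono_ae (integrable_surfaceMeasure_of_continuous hB (by fun_prop))
        (integrable_surfaceMeasure_of_continuous hB (by fun_prop)) ?_
      filter_upwards [ae_mem_frontier _] with x hx
      have hxc : x ∈ Metric.closedBall c R :=
        closure_ball c hR.ne' ▸ frontier_subset_closure hx
      have h8 : b x * b x * (ℓ x / (ℓ x ^ 2 + ε)) * (R⁻¹ * ⟪x - c, e⟫) =
          R⁻¹ * (b x ^ 2 - b x ^ 2 * (ε / (ℓ x ^ 2 + ε))) := by
        have := (hpos x).ne'
        change b x * b x * (ℓ x / (ℓ x ^ 2 + ε)) * (R⁻¹ * ℓ x) = _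
        field_simp
        ring
      rw [h8]
      refine mul_le_mul_of_nonneg_left (sub_le_sub_left ?_ _) (inv_nonneg.2 hR.le)
      have h9 : ε / (ℓ x ^ 2 + ε) * ℓ x ^ 2 ≤ ε := by
        rw [div_mul_eq_mul_div, div_le_iff₀ (hpos x)]
        nlinarith
      calc b x ^ 2 * (ε / (ℓ x ^ 2 + ε)) ≤ L ^ 2 * ℓ x ^ 2 * (ε / (ℓ x ^ 2 + ε)) := by
            have := hpos x
            gcongr
            exact hbl x hxc
        _ = L ^ 2 * (ε / (ℓ x ^ 2 + ε) * ℓ x ^ 2) := by ring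
        _ ≤ L ^ 2 * ε := by gcongr
    have h10 := hlower.trans hupper
    rwa [inv_mul_le_iff₀ hR] at h10
  -- the error term is bounded by `L²` and tends to zero pointwise, also on the mirror
  have hlim : Tendsto (fun n : ℕ => ∫ x in Metric.ball c R, L ^ 2 *
      ((1 / ((n : ℝ) + 1)) * ℓ x ^ 2 / (ℓ x ^ 2 + 1 / ((n : ℝ) + 1)) ^ 2)) atTop (𝓝 0) := by
    have h0 : (0 : ℝ) = ∫ x in Metric.ball c R, (0 : ℝ) := by simp
    rw [h0]
    have hε : Tendsto (fun n : ℕ => 1 / ((n : ℝ) + 1)) atTop (𝓝 0) :=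
      tendsto_one_div_add_atTop_nhds_zero_nat
    have hεp : ∀ n : ℕ, 0 < 1 / ((n : ℝ) + 1) := fun n => by positivity
    refine tendsto_integral_of_dominated_convergence (fun _ => L ^ 2) (fun n => ?_)
      (integrableOn_const measure_ball_lt_top.ne) (fun n => ?_) ?_
    · have hc : Continuous fun x => (1 / ((n : ℝ) + 1)) * ℓ x ^ 2 /
        (ℓ x ^ 2 + 1 / ((n : ℝ) + 1)) ^ 2 :=
        (continuous_const.mul (hℓc.pow 2)).div (((hℓc.pow 2).add continuous_const).pow 2)
          fun x => (pow_pos (by have := hεp n; positivity) 2).ne'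
      exact (continuous_const.mul hc).aestronglyMeasurable
    · refine Eventually.of_forall fun x => ?_
      have hp := hεp n
      rw [Real.norm_of_nonneg (by positivity)]
      refine mul_le_of_le_one_right (sq_nonneg _) ?_
      rw [div_le_one (by positivity)]
      nlinarith [sq_nonneg (ℓ x ^ 2), sq_nonneg (ℓ x)]
    · refine Eventually.of_forall fun x => ?_
      by_cases hx : ℓ x = 0
      · simp [hx]
      · have h2 : 0 < ℓ x ^ 2 := by positivity
        have : ContinuousAt (fun ε : ℝ => L ^ 2 * (ε * ℓ x ^ 2 / (ℓ x ^ 2 + ε) ^ 2)) 0 := by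
          refine continuousAt_const.mul (ContinuousAt.div (by fun_prop) (by fun_prop) ?_)
          simp [hx]
        have h3 := this.tendsto.comp hε
        simpa [Function.comp_def] using h3
  have hlim2 : Tendsto (fun n : ℕ => R * (D + ∫ x in Metric.ball c R, L ^ 2 *
      ((1 / ((n : ℝ) + 1)) * ℓ x ^ 2 / (ℓ x ^ 2 + 1 / ((n : ℝ) + 1)) ^ 2)) +
      L ^ 2 * (1 / ((n : ℝ) + 1)) * M) atTop (𝓝 (R * (D + 0) + L ^ 2 * 0 * M)) :=
    ((hlim.const_add D).const_mul R).add
      ((tendsto_one_div_add_atTop_nhds_zero_nat.const_mul (L ^ 2)).mul_const M)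
  rw [add_zero, mul_zero, zero_mul, add_zero] at hlim2
  refine ge_of_tendsto' hlim2 fun n => ?_
  have := key (1 / ((n : ℝ) + 1)) (by positivity)
  linarith

end picone

/-! ### Symmetrisation, and the Steklov inequality on a ball -/

section symmetrization

variable {N : ℕ} {c : EuclideanSpace ℝ (Fin N)} {R : ℝ}

/-- The defect in the Steklov inequality on the ball `B(c, R)`. -/
noncomputable def steklovDefect (c : EuclideanSpace ℝ (Fin N)) (R : ℝ)
    (w : EuclideanSpace ℝ (Fin N) → ℝ) : ℝ :=
  R * (∫ x in Metric.ball c R, ‖fderiv ℝ w x‖ ^ 2) -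
    ∫ x, w x ^ 2 ∂(surfaceMeasure (Metric.ball c R))

/-- Splitting a function into its even and odd parts with respect to a reflection does not increase
the Steklov defect when the odd part is dropped, and it decreases the boundary norm by that of the
odd part. -/
theorem steklovDefect_even_part (hR : 0 < R) {v : EuclideanSpace ℝ (Fin N)} (hv : v ≠ 0)
    {w : EuclideanSpace ℝ (Fin N) → ℝ} (hw : ContDiff ℝ 1 w) :
    steklovDefect c R (fun x => (1 / 2 : ℝ) * (w x + w (hyperplaneReflection c v x))) ≤
      steklovDefect c R w ∧
    (∫ x, ((1 / 2 : ℝ) * (w x + w (hyperplaneReflection c v x))) ^ 2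
        ∂(surfaceMeasure (Metric.ball c R))) +
      ∫ x, ((1 / 2 : ℝ) * (w x - w (hyperplaneReflection c v x))) ^ 2
        ∂(surfaceMeasure (Metric.ball c R)) =
      ∫ x, w x ^ 2 ∂(surfaceMeasure (Metric.ball c R)) := by
  have hB := isBoundedC1Domain_ball c hR
  set ρ := hyperplaneReflection c v with hρ
  set σ := surfaceMeasure (Metric.ball c R) with hσ
  have hρd : ContDiff ℝ 1 ρ := contDiff_hyperplaneReflection c v
  have hwρ : ContDiff ℝ 1 fun x => w (ρ x) := hw.comp hρd
  have hwc := hw.continuous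
  have hwρc := hwρ.continuous
  have ha : ContDiff ℝ 1 fun x => (1 / 2 : ℝ) * (w x + w (ρ x)) :=
    contDiff_const.mul (hw.add hwρ)
  have hb : ContDiff ℝ 1 fun x => (1 / 2 : ℝ) * (w x - w (ρ x)) :=
    contDiff_const.mul (hw.sub hwρ)
  have hac := ha.continuous
  have hbc := hb.continuous
  have had := ha.continuous_fderiv one_ne_zero
  have hbd := hb.continuous_fderiv one_ne_zero
  have hwd := hw.continuous_fderiv one_ne_zero
  have hwρd := hwρ.continuous_fderiv one_ne_zero
  have hmeas : MeasurableEmbedding ρ := ρ.toHomeomorph.measurableEmbedding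
  have hsq : (∫ x, ((1 / 2 : ℝ) * (w x + w (ρ x))) ^ 2 ∂σ) +
      ∫ x, ((1 / 2 : ℝ) * (w x - w (ρ x))) ^ 2 ∂σ = ∫ x, w x ^ 2 ∂σ := by
    have h1 : ∫ x, w (ρ x) ^ 2 ∂σ = ∫ x, w x ^ 2 ∂σ :=
      (measurePreserving_hyperplaneReflection_surface c v R).integral_comp hmeas fun x => w x ^ 2
    rw [← integral_add (integrable_surfaceMeasure_of_continuous hB (by fun_prop))
      (integrable_surfaceMeasure_of_continuous hB (by fun_prop))]
    have h2 : ∫ x, (((1 / 2 : ℝ) * (w x + w (ρ x))) ^ 2 + ((1 / 2 : ℝ) * (w x - w (ρ x))) ^ 2) ∂σ =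
        ∫ x, ((1 / 2 : ℝ) * w x ^ 2 + (1 / 2 : ℝ) * w (ρ x) ^ 2) ∂σ := by
      congr 1; ext x; ring
    rw [h2, integral_add (integrable_surfaceMeasure_of_continuous hB (by fun_prop))
      (integrable_surfaceMeasure_of_continuous hB (by fun_prop)), integral_const_mul,
      integral_const_mul, h1]
    ring
  refine ⟨?_, hsq⟩
  have hfd : ∀ x, fderiv ℝ (fun x => (1 / 2 : ℝ) * (w x + w (ρ x))) x =
      (1 / 2 : ℝ) • (fderiv ℝ w x + fderiv ℝ (fun x => w (ρ x)) x) := fun x =>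
    (((hw.differentiable one_ne_zero x).hasFDerivAt.add
      (hwρ.differentiable one_ne_zero x).hasFDerivAt).const_mul (1 / 2 : ℝ)).fderiv
  have hfd' : ∀ x, fderiv ℝ (fun x => (1 / 2 : ℝ) * (w x - w (ρ x))) x =
      (1 / 2 : ℝ) • (fderiv ℝ w x - fderiv ℝ (fun x => w (ρ x)) x) := fun x =>
    (((hw.differentiable one_ne_zero x).hasFDerivAt.sub
      (hwρ.differentiable one_ne_zero x).hasFDerivAt).const_mul (1 / 2 : ℝ)).fderiv
  have hgrad : (∫ x in Metric.ball c R,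
      ‖fderiv ℝ (fun x => (1 / 2 : ℝ) * (w x + w (ρ x))) x‖ ^ 2) +
      ∫ x in Metric.ball c R, ‖fderiv ℝ (fun x => (1 / 2 : ℝ) * (w x - w (ρ x))) x‖ ^ 2 =
      ∫ x in Metric.ball c R, ‖fderiv ℝ w x‖ ^ 2 := by
    have h1 : ∫ x in Metric.ball c R, ‖fderiv ℝ w (ρ x)‖ ^ 2 =
        ∫ x in Metric.ball c R, ‖fderiv ℝ w x‖ ^ 2 :=
      (measurePreserving_hyperplaneReflection_volume c v R).integral_comp hmeas
        fun x => ‖fderiv ℝ w x‖ ^ 2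
    rw [← integral_add (integrableOn_of_continuous hB (by fun_prop))
      (integrableOn_of_continuous hB (by fun_prop))]
    have hn : ∀ x, ‖fderiv ℝ (fun x => w (ρ x)) x‖ = ‖fderiv ℝ w (ρ x)‖ :=
      norm_fderiv_comp_hyperplaneReflection hw c v
    simp_rw [hfd, hfd', parallelogram_dual, hn]
    have hρc := hρd.continuous
    rw [integral_div, integral_add (integrableOn_of_continuous hB (by fun_prop))
      (integrableOn_of_continuous hB (by fun_prop)), h1]
    ring
  -- the axis is normalised in order to apply the inequality for odd functions
  have hodd : ∫ x, ((1 / 2 : ℝ) * (w x - w (ρ x))) ^ 2 ∂σ ≤ R * ∫ x in Metric.ball c R,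
      ‖fderiv ℝ (fun x => (1 / 2 : ℝ) * (w x - w (ρ x))) x‖ ^ 2 := by
    have hv' : ‖(‖v‖⁻¹ • v)‖ = 1 := by
      rw [norm_smul, norm_inv, norm_norm, inv_mul_cancel₀ (norm_ne_zero_iff.2 hv)]
    have hspan : (ℝ ∙ (‖v‖⁻¹ • v)) = (ℝ ∙ v) :=
      Submodule.span_singleton_smul_eq
        (IsUnit.mk0 _ (inv_ne_zero (norm_ne_zero_iff.2 hv))) v
    have hρe : ∀ x, hyperplaneReflection c (‖v‖⁻¹ • v) x = ρ x := fun x => by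
      rw [hρ, hyperplaneReflection_apply, hyperplaneReflection_apply]
      simp only [hspan]
    refine steklov_ball_odd hR hv' hb fun x => ?_
    rw [hρe, hρ, hyperplaneReflection_involutive]
    ring
  unfold steklovDefect
  nlinarith

/-- Repeated symmetrisation: as long as a function oscillates by at least `ε` on the sphere,
symmetrising it with respect to the reflection exchanging two extremal points decreases its boundary
norm by a fixed amount, so after finitely many steps the oscillation is below `ε`. -/
theorem exists_small_oscillation (hN : 1 ≤ N) (hR : 0 < R) {L : ℝ} (hL : 0 ≤ L) {ε : ℝ}
    (hε : 0 < ε) {w : EuclideanSpace ℝ (Fin N) → ℝ} (hw : ContDiff ℝ 1 w)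
    (hwL : ∀ x ∈ Metric.closedBall c R, ∀ y ∈ Metric.closedBall c R, |w x - w y| ≤ L * ‖x - y‖)
    (hw0 : ∫ x, w x ∂(surfaceMeasure (Metric.ball c R)) = 0) :
    ∃ w' : EuclideanSpace ℝ (Fin N) → ℝ, ContDiff ℝ 1 w' ∧
      ∫ x, w' x ∂(surfaceMeasure (Metric.ball c R)) = 0 ∧
      steklovDefect c R w' ≤ steklovDefect c R w ∧
      ∀ x ∈ Metric.sphere c R, ∀ y ∈ Metric.sphere c R, w' x - w' y < ε := by
  have hB := isBoundedC1Domain_ball c hR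
  have := hB.isFiniteMeasure
  set σ := surfaceMeasure (Metric.ball c R) with hσ
  -- symmetrisation preserves the Lipschitz constant `L`, so the odd part, which is at least `ε / 2`
  -- at an extremal point, stays above `ε / 4` on a cap of fixed radius `δ`
  set δ := ε / (4 * (L + 1)) with hδ
  have hδ0 : 0 < δ := by positivity
  have hLδ : L * δ ≤ ε / 4 := by
    rw [hδ, mul_div_assoc', div_le_div_iff₀ (by positivity) (by positivity)]
    nlinarith
  obtain ⟨m, hm, hcap⟩ := exists_cap_measure_pos hN c hR hδ0
  set d := (ε / 4) ^ 2 * m with hd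
  have hd0 : 0 < d := by positivity
  by_contra hcon
  push Not at hcon
  have step : ∀ n : ℕ, ∃ w' : EuclideanSpace ℝ (Fin N) → ℝ, ContDiff ℝ 1 w' ∧
      (∀ x ∈ Metric.closedBall c R, ∀ y ∈ Metric.closedBall c R,
        |w' x - w' y| ≤ L * ‖x - y‖) ∧
      ∫ x, w' x ∂σ = 0 ∧ steklovDefect c R w' ≤ steklovDefect c R w ∧
      ∫ x, w' x ^ 2 ∂σ ≤ ∫ x, w x ^ 2 ∂σ - n * d := by
    intro n
    induction n with
    | zero => exact ⟨w, hw, hwL, hw0, le_rfl, by simp⟩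
    | succ n ih =>
      obtain ⟨u, hu, huL, hu0, hudef, husq⟩ := ih
      obtain ⟨x, hx, y, hy, hxy⟩ := hcon u hu hu0 hudef
      have hne : x - y ≠ 0 := by
        intro h
        rw [sub_eq_zero.1 h, sub_self] at hxy
        linarith
      set ρ := hyperplaneReflection c (x - y) with hρ
      have hρd : ContDiff ℝ 1 ρ := contDiff_hyperplaneReflection c (x - y)
      have hρx : ρ x = y := hyperplaneReflection_sub_eq (by
        rw [mem_sphere_iff_norm.1 hx, mem_sphere_iff_norm.1 hy])
      have hρB : ∀ z ∈ Metric.closedBall c R, ρ z ∈ Metric.closedBall c R := fun z hz => by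
        rw [mem_closedBall_iff_norm, norm_hyperplaneReflection_sub]
        exact mem_closedBall_iff_norm.1 hz
      have huρ : ContDiff ℝ 1 fun x => u (ρ x) := hu.comp hρd
      have huc := hu.continuous
      have huρc := huρ.continuous
      have hsplit := steklovDefect_even_part (c := c) hR hne hu
      refine ⟨fun z => (1 / 2 : ℝ) * (u z + u (ρ z)), contDiff_const.mul (hu.add huρ), ?_, ?_,
        hsplit.1.trans hudef, ?_⟩
      · intro z hz z' hz'
        have h1 := abs_le.1 (huL z hz z' hz')
        have h2 := huL _ (hρB z hz) _ (hρB z' hz')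
        rw [← dist_eq_norm (ρ z), ρ.dist_eq, dist_eq_norm] at h2
        have h2 := abs_le.1 h2
        rw [abs_le]
        constructor <;> linarith [h1.1, h1.2, h2.1, h2.2]
      · have h1 : ∫ x, u (ρ x) ∂σ = ∫ x, u x ∂σ :=
          (measurePreserving_hyperplaneReflection_surface c (x - y) R).integral_comp
            ρ.toHomeomorph.measurableEmbedding u
        rw [integral_const_mul, integral_add (integrable_surfaceMeasure_of_continuous hB huc)
          (integrable_surfaceMeasure_of_continuous hB huρc), h1, hu0]
        simp
      · have hlow : d ≤ ∫ z, ((1 / 2 : ℝ) * (u z - u (ρ z))) ^ 2 ∂σ := by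
          have hint : Integrable (fun z => ((1 / 2 : ℝ) * (u z - u (ρ z))) ^ 2) σ :=
            integrable_surfaceMeasure_of_continuous hB (by fun_prop)
          calc d ≤ (ε / 4) ^ 2 * σ.real (Metric.ball x δ) := by
                rw [hd]; gcongr; exact hcap x hx
            _ = ∫ z in Metric.ball x δ, (ε / 4) ^ 2 ∂σ := by
                rw [setIntegral_const, smul_eq_mul, mul_comm]
            _ ≤ ∫ z in Metric.ball x δ, ((1 / 2 : ℝ) * (u z - u (ρ z))) ^ 2 ∂σ := by
                refine integral_mono_ae (integrable_const _) hint.integrableOn ?_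
                have h3 : ∀ᵐ z ∂σ.restrict (Metric.ball x δ), z ∈ frontier (Metric.ball c R) :=
                  ae_restrict_of_ae (ae_mem_frontier _)
                filter_upwards [h3, ae_restrict_mem measurableSet_ball] with z hz hzx
                have hzc : z ∈ Metric.closedBall c R :=
                  closure_ball c hR.ne' ▸ frontier_subset_closure hz
                have hxc : x ∈ Metric.closedBall c R := Metric.sphere_subset_closedBall hx
                have h4 := abs_le.1 (huL z hzc x hxc)
                have h5 := huL _ (hρB z hzc) _ (hρB x hxc)
                rw [← dist_eq_norm (ρ z), ρ.dist_eq, dist_eq_norm] at h5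
                have h5 := abs_le.1 h5
                rw [hρx] at h5
                have h6 : L * ‖z - x‖ ≤ ε / 4 := by
                  refine (mul_le_mul_of_nonneg_left ?_ hL).trans hLδ
                  exact (mem_ball_iff_norm.1 hzx).le
                have h7 : ε / 4 ≤ (1 / 2 : ℝ) * (u z - u (ρ z)) := by linarith [h4.1, h5.2]
                gcongr
            _ ≤ _ := setIntegral_le_integral hint (Eventually.of_forall fun z => sq_nonneg _)
        push_cast
        have h8 := hsplit.2
        rw [← hσ] at h8
        linarith
  obtain ⟨n, hn⟩ := exists_nat_gt ((∫ x, w x ^ 2 ∂σ) / d)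
  obtain ⟨u, hu, huL, hu0, hudef, husq⟩ := step n
  rw [div_lt_iff₀ hd0] at hn
  have : 0 ≤ ∫ x, u x ^ 2 ∂σ := integral_nonneg fun x => sq_nonneg _
  linarith

/-- The sharp Steklov inequality on a ball for functions with zero mean on the sphere. -/
theorem steklov_ball (hN : 1 ≤ N) (hR : 0 < R) {w : EuclideanSpace ℝ (Fin N) → ℝ}
    (hw : ContDiff ℝ 1 w) (hw0 : ∫ x, w x ∂(surfaceMeasure (Metric.ball c R)) = 0) :
    ∫ x, w x ^ 2 ∂(surfaceMeasure (Metric.ball c R)) ≤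
      R * ∫ x in Metric.ball c R, ‖fderiv ℝ w x‖ ^ 2 := by
  have hB := isBoundedC1Domain_ball c hR
  have := hB.isFiniteMeasure
  set σ := surfaceMeasure (Metric.ball c R) with hσ
  have hσ0 : 0 < σ.real univ := by
    refine ENNReal.toReal_pos ?_ (measure_ne_top _ _)
    rw [Ne, Measure.measure_univ_eq_zero]
    exact surfaceMeasure_ne_zero hN hB
  obtain ⟨L, hL0, hL⟩ := exists_lipschitz_closedBall c R hw
  have key : ∀ ε : ℝ, 0 < ε → -(ε ^ 2 * σ.real univ) ≤ steklovDefect c R w := by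
    intro ε hε
    obtain ⟨u, hu, hu0, hdef, hosc⟩ := exists_small_oscillation hN hR hL0 hε hw hL hw0
    have huc := hu.continuous
    have hui := integrable_surfaceMeasure_of_continuous hB huc
    -- a function of mean zero is bounded by its oscillation
    have hbound : ∀ y ∈ Metric.sphere c R, |u y| ≤ ε := by
      intro y hy
      have h1 : σ.real univ * u y = ∫ x, (u y - u x) ∂σ := by
        rw [integral_sub (integrable_const _) hui, hu0, integral_const, smul_eq_mul, sub_zero]
      have h2 : ‖∫ x, (u y - u x) ∂σ‖ ≤ ε * σ.real univ := by
        refine norm_integral_le_of_norm_le_const ?_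
        filter_upwards [ae_mem_frontier _] with x hx
        rw [frontier_ball c hR.ne'] at hx
        rw [Real.norm_eq_abs, abs_le]
        constructor <;> linarith [hosc x hx y hy, hosc y hy x hx]
      rw [← h1, norm_mul, Real.norm_of_nonneg hσ0.le, mul_comm] at h2
      exact le_of_mul_le_mul_right h2 hσ0
    have h3 : ∫ x, u x ^ 2 ∂σ ≤ ε ^ 2 * σ.real univ := by
      have : ε ^ 2 * σ.real univ = ∫ x, ε ^ 2 ∂σ := by
        rw [integral_const, smul_eq_mul, mul_comm]
      rw [this]
      refine integral_mono_ae (integrable_surfaceMeasure_of_continuous hB (by fun_prop))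
        (integrable_const _) ?_
      filter_upwards [ae_mem_frontier _] with x hx
      rw [frontier_ball c hR.ne'] at hx
      rw [← sq_abs]
      gcongr
      exact hbound x hx
    have h4 : 0 ≤ R * ∫ x in Metric.ball c R, ‖fderiv ℝ u x‖ ^ 2 :=
      mul_nonneg hR.le (integral_nonneg fun x => sq_nonneg _)
    have h5 : steklovDefect c R u = R * (∫ x in Metric.ball c R, ‖fderiv ℝ u x‖ ^ 2) -
      ∫ x, u x ^ 2 ∂σ := rfl
    linarith
  have hlim : Tendsto (fun ε : ℝ => -(ε ^ 2 * σ.real univ)) (𝓝[>] 0) (𝓝 0) := by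
    have : Continuous fun ε : ℝ => -(ε ^ 2 * σ.real univ) := by fun_prop
    simpa using (this.tendsto 0).mono_left (nhdsWithin_le_nhds (s := Ioi 0))
  have := le_of_tendsto hlim (eventually_nhdsWithin_of_forall fun ε hε => key ε hε)
  unfold steklovDefect at this
  linarith

end symmetrization

/-! ### Translations, averages and the cone condition -/

section

variable {N : ℕ}

/-- The Cauchy–Schwarz inequality against the constant one. -/
theorem sq_integral_le {X : Type*} [MeasurableSpace X] {μ : Measure X} [IsFiniteMeasure μ]
    {f : X → ℝ} (hf : Integrable f μ) (hf2 : Integrable (fun x => f x ^ 2) μ) :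
    (∫ x, f x ∂μ) ^ 2 ≤ μ.real univ * ∫ x, f x ^ 2 ∂μ := by
  set m := μ.real univ with hm
  set I := ∫ x, f x ∂μ with hI
  have h0 : 0 ≤ ∫ x, (m * f x - I) ^ 2 ∂μ := integral_nonneg fun x => sq_nonneg _
  have h1 : ∫ x, (m * f x - I) ^ 2 ∂μ = m * (m * ∫ x, f x ^ 2 ∂μ - I ^ 2) := by
    have e : ∀ x, (m * f x - I) ^ 2 = m ^ 2 * f x ^ 2 -
        (2 * m * I * f x - I ^ 2) := fun x => by ring
    simp_rw [e]
    have hg : Integrable (fun x => 2 * m * I * f x - I ^ 2) μ :=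
      (hf.const_mul _).sub (integrable_const _)
    rw [integral_sub (hf2.const_mul _) hg,
      integral_sub (hf.const_mul _) (integrable_const _), integral_const_mul, integral_const_mul,
      integral_const, ← hI, ← hm, smul_eq_mul]
    ring
  rcases eq_or_lt_of_le (measureReal_nonneg : 0 ≤ μ.real univ) with h | h
  · have hμ : μ = 0 := by
      rw [← Measure.measure_univ_eq_zero]
      simpa [Measure.real, ENNReal.toReal_eq_zero_iff] using h.symm
    simp [hI, hμ]
  · rw [h1] at h0
    have := (mul_nonneg_iff_of_pos_left h).1 h0
    linarith

/-- Shifting a `C^1` function along a segment that stays in `Ω` changes it, in `L²`, by at most the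
length of the segment times the Dirichlet norm. -/
theorem integral_translate_sub_sq_le {Ω D : Set (EuclideanSpace ℝ (Fin N))}
    {y : EuclideanSpace ℝ (Fin N)}
    (hΩb : Bornology.IsBounded Ω)
    (hD_sub : ∀ x ∈ D, ∀ t ∈ Icc (0 : ℝ) 1, x + t • y ∈ Ω)
    {u : EuclideanSpace ℝ (Fin N) → ℝ} (hu : ContDiff ℝ 1 u) :
    ∫ x in D, (u (x + y) - u x) ^ 2 ≤ ‖y‖ ^ 2 * ∫ x in Ω, ‖fderiv ℝ u x‖ ^ 2 := by
  have hDΩ : D ⊆ Ω := fun x hx => by simpa using hD_sub x hx 0 (by simp)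
  have hDb : Bornology.IsBounded D := hΩb.subset hDΩ
  have hK : IsCompact (closure D) := hDb.isCompact_closure
  have hΩi : IntegrableOn (fun x => ‖fderiv ℝ u x‖ ^ 2) Ω :=
    (((hu.continuous_fderiv one_ne_zero).norm.pow 2).continuousOn.integrableOn_compact
      hΩb.isCompact_closure).mono_set subset_closure
  have hc : Continuous fun q : EuclideanSpace ℝ (Fin N) × ℝ => ‖fderiv ℝ u (q.1 + q.2 • y)‖ ^ 2 :=
    (((hu.continuous_fderiv one_ne_zero).comp (by fun_prop)).norm.pow 2)
  have : IsFiniteMeasure (volume.restrict (Icc (0:ℝ) 1)) := ⟨by simp⟩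
  have hpt : ∀ x, (u (x + y) - u x) ^ 2 ≤
      ‖y‖ ^ 2 * ∫ t in Icc (0:ℝ) 1, ‖fderiv ℝ u (x + t • y)‖ ^ 2 := by
    intro x
    have hcx : Continuous fun t : ℝ => fderiv ℝ u (x + t • y) y :=
      ((hu.continuous_fderiv one_ne_zero).comp (by fun_prop)).clm_apply continuous_const
    have hftc : u (x + y) - u x = ∫ t in Icc (0:ℝ) 1, fderiv ℝ u (x + t • y) y := by
      rw [integral_Icc_eq_integral_Ioc, ← intervalIntegral.integral_of_le zero_le_one,
        intervalIntegral.integral_eq_sub_of_hasDerivAt (f := fun t : ℝ => u (x + t • y))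
          (fun t _ => ?_) (hcx.intervalIntegrable _ _)]
      · simp
      · have h1 : HasDerivAt (fun t : ℝ => x + t • y) y t := by
          simpa using ((hasDerivAt_id t).smul_const y).const_add x
        exact ((hu.differentiable one_ne_zero _).hasFDerivAt).comp_hasDerivAt t h1
    rw [hftc]
    have hi : ∀ {f : ℝ → ℝ}, Continuous f → Integrable f (volume.restrict (Icc (0:ℝ) 1)) :=
      fun hf => hf.continuousOn.integrableOn_compact isCompact_Icc
    refine (sq_integral_le (hi hcx) (hi (hcx.pow 2))).trans ?_
    rw [show (volume.restrict (Icc (0:ℝ) 1)).real univ = 1 by simp, one_mul, ← integral_const_mul]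
    have hcx2 : Continuous fun t : ℝ => ‖fderiv ℝ u (x + t • y)‖ ^ 2 :=
      ((hu.continuous_fderiv one_ne_zero).comp (by fun_prop)).norm.pow 2
    refine integral_mono (hi (hcx.pow 2)) (hi (continuous_const.mul hcx2)) fun t => ?_
    · have := ContinuousLinearMap.le_opNorm (fderiv ℝ u (x + t • y)) y
      rw [Real.norm_eq_abs] at this
      calc (fderiv ℝ u (x + t • y) y) ^ 2 = |fderiv ℝ u (x + t • y) y| ^ 2 := (sq_abs _).symm
        _ ≤ (‖fderiv ℝ u (x + t • y)‖ * ‖y‖) ^ 2 := by gcongr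
        _ = _ := by ring
  have hci : Integrable (fun q : EuclideanSpace ℝ (Fin N) × ℝ => ‖fderiv ℝ u (q.1 + q.2 • y)‖ ^ 2)
      ((volume.restrict D).prod (volume.restrict (Icc (0:ℝ) 1))) := by
    rw [Measure.prod_restrict]
    exact (hc.continuousOn.integrableOn_compact (hK.prod isCompact_Icc)).mono_set
      (prod_mono subset_closure subset_rfl)
  have hui : IntegrableOn (fun x => (u (x + y) - u x) ^ 2) D :=
    ((((hu.continuous.comp (by fun_prop)).sub hu.continuous).pow 2).continuousOn.integrableOn_compact
      hK).mono_set subset_closure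
  calc ∫ x in D, (u (x + y) - u x) ^ 2
      ≤ ∫ x in D, ‖y‖ ^ 2 * ∫ t in Icc (0:ℝ) 1, ‖fderiv ℝ u (x + t • y)‖ ^ 2 :=
        integral_mono hui (hci.integral_prod_left.const_mul _) hpt
    _ = ‖y‖ ^ 2 * ∫ t in Icc (0:ℝ) 1, ∫ x in D, ‖fderiv ℝ u (x + t • y)‖ ^ 2 := by
        rw [integral_const_mul, integral_integral_swap hci]
    _ ≤ ‖y‖ ^ 2 * ∫ t in Icc (0:ℝ) 1, ∫ x in Ω, ‖fderiv ℝ u x‖ ^ 2 := by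
        gcongr ‖y‖ ^ 2 * ?_
        refine setIntegral_mono_on hci.integral_prod_right (integrable_const _) measurableSet_Icc
          fun t ht => ?_
        have h1 : MeasurePreserving (fun x : EuclideanSpace ℝ (Fin N) => x + t • y) volume volume :=
          measurePreserving_add_right _ _
        have hemb : MeasurableEmbedding fun x : EuclideanSpace ℝ (Fin N) => x + t • y :=
          (Homeomorph.addRight (t • y)).measurableEmbedding
        rw [← h1.setIntegral_image_emb hemb (fun x => ‖fderiv ℝ u x‖ ^ 2)]
        refine setIntegral_mono_set hΩi (ae_of_all _ fun x => by positivity) (LE.le.eventuallyLE ?_)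
        rintro _ ⟨x, hx, rfl⟩
        exact hD_sub x hx t ht
    _ = _ := by simp

/-- A `C^1` function is close in `L²(D)` to its averages over the balls `x + closedBall b ρ`, as
long as all segments from `x ∈ D` to these balls stay in `Ω`. -/
theorem integral_sq_le_average {Ω D : Set (EuclideanSpace ℝ (Fin N))} {b : EuclideanSpace ℝ (Fin N)}
    {ρ : ℝ} (hρ : 0 < ρ)
    (hΩb : Bornology.IsBounded Ω)
    (hD_sub : ∀ x ∈ D, ∀ y ∈ Metric.closedBall b ρ, ∀ t ∈ Icc (0 : ℝ) 1, x + t • y ∈ Ω)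
    {u : EuclideanSpace ℝ (Fin N) → ℝ} (hu : ContDiff ℝ 1 u) :
    ∫ x in D, u x ^ 2 ≤ 2 * ((‖b‖ + ρ) ^ 2 * ∫ x in Ω, ‖fderiv ℝ u x‖ ^ 2) +
      2 * ((volume.real (Metric.closedBall b ρ))⁻¹ ^ 2 *
        ∫ x in D, (∫ y in Metric.closedBall b ρ, u (x + y)) ^ 2) := by
  set B := Metric.closedBall b ρ with hB
  have hDΩ : D ⊆ Ω := fun x hx => by
    simpa using hD_sub x hx b (Metric.mem_closedBall_self hρ.le) 0 (by simp)
  have hDb : Bornology.IsBounded D := hΩb.subset hDΩ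
  have hK : IsCompact (closure D) := hDb.isCompact_closure
  have hBK : IsCompact B := isCompact_closedBall b ρ
  have : IsFiniteMeasure (volume.restrict B) := ⟨by simpa using hBK.measure_lt_top⟩
  have hBi : ∀ {f : EuclideanSpace ℝ (Fin N) → ℝ}, Continuous f → Integrable f
      (volume.restrict B) :=
    fun hf => hf.continuousOn.integrableOn_compact hBK
  have hDi : ∀ {f : EuclideanSpace ℝ (Fin N) → ℝ}, Continuous f → Integrable f
      (volume.restrict D) :=
    fun hf => (hf.continuousOn.integrableOn_compact hK).mono_set subset_closure
  set V := volume.real B with hV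
  have hVpos : 0 < V := ENNReal.toReal_pos
    (Metric.measure_closedBall_pos _ _ hρ).ne' hBK.measure_lt_top.ne
  have hc : Continuous fun q : EuclideanSpace ℝ (Fin N) × EuclideanSpace ℝ (Fin N) =>
      (u (q.1 + q.2) - u q.1) ^ 2 :=
    ((hu.continuous.comp (by fun_prop)).sub (hu.continuous.comp (by fun_prop))).pow 2
  have hci : Integrable (fun q : EuclideanSpace ℝ (Fin N) × EuclideanSpace ℝ (Fin N) =>
      (u (q.1 + q.2) - u q.1) ^ 2) ((volume.restrict D).prod (volume.restrict B)) := by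
    rw [Measure.prod_restrict]
    exact (hc.continuousOn.integrableOn_compact (hK.prod hBK)).mono_set
      (prod_mono subset_closure subset_rfl)
  have hA : Continuous fun x => ∫ y in B, u (x + y) :=
    continuous_parametric_integral_of_continuous (f := fun x y => u (x + y))
      (hu.continuous.comp (continuous_fst.add continuous_snd)) hBK
  have hA2 : Integrable (fun x => (∫ y in B, u (x + y)) ^ 2) (volume.restrict D) := hDi (hA.pow 2)
  have hpt : ∀ x, u x ^ 2 ≤ 2 * (V⁻¹ * ∫ y in B, (u (x + y) - u x) ^ 2) +
      2 * (V⁻¹ ^ 2 * (∫ y in B, u (x + y)) ^ 2) := by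
    intro x
    have hux : Continuous fun y => u (x + y) := hu.continuous.comp (by fun_prop)
    have h1 := sq_integral_le (hBi (hux.sub (continuous_const (y := u x))))
      (hBi ((hux.sub (continuous_const (y := u x))).pow 2))
    simp only [Pi.sub_apply] at h1
    rw [integral_sub (hBi hux) (integrable_const _), integral_const, smul_eq_mul,
      show (volume.restrict B).real univ = V by simp [hV]] at h1
    set J := ∫ y in B, u (x + y)
    have h2 : (V⁻¹ * J - u x) ^ 2 ≤ V⁻¹ * ∫ y in B, (u (x + y) - u x) ^ 2 := by
      have h3 : (V⁻¹ * J - u x) ^ 2 = V⁻¹ ^ 2 * (J - V * u x) ^ 2 := by field_simp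
      rw [h3]
      calc V⁻¹ ^ 2 * (J - V * u x) ^ 2 ≤ V⁻¹ ^ 2 * (V * ∫ y in B,
          (u (x + y) - u x) ^ 2) := by gcongr
        _ = _ := by field_simp
    nlinarith [sq_nonneg (2 * (V⁻¹ * J) - u x)]
  have hint : Integrable (fun x => ∫ y in B, (u (x + y) - u x) ^ 2) (volume.restrict D) :=
    hci.integral_prod_left
  calc ∫ x in D, u x ^ 2
      ≤ ∫ x in D, (2 * (V⁻¹ * ∫ y in B, (u (x + y) - u x) ^ 2) +
          2 * (V⁻¹ ^ 2 * (∫ y in B, u (x + y)) ^ 2)) :=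
        integral_mono (hDi (hu.continuous.pow 2)) (((hint.const_mul _).const_mul _).add
          ((hA2.const_mul _).const_mul _)) hpt
    _ = 2 * (V⁻¹ * ∫ y in B, ∫ x in D, (u (x + y) - u x) ^ 2) +
          2 * (V⁻¹ ^ 2 * ∫ x in D, (∫ y in B, u (x + y)) ^ 2) := by
        rw [integral_add ((hint.const_mul _).const_mul _) ((hA2.const_mul _).const_mul _),
          integral_const_mul, integral_const_mul, integral_const_mul, integral_const_mul,
          integral_integral_swap hci]
    _ ≤ 2 * (V⁻¹ * ∫ y in B, (‖b‖ + ρ) ^ 2 * ∫ x in Ω, ‖fderiv ℝ u x‖ ^ 2) +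
          2 * (V⁻¹ ^ 2 * ∫ x in D, (∫ y in B, u (x + y)) ^ 2) := by
        gcongr 2 * (V⁻¹ * ?_) + _
        refine setIntegral_mono_on hci.integral_prod_right (integrable_const _)
          measurableSet_closedBall fun y hy => ?_
        refine (integral_translate_sub_sq_le hΩb (fun x hx => hD_sub x hx y hy) hu).trans ?_
        have : ‖y‖ ≤ ‖b‖ + ρ := by
          have := norm_sub_norm_le y b
          have h2 : ‖y - b‖ ≤ ρ := by simpa [hB, dist_eq_norm] using hy
          linarith
        have h0 : 0 ≤ ∫ x in Ω, ‖fderiv ℝ u x‖ ^ 2 := integral_nonneg fun x => by positivity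
        gcongr
    _ = _ := by
        rw [integral_const, smul_eq_mul, show (volume.restrict B).real univ = V by simp [hV]]
        field_simp

/-- Interior cone condition: near each point of the closure of a `C^1` domain, all segments from
points of `Ω` to the vectors of one fixed ball stay in `Ω`. -/
theorem IsBoundedC1Domain.exists_cone {Ω : Set (EuclideanSpace ℝ (Fin N))}
    (hΩ : IsBoundedC1Domain Ω)
    {p : EuclideanSpace ℝ (Fin N)} (hp : p ∈ closure Ω) :
    ∃ r > 0, ∃ (a : EuclideanSpace ℝ (Fin N)) (κ : ℝ), 0 < κ ∧
      ∀ x ∈ Ω ∩ Metric.ball p r, ∀ y ∈ Metric.closedBall a κ, ∀ t ∈ Icc (0 : ℝ) 1,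
        x + t • y ∈ Ω := by
  by_cases hpi : p ∈ Ω
  · obtain ⟨r, hr, hball⟩ := Metric.isOpen_iff.1 hΩ.isOpen p hpi
    refine ⟨r / 2, by positivity, 0, r / 4, by positivity, fun x hx y hy t ht => hball ?_⟩
    have hx2 := hx.2
    rw [Metric.mem_ball, dist_eq_norm] at hx2 ⊢
    rw [mem_closedBall_zero_iff] at hy
    calc ‖x + t • y - p‖ = ‖(x - p) + t • y‖ := by congr 1; abel
      _ ≤ ‖x - p‖ + ‖t • y‖ := norm_add_le _ _
      _ ≤ ‖x - p‖ + 1 * (r / 4) := by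
          rw [norm_smul, Real.norm_eq_abs, abs_of_nonneg ht.1]
          gcongr
          exact ht.2
      _ < r := by linarith
  · have hpf : p ∈ frontier Ω := ⟨hp, by rwa [hΩ.isOpen.interior_eq]⟩
    obtain ⟨e, γ, r, h⟩ := hΩ.exists_chart hpf
    have he := h.norm_eq
    obtain ⟨K, U, hU, hK⟩ := (h.contDiff.contDiffAt
        (x := (ℝ ∙ e)ᗮ.orthogonalProjectionOnto p)).exists_lipschitzOnWith
    obtain ⟨s, hs, hsU⟩ := Metric.mem_nhds_iff.1 hU
    set ρ := min r s / 2 with hρ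
    have hρ0 : 0 < ρ := by have := h.pos; positivity
    have hρr : 2 * ρ ≤ r := by rw [hρ]; linarith [min_le_left r s]
    have hρs : 2 * ρ ≤ s := by rw [hρ]; linarith [min_le_right r s]
    have hK0 : (0:ℝ) ≤ K := K.2
    -- with `κ = ρ / (K + 3)` and height `(K + 2) κ`, both the graph condition and the size fit
    set κ := ρ / (K + 3) with hκ
    have hκ0 : 0 < κ := by positivity
    have hκρ : (K + 3) * κ = ρ := by rw [hκ]; field_simp
    refine ⟨ρ, hρ0, ((K + 2) * κ) • e, κ, hκ0, fun x hx y hy t ht => ?_⟩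
    have hxp : ‖x - p‖ < ρ := by simpa [dist_eq_norm] using hx.2
    have hy' : ‖y - ((K + 2) * κ) • e‖ ≤ κ := by simpa [dist_eq_norm] using hy
    have hyn : ‖y‖ ≤ ρ := by
      have h1 := norm_sub_norm_le y (((K + 2) * κ) • e)
      rw [norm_smul, he, mul_one, Real.norm_of_nonneg (by positivity)] at h1
      nlinarith
    have htyn : ‖t • y‖ ≤ ρ := by
      rw [norm_smul, Real.norm_eq_abs, abs_of_nonneg ht.1]
      nlinarith [ht.1, ht.2, norm_nonneg y]
    have hz : ‖x + t • y - p‖ < 2 * ρ := by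
      calc ‖x + t • y - p‖ = ‖(x - p) + t • y‖ := by congr 1; abel
        _ ≤ ‖x - p‖ + ‖t • y‖ := norm_add_le _ _
        _ < 2 * ρ := by linarith
    set P := (ℝ ∙ e)ᗮ.orthogonalProjectionOnto with hP
    have hPn : ∀ v, ‖P v‖ ≤ ‖v‖ := fun v => Submodule.norm_orthogonalProjectionOnto_apply_le _ v
    have hmem : ∀ v : EuclideanSpace ℝ (Fin N), ‖v - p‖ < 2 * ρ → P v ∈ U := fun v hv => hsU (by
      rw [Metric.mem_ball, dist_eq_norm, ← map_sub]
      exact ((hPn _).trans_lt hv).trans_le hρs)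
    have hPy : ‖P y‖ ≤ κ := by
      have : P y = P (y - ((K + 2) * κ) • e) := by
        rw [map_sub, map_smul]
        have : P e = 0 := by
          have := orthogonalProjectionOnto_add_smul e 0 1
          rwa [one_smul, Submodule.coe_zero, zero_add] at this
        rw [this]; simp
      rw [this]
      exact (hPn _).trans hy'
    have hey : (K + 1) * κ ≤ ⟪e, y⟫ := by
      have h1 : ⟪e, y⟫ = (K + 2) * κ + ⟪e, y - ((K + 2) * κ) • e⟫ := by
        rw [inner_sub_right, inner_smul_right, real_inner_self_eq_norm_sq, he]; ring
      have h2 := abs_real_inner_le_norm e (y - ((K + 2) * κ) • e)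
      rw [he, one_mul] at h2
      have h3 := (abs_le.1 (h2.trans hy')).1
      rw [h1]; linarith
    have hxin : x ∈ Metric.ball p r := by
      rw [Metric.mem_ball, dist_eq_norm]; linarith
    have hzin : x + t • y ∈ Metric.ball p r := by
      rw [Metric.mem_ball, dist_eq_norm]; linarith
    rw [h.mem_iff _ hzin]
    have hxlt := (h.mem_iff _ hxin).1 hx.1
    have hlip := hK.dist_le_mul _ (hmem _ hz) _ (hmem x (by linarith))
    rw [Real.dist_eq, dist_eq_norm, ← map_sub, add_sub_cancel_left, map_smul, norm_smul,
      Real.norm_eq_abs, abs_of_nonneg ht.1] at hlip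
    rw [inner_add_right, inner_smul_right]
    have h4 := (abs_le.1 hlip).2
    have h5 : (K:ℝ) * (t * ‖P y‖) ≤ t * ⟪e, y⟫ := by
      have : (K:ℝ) * ‖P y‖ ≤ ⟪e, y⟫ := by nlinarith
      calc (K:ℝ) * (t * ‖P y‖) = t * (K * ‖P y‖) := by ring
        _ ≤ _ := mul_le_mul_of_nonneg_left this ht.1
    linarith

end

/-! ### Rellich's theorem -/

section

variable {N : ℕ} {Ω : Set (EuclideanSpace ℝ (Fin N))}

/-- Weak sequential compactness of bounded sets in a separable Hilbert space, phrased through inner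
products. -/
theorem exists_subseq_tendsto_inner {H : Type*} [NormedAddCommGroup H] [InnerProductSpace ℝ H]
    [CompleteSpace H] [TopologicalSpace.SeparableSpace H] (f : ℕ → H) {C : ℝ}
    (hf : ∀ n, ‖f n‖ ≤ C) :
    ∃ φ : ℕ → ℕ, StrictMono φ ∧ ∀ h : H, ∃ l : ℝ, Tendsto (fun n => ⟪h, f (φ n)⟫) atTop (𝓝 l) := by
  have hs := WeakDual.isSeqCompact_closedBall ℝ H 0 C
  obtain ⟨a, -, φ, hφ, ha⟩ := hs (x := fun n =>
    StrongDual.toWeakDual (InnerProductSpace.toDual ℝ H (f n))) (fun n => by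
      simpa using hf n)
  refine ⟨φ, hφ, fun h => ⟨a h, ?_⟩⟩
  have h1 := ((WeakDual.eval_continuous h).tendsto a).comp ha
  refine h1.congr fun n => ?_
  simp [real_inner_comm]

/-- A bounded sequence in `L²(Ω)` of continuous functions has a subsequence whose integrals over
each measurable set converge. -/
theorem exists_subseq_setIntegral (hΩ : IsBoundedC1Domain Ω)
    {w : ℕ → EuclideanSpace ℝ (Fin N) → ℝ} (hw : ∀ n, Continuous (w n)) {M : ℝ}
    (hM : ∀ n, ∫ x in Ω, w n x ^ 2 ≤ M) :
    ∃ φ : ℕ → ℕ, StrictMono φ ∧ ∀ A : Set (EuclideanSpace ℝ (Fin N)), MeasurableSet A → A ⊆ Ω →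
      ∃ l : ℝ, Tendsto (fun n => ∫ x in A, w (φ n) x) atTop (𝓝 l) := by
  have : Fact ((2 : ENNReal) ≠ ⊤) := ⟨by norm_num⟩
  have hL := fun n => memLp_of_continuous hΩ (hw n)
  obtain ⟨φ, hφ, h⟩ := exists_subseq_tendsto_inner (fun n => (hL n).toLp) (C := √M) (fun n => by
    refine Real.le_sqrt_of_sq_le (le_trans (le_of_eq ?_) (hM n))
    rw [← real_inner_self_eq_norm_sq, L2.inner_def]
    refine integral_congr_ae ?_
    filter_upwards [(hL n).coeFn_toLp] with x hx
    rw [hx]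
    simp [sq])
  refine ⟨φ, hφ, fun A hA hAΩ => ?_⟩
  have hfin : volume.restrict Ω A ≠ ⊤ := by
    rw [Measure.restrict_apply hA, inter_eq_self_of_subset_left hAΩ]
    exact ((measure_mono (hAΩ.trans subset_closure)).trans_lt
      hΩ.isCompact_closure.measure_lt_top).ne
  obtain ⟨l, hl⟩ := h (indicatorConstLp 2 hA hfin 1)
  refine ⟨l, hl.congr fun n => ?_⟩
  rw [L2.inner_indicatorConstLp_one hA hfin, Measure.restrict_restrict hA,
    inter_eq_self_of_subset_left hAΩ]
  refine setIntegral_congr_ae hA ?_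
  have := (ae_restrict_iff' hΩ.isOpen.measurableSet).1 (hL (φ n)).coeFn_toLp
  filter_upwards [this] with x hx hxA using hx (hAΩ hxA)

/-- If `h ≤ 2 f² + 2 g²` and both squares have integral at most `M`, then `h` has integral at most
`4 M`. It is used with `h` the square of a difference. -/
theorem integral_sub_sq_le_four {X : Type*} [MeasurableSpace X] {μ : Measure X} {f g h : X → ℝ}
    (hh : Integrable h μ)
    (hf : Integrable (fun x => f x ^ 2) μ) (hg : Integrable (fun x => g x ^ 2) μ) {M : ℝ}
    (hle : ∀ x, h x ≤ 2 * f x ^ 2 + 2 * g x ^ 2)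
    (hfM : ∫ x, f x ^ 2 ∂μ ≤ M) (hgM : ∫ x, g x ^ 2 ∂μ ≤ M) :
    ∫ x, h x ∂μ ≤ 4 * M := by
  calc ∫ x, h x ∂μ ≤ ∫ x, (2 * f x ^ 2 + 2 * g x ^ 2) ∂μ :=
        integral_mono hh ((hf.const_mul 2).add (hg.const_mul 2)) hle
    _ = 2 * ∫ x, f x ^ 2 ∂μ + 2 * ∫ x, g x ^ 2 ∂μ := by
        rw [integral_add (hf.const_mul 2) (hg.const_mul 2), integral_const_mul, integral_const_mul]
    _ ≤ 4 * M := by linarith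

theorem integral_norm_fderiv_sub_sq_le (hΩ : IsBoundedC1Domain Ω)
    {f g : EuclideanSpace ℝ (Fin N) → ℝ} (hf : ContDiff ℝ 1 f) (hg : ContDiff ℝ 1 g) {M : ℝ}
    (hfM : ∫ x in Ω, ‖fderiv ℝ f x‖ ^ 2 ≤ M) (hgM : ∫ x in Ω, ‖fderiv ℝ g x‖ ^ 2 ≤ M) :
    ∫ x in Ω, ‖fderiv ℝ (fun y => f y - g y) x‖ ^ 2 ≤ 4 * M := by
  have hint : ∀ {h : EuclideanSpace ℝ (Fin N) → ℝ}, ContDiff ℝ 1 h →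
      IntegrableOn (fun x => ‖fderiv ℝ h x‖ ^ 2) Ω :=
    fun hh => integrableOn_of_continuous hΩ ((hh.continuous_fderiv one_ne_zero).norm.pow 2)
  refine integral_sub_sq_le_four (hint (hf.sub hg)) (hint hf) (hint hg) (fun x => ?_) hfM hgM
  rw [show fderiv ℝ (fun y => f y - g y) x = fderiv ℝ f x - fderiv ℝ g x from
    fderiv_fun_sub (hf.differentiable one_ne_zero x) (hg.differentiable one_ne_zero x)]
  calc ‖fderiv ℝ f x - fderiv ℝ g x‖ ^ 2 ≤ (‖fderiv ℝ f x‖ + ‖fderiv ℝ g x‖) ^ 2 := by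
        gcongr
        exact norm_sub_le _ _
    _ ≤ _ := by nlinarith [sq_nonneg (‖fderiv ℝ f x‖ - ‖fderiv ℝ g x‖)]

theorem integral_translate_closedBall (u : EuclideanSpace ℝ (Fin N) → ℝ)
    (x b : EuclideanSpace ℝ (Fin N)) (ρ : ℝ) :
    ∫ y in Metric.closedBall b ρ, u (x + y) = ∫ z in Metric.closedBall (x + b) ρ, u z := by
  have h1 : MeasurePreserving (fun y : EuclideanSpace ℝ (Fin N) => x + y) volume volume :=
    measurePreserving_add_left _ _
  have hemb : MeasurableEmbedding fun y : EuclideanSpace ℝ (Fin N) => x + y :=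
    (Homeomorph.addLeft x).measurableEmbedding
  rw [← h1.setIntegral_image_emb hemb u]
  congr 2
  simp [add_comm]

/-- On a piece `D` of `Ω` with the cone property, integrals over balls control the `L²` norm up to
a small multiple of the Dirichlet norm, so their convergence gives a Cauchy sequence in `L²(D)`. -/
theorem tendsto_integral_sub_sq_of_cone (hΩ : IsBoundedC1Domain Ω)
    {D : Set (EuclideanSpace ℝ (Fin N))} (hD : MeasurableSet D)
    {a : EuclideanSpace ℝ (Fin N)} {κ : ℝ} (hκ : 0 < κ)
    (hcone : ∀ x ∈ D, ∀ y ∈ Metric.closedBall a κ, ∀ t ∈ Icc (0 : ℝ) 1, x + t • y ∈ Ω)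
    {w : ℕ → EuclideanSpace ℝ (Fin N) → ℝ} (hw : ∀ n, ContDiff ℝ 1 (w n)) {M : ℝ}
    (hM : ∀ n, ∫ x in Ω, w n x ^ 2 ≤ M) (hM' : ∀ n, ∫ x in Ω, ‖fderiv ℝ (w n) x‖ ^ 2 ≤ M)
    (hconv : ∀ A : Set (EuclideanSpace ℝ (Fin N)), MeasurableSet A → A ⊆ Ω →
      ∃ l : ℝ, Tendsto (fun n => ∫ x in A, w n x) atTop (𝓝 l)) :
    Tendsto (fun q : ℕ × ℕ => ∫ x in D, (w q.1 x - w q.2 x) ^ 2) atTop (𝓝 0) := by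
  have hDΩ : D ⊆ Ω := fun x hx => by
    simpa using hcone x hx a (Metric.mem_closedBall_self hκ.le) 0 (by simp)
  have hM0 : 0 ≤ M := (integral_nonneg fun x => sq_nonneg (w 0 x)).trans (hM 0)
  set u : ℕ × ℕ → EuclideanSpace ℝ (Fin N) → ℝ := fun q x => w q.1 x - w q.2 x with hu
  have huc : ∀ q, ContDiff ℝ 1 (u q) := fun q => (hw q.1).sub (hw q.2)
  have hint : ∀ {f : EuclideanSpace ℝ (Fin N) → ℝ}, Continuous f → IntegrableOn f Ω :=
    fun hf => integrableOn_of_continuous hΩ hf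
  have huM : ∀ q, ∫ x in Ω, u q x ^ 2 ≤ 4 * M := fun q =>
    integral_sub_sq_le_four (hint ((huc q).continuous.pow 2)) (hint ((hw q.1).continuous.pow 2))
      (hint ((hw q.2).continuous.pow 2)) (fun x => by
        simp only [hu, Pi.pow_apply]; nlinarith [sq_nonneg (w q.1 x + w q.2 x)]) (hM q.1) (hM q.2)
  have huM' : ∀ q, ∫ x in Ω, ‖fderiv ℝ (u q) x‖ ^ 2 ≤ 4 * M := fun q =>
    integral_norm_fderiv_sub_sq_le hΩ (hw q.1) (hw q.2) (hM' q.1) (hM' q.2)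
  have hDfin : volume D < ⊤ := (measure_mono (hDΩ.trans subset_closure)).trans_lt
    hΩ.isCompact_closure.measure_lt_top
  -- the averages over any ball of vectors tend to zero in `L²(D)`
  have havg : ∀ (b : EuclideanSpace ℝ (Fin N)) (ρ : ℝ),
      (∀ x ∈ D, Metric.closedBall (x + b) ρ ⊆ Ω) →
      Tendsto (fun q => ∫ x in D, (∫ y in Metric.closedBall b ρ, u q (x + y)) ^ 2) atTop (𝓝 0) := by
    intro b ρ hb
    have hBfin : IsFiniteMeasure (volume.restrict (Metric.closedBall b ρ)) :=
      ⟨by simpa using (isCompact_closedBall b ρ).measure_lt_top⟩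
    have hlim : Tendsto (fun q => ∫ x in D, (∫ y in Metric.closedBall b ρ, u q (x + y)) ^ 2) atTop
        (𝓝 (∫ x in D, (0 : ℝ))) := by
      refine tendsto_integral_filter_of_dominated_convergence
        (fun _ => volume.real (Metric.closedBall b ρ) * (4 * M)) ?_ ?_ ?_ ?_
      · refine Eventually.of_forall fun q => Continuous.aestronglyMeasurable (Continuous.pow ?_ 2)
        exact continuous_parametric_integral_of_continuous (f := fun x y => u q (x + y))
          ((huc q).continuous.comp (continuous_fst.add continuous_snd)) (isCompact_closedBall b ρ)
      · refine Eventually.of_forall fun q => ?_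
        filter_upwards [ae_restrict_mem hD] with x hx
        rw [Real.norm_of_nonneg (sq_nonneg _)]
        have hc : Continuous fun y => u q (x + y) := (huc q).continuous.comp (by fun_prop)
        refine (sq_integral_le (hc.continuousOn.integrableOn_compact (isCompact_closedBall b ρ))
          ((hc.pow 2).continuousOn.integrableOn_compact (isCompact_closedBall b ρ))).trans ?_
        rw [show (volume.restrict (Metric.closedBall b ρ)).real univ =
          volume.real (Metric.closedBall b ρ) by simp]
        gcongr
        rw [integral_translate_closedBall (fun z => u q z ^ 2)]
        refine le_trans (setIntegral_mono_set (hint ((huc q).continuous.pow 2))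
          (ae_of_all _ fun x => by positivity) (LE.le.eventuallyLE (hb x hx))) (huM q)
      · have : IsFiniteMeasure (volume.restrict D) := ⟨by simpa using hDfin⟩
        exact integrable_const _
      · filter_upwards [ae_restrict_mem hD] with x hx
        obtain ⟨l, hl⟩ := hconv (Metric.closedBall (x + b) ρ) measurableSet_closedBall (hb x hx)
        have h1 : Tendsto (fun q : ℕ × ℕ => (∫ z in Metric.closedBall (x + b) ρ, w q.1 z) -
            ∫ z in Metric.closedBall (x + b) ρ, w q.2 z) atTop (𝓝 (l - l)) := by
          rw [← prod_atTop_atTop_eq]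
          exact (hl.comp tendsto_fst).sub (hl.comp tendsto_snd)
        have h2 := h1.pow 2
        rw [sub_self, zero_pow two_ne_zero] at h2
        refine h2.congr fun q => ?_
        rw [integral_translate_closedBall, ← integral_sub
          ((hint (hw q.1).continuous).mono_set (hb x hx))
          ((hint (hw q.2).continuous).mono_set (hb x hx))]
    simpa using hlim
  rw [Metric.tendsto_nhds]
  intro ε hε
  -- shrinking the ball of vectors by the factor `s` makes the Dirichlet contribution small
  obtain ⟨s, hs0, hs1, hsε⟩ : ∃ s : ℝ, 0 < s ∧ s ≤ 1 ∧
      2 * ((s * (‖a‖ + κ)) ^ 2 * (4 * M)) < ε / 2 := by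
    have hc : Tendsto (fun s : ℝ => 2 * ((s * (‖a‖ + κ)) ^ 2 * (4 * M))) (𝓝[>] 0) (𝓝 0) := by
      have : Continuous fun s : ℝ => 2 * ((s * (‖a‖ + κ)) ^ 2 * (4 * M)) := by fun_prop
      have h0 := this.tendsto 0
      simp only [zero_mul, zero_pow two_ne_zero, mul_zero] at h0
      exact h0.mono_left nhdsWithin_le_nhds
    have h1 := hc.eventually (gt_mem_nhds (half_pos hε))
    have h2 : ∀ᶠ s : ℝ in 𝓝[>] 0, s ∈ Ioc (0:ℝ) 1 := Ioc_mem_nhdsGT one_pos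
    obtain ⟨s, h3, h4⟩ := (h1.and h2).exists
    exact ⟨s, h4.1, h4.2, h3⟩
  have hscone : ∀ x ∈ D, ∀ y ∈ Metric.closedBall (s • a) (s * κ), ∀ t ∈ Icc (0 : ℝ) 1,
      x + t • y ∈ Ω := by
    intro x hx y hy t ht
    have hy' : s⁻¹ • y ∈ Metric.closedBall a κ := by
      rw [Metric.mem_closedBall, dist_eq_norm] at hy ⊢
      have : s⁻¹ • y - a = s⁻¹ • (y - s • a) := by
        rw [smul_sub, smul_smul, inv_mul_cancel₀ hs0.ne', one_smul]
      rw [this, norm_smul, norm_inv, Real.norm_of_nonneg hs0.le, inv_mul_le_iff₀ hs0]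
      exact hy
    have h1 := hcone x hx _ hy' (t * s) ⟨mul_nonneg ht.1 hs0.le, mul_le_one₀ ht.2 hs0.le hs1⟩
    rwa [smul_smul, mul_assoc, mul_inv_cancel₀ hs0.ne', mul_one] at h1
  have hb : ∀ x ∈ D, Metric.closedBall (x + s • a) (s * κ) ⊆ Ω := by
    intro x hx z hz
    have := hscone x hx (z - x) (by
      rw [Metric.mem_closedBall, dist_eq_norm] at hz ⊢
      rwa [sub_sub]) 1 (by simp)
    simpa using this
  have hlim := (havg _ _ hb).const_mul (2 * (volume.real (Metric.closedBall (s • a) (s * κ)))⁻¹ ^ 2)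
  rw [mul_zero] at hlim
  filter_upwards [hlim.eventually (gt_mem_nhds (half_pos hε))] with q hq
  have h0 : 0 ≤ ∫ x in D, u q x ^ 2 := integral_nonneg fun x => sq_nonneg _
  rw [Real.dist_eq, sub_zero, abs_of_nonneg h0]
  have h1 := integral_sq_le_average (b := s • a) (mul_pos hs0 hκ) hΩ.isBounded hscone (huc q)
  rw [norm_smul, Real.norm_of_nonneg hs0.le, ← mul_add] at h1
  have h2 : 2 * ((s * (‖a‖ + κ)) ^ 2 * ∫ x in Ω, ‖fderiv ℝ (u q) x‖ ^ 2) ≤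
      2 * ((s * (‖a‖ + κ)) ^ 2 * (4 * M)) := by
    gcongr
    exact huM' q
  rw [mul_assoc] at hq
  linarith

/-- Rellich's compactness theorem for `C^1` functions on a bounded `C^1` domain. -/
theorem IsBoundedC1Domain.rellich (hΩ : IsBoundedC1Domain Ω)
    {w : ℕ → EuclideanSpace ℝ (Fin N) → ℝ} (hw : ∀ n, ContDiff ℝ 1 (w n)) {M : ℝ}
    (hM : ∀ n, ∫ x in Ω, w n x ^ 2 ≤ M) (hM' : ∀ n, ∫ x in Ω, ‖fderiv ℝ (w n) x‖ ^ 2 ≤ M) :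
    ∃ φ : ℕ → ℕ, StrictMono φ ∧
      Tendsto (fun q : ℕ × ℕ => ∫ x in Ω, (w (φ q.1) x - w (φ q.2) x) ^ 2) atTop (𝓝 0) := by
  obtain ⟨φ, hφ, hconv⟩ := exists_subseq_setIntegral hΩ (fun n => (hw n).continuous) hM
  refine ⟨φ, hφ, ?_⟩
  choose! r hr a κ hκ hcone using fun p (hp : p ∈ closure Ω) => hΩ.exists_cone hp
  obtain ⟨t, ht, hcov⟩ := hΩ.isCompact_closure.elim_nhds_subcover (fun p => Metric.ball p (r p))
    (fun p hp => Metric.ball_mem_nhds p (hr p hp))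
  have hsum : Tendsto (fun q : ℕ × ℕ => ∑ p ∈ t, ∫ x in Ω ∩ Metric.ball p (r p),
      (w (φ q.1) x - w (φ q.2) x) ^ 2) atTop (𝓝 (∑ p ∈ t, 0)) :=
    tendsto_finsetSum _ fun p hp => tendsto_integral_sub_sq_of_cone hΩ
      (hΩ.isOpen.measurableSet.inter measurableSet_ball) (hκ p (ht p hp)) (hcone p (ht p hp))
      (fun n => hw (φ n)) (fun n => hM (φ n)) (fun n => hM' (φ n)) hconv
  rw [Finset.sum_const_zero] at hsum
  refine squeeze_zero (fun q => integral_nonneg fun x => sq_nonneg _) (fun q => ?_) hsum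
  have hi : IntegrableOn (fun x => (w (φ q.1) x - w (φ q.2) x) ^ 2) Ω :=
    integrableOn_of_continuous hΩ (((hw _).continuous.sub (hw _).continuous).pow 2)
  have h1 : ∀ p ∈ t, ∫ x in Ω ∩ Metric.ball p (r p), (w (φ q.1) x - w (φ q.2) x) ^ 2 =
      ∫ x in Ω, (Metric.ball p (r p)).indicator (fun x => (w (φ q.1) x - w (φ q.2) x) ^ 2) x :=
    fun p _ => (setIntegral_indicator measurableSet_ball).symm
  rw [Finset.sum_congr rfl h1, ← integral_finsetSum _ fun p _ => hi.indicator measurableSet_ball]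
  refine setIntegral_mono_on hi (integrable_finsetSum _ fun p _ => hi.indicator measurableSet_ball)
    hΩ.isOpen.measurableSet fun x hx => ?_
  obtain ⟨p, hp, hxp⟩ := mem_iUnion₂.1 (hcov (subset_closure hx))
  refine le_trans (le_of_eq ?_) (Finset.single_le_sum
      (fun p _ => indicator_nonneg (fun _ _ => sq_nonneg _) x) hp)
  rw [indicator_of_mem hxp]

end

/-! ### Poincaré's inequality -/

section

variable {N : ℕ} {Ω : Set (EuclideanSpace ℝ (Fin N))}

theorem inner_toLp {X : Type*} [MeasurableSpace X] {μ : Measure X} {f g : X → ℝ} (hf : MemLp f 2 μ)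
    (hg : MemLp g 2 μ) : ⟪hf.toLp f, hg.toLp g⟫ = ∫ x, f x * g x ∂μ := by
  rw [L2.inner_def]
  refine integral_congr_ae ?_
  filter_upwards [hf.coeFn_toLp, hg.coeFn_toLp] with x h1 h2
  rw [h1, h2]
  simp [mul_comm]

theorem norm_toLp_sq {X : Type*} [MeasurableSpace X] {μ : Measure X} {f : X → ℝ}
    (hf : MemLp f 2 μ) :
    ‖hf.toLp f‖ ^ 2 = ∫ x, f x ^ 2 ∂μ := by
  rw [← real_inner_self_eq_norm_sq, inner_toLp]
  simp [sq]

/-- `L²` convergence gives convergence of the integrals over sets of finite measure. -/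
theorem tendsto_setIntegral_of_tendsto_toLp {X : Type*} [MeasurableSpace X] {μ : Measure X}
    {u : ℕ → Lp ℝ 2 μ} {v : Lp ℝ 2 μ} (h : Tendsto u atTop (𝓝 v)) {A : Set X}
    (hA : MeasurableSet A) (hμA : μ A ≠ ⊤) :
    Tendsto (fun n => ∫ x in A, u n x ∂μ) atTop (𝓝 (∫ x in A, v x ∂μ)) := by
  have h1 : Tendsto (fun n => ⟪indicatorConstLp 2 hA hμA (1 : ℝ), u n⟫) atTop
      (𝓝 ⟪indicatorConstLp 2 hA hμA (1 : ℝ), v⟫) := tendsto_const_nhds.inner h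
  rw [L2.inner_indicatorConstLp_one hA hμA] at h1
  exact h1.congr fun n => L2.inner_indicatorConstLp_one hA hμA _

/-- An `L²` limit of functions whose Dirichlet norms tend to zero is constant on a connected set:
its integrals over small balls do not change when the centre moves, and Lebesgue's differentiation
theorem recovers the function from these integrals. -/
theorem ae_eq_const_of_tendsto (hΩ : IsBoundedC1Domain Ω)
    {w : ℕ → EuclideanSpace ℝ (Fin N) → ℝ} (hw : ∀ n, ContDiff ℝ 1 (w n))
    {u : Lp ℝ 2 (volume.restrict Ω)}
    (hu : Tendsto (fun n => (memLp_of_continuous hΩ (hw n).continuous).toLp (w n)) atTop (𝓝 u))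
    (hD : Tendsto (fun n => ∫ x in Ω, ‖fderiv ℝ (w n) x‖ ^ 2) atTop (𝓝 0)) :
    ∃ k : ℝ, ∀ᵐ x ∂(volume.restrict Ω), u x = k := by
  have hΩm := hΩ.isOpen.measurableSet
  have hΩfin : volume Ω < ⊤ :=
    (measure_mono subset_closure).trans_lt hΩ.isCompact_closure.measure_lt_top
  have hA : ∀ A : Set (EuclideanSpace ℝ (Fin N)), MeasurableSet A → A ⊆ Ω →
      Tendsto (fun n => ∫ x in A, w n x) atTop (𝓝 (∫ x in A, u x)) := by
    intro A hAm hAΩ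
    have hfin : volume.restrict Ω A ≠ ⊤ :=
      ((Measure.restrict_apply_le _ _).trans_lt ((measure_mono hAΩ).trans_lt hΩfin)).ne
    have h1 := tendsto_setIntegral_of_tendsto_toLp hu hAm hfin
    rw [Measure.restrict_restrict hAm, inter_eq_self_of_subset_left hAΩ] at h1
    refine h1.congr fun n => setIntegral_congr_ae hAm ?_
    have := (ae_restrict_iff' hΩm).1 (memLp_of_continuous hΩ (hw n).continuous).coeFn_toLp
    filter_upwards [this] with x hx hxA using hx (hAΩ hxA)
  -- integrals over balls do not change under translation inside `Ω`, since the difference for `w n`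
  -- is bounded by the Dirichlet norm
  have hB : ∀ (x y : EuclideanSpace ℝ (Fin N)) (ρ : ℝ), 0 ≤ ρ →
      (∀ z ∈ Metric.closedBall x ρ, ∀ t ∈ Icc (0 : ℝ) 1, z + t • y ∈ Ω) →
      ∫ z in Metric.closedBall (x + y) ρ, u z = ∫ z in Metric.closedBall x ρ, u z := by
    intro x y ρ hρ h
    have hB1 : Metric.closedBall x ρ ⊆ Ω := fun z hz => by simpa using h z hz 0 (by simp)
    have hB2 : Metric.closedBall (x + y) ρ ⊆ Ω := fun z hz => by
      have hz' : z - y ∈ Metric.closedBall x ρ := by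
        rw [Metric.mem_closedBall, dist_eq_norm] at hz ⊢
        rwa [sub_sub, add_comm y x]
      simpa using h (z - y) hz' 1 (by simp)
    have hfin : IsFiniteMeasure (volume.restrict (Metric.closedBall x ρ)) :=
      ⟨by simpa using (isCompact_closedBall x ρ).measure_lt_top⟩
    have h1 := (((hA _ measurableSet_closedBall hB2).sub (hA _ measurableSet_closedBall hB1)).pow 2)
    have h2 : Tendsto (fun n => ((∫ z in Metric.closedBall (x + y) ρ, w n z) -
        ∫ z in Metric.closedBall x ρ, w n z) ^ 2) atTop (𝓝 0) := by
      have h3 := hD.const_mul (volume.real (Metric.closedBall x ρ) * ‖y‖ ^ 2)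
      rw [mul_zero] at h3
      refine squeeze_zero (fun n => sq_nonneg _) (fun n => ?_) h3
      have hi : ∀ {f : EuclideanSpace ℝ (Fin N) → ℝ}, Continuous f →
          Integrable f (volume.restrict (Metric.closedBall x ρ)) :=
        fun hf => hf.continuousOn.integrableOn_compact (isCompact_closedBall x ρ)
      have hc : Continuous fun z => w n (z + y) := (hw n).continuous.comp (by fun_prop)
      have e1 : ∫ z in Metric.closedBall (x + y) ρ, w n z =
          ∫ z in Metric.closedBall x ρ, w n (z + y) := by
        rw [add_comm x y, ← integral_translate_closedBall]
        simp_rw [add_comm y]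
      rw [e1, ← integral_sub (hi hc) (hi (hw n).continuous), mul_assoc]
      refine (sq_integral_le (hi (hc.sub (hw n).continuous))
        (hi ((hc.sub (hw n).continuous).pow 2))).trans ?_
      rw [show (volume.restrict (Metric.closedBall x ρ)).real univ =
        volume.real (Metric.closedBall x ρ) by simp]
      gcongr
      exact integral_translate_sub_sq_le hΩ.isBounded h (hw n)
    have h3 := tendsto_nhds_unique h1 h2
    exact sub_eq_zero.1 (pow_eq_zero_iff two_ne_zero |>.1 h3)
  -- by connectedness, the integrals over small balls around any two points agree
  have hconn : ∀ x ∈ Ω, ∀ x' ∈ Ω, ∀ᶠ ρ : ℝ in 𝓝[>] 0,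
      ∫ z in Metric.closedBall x ρ, u z = ∫ z in Metric.closedBall x' ρ, u z := by
    intro x hx x' hx'
    refine hΩ.isConnected.isPreconnected.induction₂ (fun x x' => ∀ᶠ ρ : ℝ in 𝓝[>] 0,
      ∫ z in Metric.closedBall x ρ, u z = ∫ z in Metric.closedBall x' ρ, u z) (fun p hp => ?_)
      (fun a b c _ _ _ h1 h2 => by filter_upwards [h1, h2] with ρ e1 e2 using e1.trans e2)
      (fun a b _ _ h1 => by filter_upwards [h1] with ρ e1 using e1.symm) hx hx'
    obtain ⟨r, hr, hball⟩ := Metric.isOpen_iff.1 hΩ.isOpen p hp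
    filter_upwards [mem_nhdsWithin_of_mem_nhds (Metric.ball_mem_nhds p (half_pos hr))] with q hq
    filter_upwards [Ioo_mem_nhdsGT (half_pos hr)] with ρ hρ
    rw [← hB p (q - p) ρ hρ.1.le fun z hz t ht => hball ?_, add_sub_cancel]
    rw [Metric.mem_ball, dist_eq_norm] at hq ⊢
    rw [Metric.mem_closedBall, dist_eq_norm] at hz
    calc ‖z + t • (q - p) - p‖ = ‖(z - p) + t • (q - p)‖ := by congr 1; abel
      _ ≤ ‖z - p‖ + ‖t • (q - p)‖ := norm_add_le _ _
      _ ≤ ‖z - p‖ + 1 * ‖q - p‖ := by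
          rw [norm_smul, Real.norm_eq_abs, abs_of_nonneg ht.1]
          gcongr
          exact ht.2
      _ < r := by linarith [hρ.2]
  have hui : IntegrableOn u Ω := by
    have : IsFiniteMeasure (volume.restrict Ω) := ⟨by simpa using hΩfin⟩
    exact (Lp.memLp u).integrable one_le_two
  have hlim : ∀ᵐ x ∂(volume.restrict Ω), x ∈ Ω ∧ Tendsto (fun ρ : ℝ =>
      (volume.real (Metric.closedBall (0 : EuclideanSpace ℝ (Fin N)) ρ))⁻¹ *
        ∫ z in Metric.closedBall x ρ, u z) (𝓝[>] 0) (𝓝 (u x)) := by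
    have h1 := IsUnifLocDoublingMeasure.ae_tendsto_average volume
      ((integrable_indicator_iff hΩm).2 hui).locallyIntegrable 1
    filter_upwards [ae_restrict_of_ae h1, ae_restrict_mem hΩm] with x hx hxΩ
    refine ⟨hxΩ, ?_⟩
    have h2 := hx (l := 𝓝[>] (0 : ℝ)) (fun _ => x) id tendsto_id (by
      filter_upwards [self_mem_nhdsWithin] with ρ (hρ : 0 < ρ)
      exact Metric.mem_closedBall_self (by simpa using hρ.le))
    rw [indicator_of_mem hxΩ] at h2
    refine h2.congr' ?_
    obtain ⟨r, hr, hball⟩ := Metric.isOpen_iff.1 hΩ.isOpen x hxΩ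
    filter_upwards [Ioo_mem_nhdsGT hr] with ρ hρ
    rw [setAverage_eq, smul_eq_mul, id, Measure.addHaar_real_closedBall_center volume x]
    congr 1
    exact setIntegral_congr_fun measurableSet_closedBall fun z hz =>
      indicator_of_mem (hball (lt_of_le_of_lt hz hρ.2)) _
  have hne : (ae (volume.restrict Ω)).NeBot := by
    rw [ae_neBot, Ne, Measure.restrict_eq_zero]
    exact (hΩ.isOpen.measure_pos volume hΩ.isConnected.nonempty).ne'
  obtain ⟨x₀, hx₀, hx₀lim⟩ := hlim.exists
  refine ⟨u x₀, ?_⟩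
  filter_upwards [hlim] with x hx
  refine tendsto_nhds_unique (hx.2.congr' ?_) hx₀lim
  filter_upwards [hconn x hx.1 x₀ hx₀] with ρ hρ
  rw [hρ]

theorem cauchySeq_toLp {X : Type*} [MeasurableSpace X] {μ : Measure X} {w : ℕ → X → ℝ}
    (hw : ∀ n, MemLp (w n) 2 μ)
    (h : Tendsto (fun q : ℕ × ℕ => ∫ x, (w q.1 x - w q.2 x) ^ 2 ∂μ) atTop (𝓝 0)) :
    CauchySeq fun n => (hw n).toLp (w n) := by
  rw [cauchySeq_iff_tendsto_dist_atTop_0]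
  have h1 := h.sqrt
  rw [Real.sqrt_zero] at h1
  refine h1.congr fun q => ?_
  rw [dist_eq_norm, ← MemLp.toLp_sub, ← Real.sqrt_sq (norm_nonneg _), norm_toLp_sq]
  rfl

/-- Poincaré's inequality, with the mean over the boundary: otherwise Rellich's theorem gives a
limit of norm one which is constant and has vanishing boundary mean. -/
theorem IsBoundedC1Domain.poincare (hN : 1 ≤ N) (hΩ : IsBoundedC1Domain Ω) :
    ∃ C : ℝ, 0 < C ∧ ∀ w : EuclideanSpace ℝ (Fin N) → ℝ, ContDiff ℝ 1 w →
      ∫ x in Ω, w x ^ 2 ≤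
        C * ((∫ x in Ω, ‖fderiv ℝ w x‖ ^ 2) + (∫ x, w x ∂(surfaceMeasure Ω)) ^ 2) := by
  have := hΩ.isFiniteMeasure
  by_contra! hcon
  choose! w₀ hw₀ hlt using hcon
  have hn : ∀ n : ℕ, (0 : ℝ) < n + 1 := fun n => by positivity
  have hpos : ∀ n : ℕ, 0 < ∫ x in Ω, w₀ (n + 1) x ^ 2 := fun n =>
    lt_of_le_of_lt (mul_nonneg (hn n).le (add_nonneg (integral_nonneg fun x => by positivity)
      (sq_nonneg _))) (hlt (n + 1) (hn n))
  set s : ℕ → ℝ := fun n => (√(∫ x in Ω, w₀ (n + 1) x ^ 2))⁻¹ with hs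
  set w : ℕ → EuclideanSpace ℝ (Fin N) → ℝ := fun n x => s n * w₀ (n + 1) x with hwdef
  have hw : ∀ n, ContDiff ℝ 1 (w n) := fun n => contDiff_const.mul (hw₀ _ (hn _))
  have hs2 : ∀ n, s n ^ 2 * ∫ x in Ω, w₀ (n + 1) x ^ 2 = 1 := fun n => by
    rw [hs]
    simp only [inv_pow, Real.sq_sqrt (hpos n).le]
    exact inv_mul_cancel₀ (hpos n).ne'
  have h1 : ∀ n, ∫ x in Ω, w n x ^ 2 = 1 := fun n => by
    simp only [hwdef, mul_pow]
    rw [integral_const_mul, hs2]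
  have hfd : ∀ n x, ‖fderiv ℝ (w n) x‖ ^ 2 = s n ^ 2 * ‖fderiv ℝ
      (w₀ (n + 1)) x‖ ^ 2 := fun n x => by
    have : fderiv ℝ (w n) x = s n • fderiv ℝ (w₀ (n + 1)) x :=
      fderiv_const_mul ((hw₀ _ (hn _)).differentiable one_ne_zero x) _
    rw [this, norm_smul, mul_pow, Real.norm_eq_abs, sq_abs]
  have h2 : ∀ n, (∫ x in Ω, ‖fderiv ℝ (w n) x‖ ^ 2) + (∫ x, w n x ∂(surfaceMeasure Ω)) ^ 2 ≤
      ((n : ℝ) + 1)⁻¹ := fun n => by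
    simp_rw [hfd]
    simp only [hwdef]
    rw [integral_const_mul, integral_const_mul, mul_pow, ← mul_add]
    have h3 := mul_le_mul_of_nonneg_left (hlt (n + 1) (hn n)).le (sq_nonneg (s n))
    rw [hs2] at h3
    rw [← one_div, le_div_iff₀ (by positivity)]
    linarith
  have h0a : ∀ n, 0 ≤ ∫ x in Ω, ‖fderiv ℝ (w n) x‖ ^ 2 := fun n =>
    integral_nonneg fun x => by positivity
  have hinv : Tendsto (fun n : ℕ => ((n : ℝ) + 1)⁻¹) atTop (𝓝 0) := by
    simpa using tendsto_one_div_add_atTop_nhds_zero_nat (𝕜 := ℝ)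
  have hD : Tendsto (fun n => ∫ x in Ω, ‖fderiv ℝ (w n) x‖ ^ 2) atTop (𝓝 0) :=
    squeeze_zero h0a (fun n => by linarith [h2 n, sq_nonneg (∫ x, w n x ∂(surfaceMeasure Ω))]) hinv
  have hmean : Tendsto (fun n => (∫ x, w n x ∂(surfaceMeasure Ω)) ^ 2) atTop (𝓝 0) :=
    squeeze_zero (fun n => sq_nonneg _) (fun n => by linarith [h2 n, h0a n]) hinv
  obtain ⟨φ, hφ, hcau⟩ := hΩ.rellich hw (M := 1) (fun n => (h1 n).le) (fun n => by
    refine le_trans (by linarith [h2 n, sq_nonneg (∫ x, w n x ∂(surfaceMeasure Ω))])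
      (inv_le_one_of_one_le₀ (by linarith [n.cast_nonneg (α := ℝ)] : (1:ℝ) ≤ n + 1)))
  have hL : ∀ n, MemLp (w (φ n)) 2 (volume.restrict Ω) := fun n =>
    memLp_of_continuous hΩ (hw _).continuous
  obtain ⟨u, hu⟩ := cauchySeq_tendsto_of_complete (cauchySeq_toLp hL hcau)
  obtain ⟨k, hk⟩ := ae_eq_const_of_tendsto hΩ (fun n => hw (φ n)) hu (hD.comp hφ.tendsto_atTop)
  have hkL : MemLp (fun _ => k) 2 (volume.restrict Ω) := memLp_of_continuous hΩ continuous_const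
  have huk : u = hkL.toLp := by
    ext1
    filter_upwards [hk, hkL.coeFn_toLp] with x h3 h4 using h3.trans h4.symm
  have hdiff : Tendsto (fun n => ∫ x in Ω, (w (φ n) x - k) ^ 2) atTop (𝓝 0) := by
    have h3 := ((tendsto_iff_norm_sub_tendsto_zero.1 hu).pow 2)
    rw [zero_pow two_ne_zero] at h3
    refine h3.congr fun n => ?_
    rw [huk, ← MemLp.toLp_sub, norm_toLp_sq]
    rfl
  obtain ⟨C, hC, htr⟩ := hΩ.trace_inequality
  -- by the trace inequality the boundary means converge to that of the constant `k`
  have hk0 : k = 0 := by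
    have hk1 : Tendsto (fun n => ∫ x, (w (φ n) x - k) ^ 2 ∂(surfaceMeasure Ω)) atTop (𝓝 0) := by
      have h3 := ((hdiff.const_mul (1 + (1:ℝ)⁻¹)).const_mul C).add
        (((hD.comp hφ.tendsto_atTop).const_mul 1).const_mul C)
      simp only [mul_zero, add_zero] at h3
      refine squeeze_zero (fun n => integral_nonneg fun x => sq_nonneg _) (fun n => ?_) h3
      have h4 := htr (fun x => w (φ n) x - k) ((hw (φ n)).sub contDiff_const) 1 one_pos
      simpa only [fderiv_sub_const, Function.comp] using h4
    have hσ : ∀ {f : EuclideanSpace ℝ (Fin N) → ℝ}, Continuous f →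
        Integrable f (surfaceMeasure Ω) := fun hf => integrable_surfaceMeasure_of_continuous hΩ hf
    have hk2 : Tendsto (fun n => (∫ x, (w (φ n) x - k) ∂(surfaceMeasure Ω)) ^ 2) atTop (𝓝 0) := by
      have h3 := hk1.const_mul ((surfaceMeasure Ω).real univ)
      rw [mul_zero] at h3
      refine squeeze_zero (fun n => sq_nonneg _) (fun n => ?_) h3
      exact sq_integral_le (hσ ((hw (φ n)).continuous.sub continuous_const))
        (hσ (((hw (φ n)).continuous.sub continuous_const).pow 2))
    have hk3 : Tendsto (fun _ : ℕ => ((surfaceMeasure Ω).real univ * k) ^ 2) atTop (𝓝 0) := by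
      have h3 := ((hmean.comp hφ.tendsto_atTop).const_mul 2).add (hk2.const_mul 2)
      simp only [mul_zero, add_zero] at h3
      refine squeeze_zero (fun n => sq_nonneg _) (fun n => ?_) h3
      rw [integral_sub (hσ (hw (φ n)).continuous) (integrable_const _), integral_const, smul_eq_mul]
      simp only [Function.comp]
      nlinarith [sq_nonneg (2 * (∫ x, w (φ n) x ∂(surfaceMeasure Ω)) -
        (surfaceMeasure Ω).real univ * k)]
    have h4 := tendsto_nhds_unique tendsto_const_nhds hk3
    have h5 : (surfaceMeasure Ω).real univ ≠ 0 := by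
      rw [Measure.real, ENNReal.toReal_ne_zero]
      exact ⟨Measure.measure_univ_ne_zero.2 (surfaceMeasure_ne_zero hN hΩ), measure_ne_top _ _⟩
    simpa [h5] using h4
  rw [hk0] at hdiff
  simp only [sub_zero, h1] at hdiff
  exact one_ne_zero (tendsto_nhds_unique tendsto_const_nhds hdiff)

end

/-! ### Minimisers of Rayleigh quotients, and compactness of traces -/

section

variable {N : ℕ} {Ω : Set (EuclideanSpace ℝ (Fin N))}

/-- Two continuous symmetric forms on a Banach space, one coercive and one compact on a closed
subspace: the Rayleigh quotient attains its minimum, and minimisers solve the eigenvalue equation.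
A minimising sequence which is Cauchy for `b` is Cauchy for `Q` by the parallelogram identity. -/
theorem exists_rayleigh_minimizer {X : Type*} [NormedAddCommGroup X] [NormedSpace ℝ X]
    [CompleteSpace X] (Q b : X →L[ℝ] X →L[ℝ] ℝ) (hQs : ∀ x y, Q x y = Q y x)
    (hbs : ∀ x y, b x y = b y x) (hQ : ∀ x, 0 ≤ Q x x) (hb : ∀ x, 0 ≤ b x x) (W : Submodule ℝ X)
    (hW : IsClosed (W : Set X)) {C : ℝ} (hcoer : ∀ x ∈ W, ‖x‖ ^ 2 ≤ C * Q x x)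
    (hcomp : ∀ x : ℕ → X, (∀ n, x n ∈ W) → (∃ M, ∀ n, ‖x n‖ ≤ M) → ∃ φ : ℕ → ℕ, StrictMono φ ∧
      Tendsto (fun q : ℕ × ℕ => b (x (φ q.1) - x (φ q.2)) (x (φ q.1) - x (φ q.2))) atTop (𝓝 0))
    (hne : ∃ x ∈ W, b x x ≠ 0) :
    ∃ lam : ℝ, 0 < lam ∧ (∀ v ∈ W, lam * b v v ≤ Q v v) ∧
      ∃ u ∈ W, b u u = 1 ∧ ∀ v ∈ W, Q u v = lam * b u v := by
  set S : Set ℝ := {a | ∃ x ∈ W, b x x = 1 ∧ a = Q x x} with hS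
  have hscale : ∀ v ∈ W, b v v ≠ 0 → (b v v)⁻¹ * Q v v ∈ S := fun v hv hbv => by
    have hpos : 0 < b v v := lt_of_le_of_ne (hb v) (Ne.symm hbv)
    have hsq : √(b v v) * √(b v v) = b v v := Real.mul_self_sqrt hpos.le
    refine ⟨(√(b v v))⁻¹ • v, W.smul_mem _ hv, ?_, ?_⟩ <;>
      simp only [map_smul, _root_.smul_apply, smul_eq_mul, ← mul_assoc, ← mul_inv, hsq]
    exact inv_mul_cancel₀ hbv
  have hSne : S.Nonempty := by
    obtain ⟨x, hx, hbx⟩ := hne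
    exact ⟨_, hscale x hx hbx⟩
  have hSb : BddBelow S := ⟨0, by rintro _ ⟨x, -, -, rfl⟩; exact hQ x⟩
  set lam := sInf S with hlam
  have hlow : ∀ v ∈ W, lam * b v v ≤ Q v v := fun v hv => by
    by_cases hbv : b v v = 0
    · rw [hbv, mul_zero]; exact hQ v
    · have hpos : 0 < b v v := lt_of_le_of_ne (hb v) (Ne.symm hbv)
      have := csInf_le hSb (hscale v hv hbv)
      rwa [inv_mul_eq_div, le_div_iff₀ hpos] at this
  have hlam0 : 0 ≤ lam := le_csInf hSne (by rintro _ ⟨x, -, -, rfl⟩; exact hQ x)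
  obtain ⟨a, -, ha, haS⟩ := exists_seq_tendsto_sInf hSne hSb
  choose x hxW hbx hax using haS
  have hC0 : 0 ≤ C := by
    by_contra! hC
    obtain ⟨y, hy, hby⟩ := hne
    have h1 := hcoer y hy
    have h3 : ‖y‖ ^ 2 ≤ 0 := h1.trans (mul_nonpos_of_nonpos_of_nonneg hC.le (hQ y))
    have h4 : y = 0 := by simpa using le_antisymm h3 (sq_nonneg _)
    simp [h4] at hby
  have hbdd : ∃ M, ∀ n, ‖x n‖ ≤ M := by
    obtain ⟨M, hM⟩ := (ha.bddAbove_range)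
    refine ⟨√(C * M), fun n => Real.le_sqrt_of_sq_le ((hcoer _ (hxW n)).trans ?_)⟩
    rw [← hax]
    exact mul_le_mul_of_nonneg_left (hM ⟨n, rfl⟩) hC0
  obtain ⟨φ, hφ, hcau⟩ := hcomp x hxW hbdd
  have haφ : Tendsto (fun n => a (φ n)) atTop (𝓝 lam) := ha.comp hφ.tendsto_atTop
  have hub : Tendsto (fun q : ℕ × ℕ => C * (2 * a (φ q.1) + 2 * a (φ q.2) - 4 * lam + lam *
      b (x (φ q.1) - x (φ q.2)) (x (φ q.1) - x (φ q.2)))) atTop (𝓝 0) := by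
    have h1 : Tendsto (fun q : ℕ × ℕ => a (φ q.1)) atTop (𝓝 lam) := by
      rw [← prod_atTop_atTop_eq]; exact haφ.comp tendsto_fst
    have h2 : Tendsto (fun q : ℕ × ℕ => a (φ q.2)) atTop (𝓝 lam) := by
      rw [← prod_atTop_atTop_eq]; exact haφ.comp tendsto_snd
    have h3 := (((h1.const_mul 2).add (h2.const_mul 2)).sub_const (4 * lam)).add
      (hcau.const_mul lam)
    convert h3.const_mul C using 2
    ring
  -- the parallelogram identity for `Q`, with `Q (x + y) ≥ lam b (x + y)` and the parallelogram
  -- identity for `b`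
  have hpar : ∀ q : ℕ × ℕ, ‖x (φ q.1) - x (φ q.2)‖ ^ 2 ≤
      C * (2 * a (φ q.1) + 2 * a (φ q.2) - 4 * lam + lam *
      b (x (φ q.1) - x (φ q.2)) (x (φ q.1) - x (φ q.2))) := fun q => by
    refine (hcoer _ (W.sub_mem (hxW _) (hxW _))).trans (mul_le_mul_of_nonneg_left ?_ hC0)
    have h1 := hlow _ (W.add_mem (hxW (φ q.1)) (hxW (φ q.2)))
    have h2 := hbx (φ q.1)
    have h3 := hbx (φ q.2)
    rw [hax, hax]
    simp only [map_add, map_sub, _root_.add_apply, _root_.sub_apply, h2,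
      h3, hQs (x (φ q.2)) (x (φ q.1)), hbs (x (φ q.2)) (x (φ q.1))] at h1 ⊢
    nlinarith
  have hcs : CauchySeq fun n => x (φ n) := by
    rw [cauchySeq_iff_tendsto_dist_atTop_0]
    have h1 := (squeeze_zero (fun q => sq_nonneg _) hpar hub).sqrt
    rw [Real.sqrt_zero] at h1
    refine h1.congr fun q => ?_
    rw [Real.sqrt_sq (norm_nonneg _), dist_eq_norm]
  obtain ⟨u, hu⟩ := cauchySeq_tendsto_of_complete hcs
  have hdiag : ∀ B : X →L[ℝ] X →L[ℝ] ℝ, Tendsto (fun n => B (x (φ n)) (x (φ n))) atTop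
      (𝓝 (B u u)) :=
    fun B => by
      have hc : Continuous fun z => B z z := B.continuous.clm_apply continuous_id
      exact (hc.tendsto u).comp hu
  have huW : u ∈ W := hW.mem_of_tendsto hu (Eventually.of_forall fun n => hxW _)
  have hbu : b u u = 1 := by
    refine tendsto_nhds_unique (hdiag b) ?_
    simp only [hbx]
    exact tendsto_const_nhds
  have hQu : Q u u = lam := by
    refine tendsto_nhds_unique (hdiag Q) ?_
    simp only [← hax]
    exact haφ
  refine ⟨lam, lt_of_le_of_ne hlam0 fun h0 => ?_, hlow, u, huW, hbu, fun v hv => ?_⟩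
  · have h1 := hcoer u huW
    rw [hQu, ← h0, mul_zero] at h1
    have h2 : u = 0 := by simpa using le_antisymm h1 (sq_nonneg _)
    simp [h2] at hbu
  · by_contra hne'
    set β := Q u v - lam * b u v with hβ
    set α := Q v v - lam * b v v with hα
    have hβ0 : β ≠ 0 := sub_ne_zero.2 hne'
    have hα0 : 0 ≤ α := sub_nonneg.2 (hlow v hv)
    -- the nonnegative form `Q - lam b` vanishes at `u`; it is evaluated at `u - β / (α + 1) v`
    have h1 := hlow _ (W.add_mem huW (W.smul_mem (-(β / (α + 1))) hv))
    simp only [map_add, map_smul, _root_.add_apply, _root_.smul_apply,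
      smul_eq_mul, hQs v u, hbs v u, hQu, hbu] at h1
    set s := β / (α + 1) with hs
    have h2 : s * (α + 1) = β := by rw [hs]; field_simp
    have h3 : 0 ≤ -2 * s * β + s ^ 2 * α := by rw [hβ, hα]; linarith
    have h4 : s ≠ 0 := fun h => hβ0 (by rw [← h2, h, zero_mul])
    have h5 : 0 < s ^ 2 := by positivity
    rw [← h2] at h3
    nlinarith

theorem norm_fderiv_sq (w : EuclideanSpace ℝ (Fin N) → ℝ) (x : EuclideanSpace ℝ (Fin N)) :
    ‖fderiv ℝ w x‖ ^ 2 = ∑ i, partialDeriv i w x ^ 2 := by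
  set v := (InnerProductSpace.toDual ℝ (EuclideanSpace ℝ (Fin N))).symm (fderiv ℝ w x) with hv
  have h1 : ‖fderiv ℝ w x‖ = ‖v‖ := by rw [hv, LinearIsometryEquiv.norm_map]
  have h2 : ∀ i, partialDeriv i w x = v i := fun i => by
    rw [partialDeriv, ← InnerProductSpace.toDual_symm_apply, ← hv]
    simp [EuclideanSpace.inner_single_right]
  simp_rw [h1, h2]
  exact (sum_coord_sq v).symm

theorem continuous_partialDeriv {w : EuclideanSpace ℝ (Fin N) → ℝ} (hw : ContDiff ℝ 1 w)
    (i : Fin N) : Continuous (partialDeriv i w) :=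
  (hw.continuous_fderiv one_ne_zero).clm_apply continuous_const

/-- Compactness of the trace `H¹(Ω) → L²(∂Ω)`, for `C^1` functions. -/
theorem IsBoundedC1Domain.rellich_trace (hΩ : IsBoundedC1Domain Ω)
    {w : ℕ → EuclideanSpace ℝ (Fin N) → ℝ} (hw : ∀ n, ContDiff ℝ 1 (w n)) {M : ℝ}
    (hM : ∀ n, ∫ x in Ω, w n x ^ 2 ≤ M) (hM' : ∀ n, ∫ x in Ω, ‖fderiv ℝ (w n) x‖ ^ 2 ≤ M) :
    ∃ φ : ℕ → ℕ, StrictMono φ ∧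
      Tendsto (fun q : ℕ × ℕ => ∫ x, (w (φ q.1) x - w (φ q.2) x) ^ 2 ∂(surfaceMeasure Ω))
        atTop (𝓝 0) := by
  obtain ⟨φ, hφ, h⟩ := hΩ.rellich hw hM hM'
  refine ⟨φ, hφ, ?_⟩
  obtain ⟨C, hC, htr⟩ := hΩ.trace_inequality
  have hM0 : 0 ≤ M := (integral_nonneg fun x => sq_nonneg (w 0 x)).trans (hM 0)
  rw [Metric.tendsto_nhds]
  intro ε hε
  set δ := ε / (2 * (C * (4 * M + 1))) with hδ
  have hδ0 : 0 < δ := by positivity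
  have hlim := (h.const_mul (1 + δ⁻¹)).const_mul C
  simp only [mul_zero] at hlim
  filter_upwards [hlim.eventually (gt_mem_nhds (half_pos hε))] with q hq
  rw [Real.dist_eq, sub_zero, abs_of_nonneg (integral_nonneg fun x => sq_nonneg _)]
  have h1 := htr (fun y => w (φ q.1) y - w (φ q.2) y) ((hw _).sub (hw _)) δ hδ0
  have h2 : C * (δ * ∫ x in Ω, ‖fderiv ℝ (fun y => w (φ q.1) y - w (φ q.2) y) x‖ ^ 2) ≤
      C * (δ * (4 * M + 1)) := by
    have := integral_norm_fderiv_sub_sq_le hΩ (hw (φ q.1)) (hw (φ q.2)) (hM' _) (hM' _)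
    gcongr
    exact this.trans (by linarith)
  have h3 : C * (δ * (4 * M + 1)) = ε / 2 := by rw [hδ]; field_simp
  linarith

end

/-! ### Functions with their gradients and traces as triples of `L²` functions -/

section

variable {N : ℕ} {Ω : Set (EuclideanSpace ℝ (Fin N))}

/-- Subtracting the mean leaves mean zero, and lowers the integral of the square by the square of
the mean. -/
theorem integral_sub_mean_sq {X : Type*} [MeasurableSpace X] {μ : Measure X} [IsFiniteMeasure μ]
    (hμ : μ ≠ 0) {f : X → ℝ} (hf : Integrable f μ) (hf2 : Integrable (fun x => f x ^ 2) μ) :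
    ∫ x, (f x - (μ.real univ)⁻¹ * ∫ x, f x ∂μ) ∂μ = 0 ∧
      ∫ x, (f x - (μ.real univ)⁻¹ * ∫ x, f x ∂μ) ^ 2 ∂μ =
        ∫ x, f x ^ 2 ∂μ - (μ.real univ)⁻¹ * (∫ x, f x ∂μ) ^ 2 := by
  have hm : μ.real univ ≠ 0 := by
    rw [Measure.real, ENNReal.toReal_ne_zero]
    exact ⟨Measure.measure_univ_ne_zero.2 hμ, measure_ne_top _ _⟩
  set I := ∫ x, f x ∂μ with hI
  set m := (μ.real univ)⁻¹ * I with hmdef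
  constructor
  · rw [integral_sub hf (integrable_const _), integral_const, smul_eq_mul, hmdef, ← mul_assoc,
      mul_inv_cancel₀ hm, one_mul, sub_self]
  · have e : ∀ x, (f x - m) ^ 2 = f x ^ 2 - (2 * m * f x - m ^ 2) := fun x => by ring
    have hg : Integrable (fun x => 2 * m * f x - m ^ 2) μ :=
      (hf.const_mul _).sub (integrable_const _)
    simp_rw [e]
    rw [integral_sub hf2 hg, integral_sub (hf.const_mul _) (integrable_const _),
      integral_const_mul, integral_const, smul_eq_mul, ← hI, hmdef]
    field_simp
    ring

/-- The space `L²(Ω)`. -/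
noncomputable abbrev L2Dom (Ω : Set (EuclideanSpace ℝ (Fin N))) := Lp ℝ 2 (volume.restrict Ω)

/-- The space `L²(∂Ω)`. -/
noncomputable abbrev L2Bdry (Ω : Set (EuclideanSpace ℝ (Fin N))) := Lp ℝ 2 (surfaceMeasure Ω)

/-- Triples of a function, its gradient and its boundary values. -/
noncomputable abbrev H1Ambient (Ω : Set (EuclideanSpace ℝ (Fin N))) :=
  L2Dom Ω × (Fin N → L2Dom Ω) × L2Bdry Ω

/-- Quadruples of a function, its gradient, its Hessian and its boundary values. -/
noncomputable abbrev H2Ambient (Ω : Set (EuclideanSpace ℝ (Fin N))) :=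
  L2Dom Ω × (Fin N → L2Dom Ω) × (Fin N → Fin N → L2Dom Ω) × L2Bdry Ω

/-- The triples that come from smooth functions on `ℝ^N`. -/
def smoothTriples (Ω : Set (EuclideanSpace ℝ (Fin N))) : Submodule ℝ (H1Ambient Ω) where
  carrier := {y | ∃ w : EuclideanSpace ℝ (Fin N) → ℝ, ContDiff ℝ ∞ w ∧
    y.1 =ᵐ[volume.restrict Ω] w ∧ (∀ i, y.2.1 i =ᵐ[volume.restrict Ω] partialDeriv i w) ∧
    y.2.2 =ᵐ[surfaceMeasure Ω] w}
  zero_mem' := ⟨0, contDiff_const, Lp.coeFn_zero _ _ _, fun i => by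
      filter_upwards [Lp.coeFn_zero ℝ 2 (volume.restrict Ω)] with x hx
      exact hx.trans (by simp [partialDeriv]), Lp.coeFn_zero _ _ _⟩
  add_mem' := by
    rintro y z ⟨w, hw, h1, h2, h3⟩ ⟨w', hw', h1', h2', h3'⟩
    refine ⟨w + w', hw.add hw', ?_, fun i => ?_, ?_⟩
    · exact (Lp.coeFn_add _ _).trans (h1.add h1')
    · refine (Lp.coeFn_add _ _).trans ?_
      filter_upwards [h2 i, h2' i] with x hx hx'
      rw [Pi.add_apply, hx, hx', partialDeriv, partialDeriv, partialDeriv,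
        fderiv_add (hw.differentiable (by simp) x) (hw'.differentiable (by simp) x)]
      rfl
    · exact (Lp.coeFn_add _ _).trans (h3.add h3')
  smul_mem' := by
    rintro c y ⟨w, hw, h1, h2, h3⟩
    refine ⟨c • w, hw.const_smul c, ?_, fun i => ?_, ?_⟩
    · exact (Lp.coeFn_smul _ _).trans (h1.const_smul c)
    · refine (Lp.coeFn_smul _ _).trans ?_
      filter_upwards [h2 i] with x hx
      rw [Pi.smul_apply, hx, partialDeriv, partialDeriv,
        fderiv_const_smul (hw.differentiable (by simp) x)]
      rfl
    · exact (Lp.coeFn_smul _ _).trans (h3.const_smul c)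

/-- The triple of a `C^1` function: the function, its gradient, and its restriction to the boundary.
-/
noncomputable def smoothTriple (hΩ : IsBoundedC1Domain Ω) {w : EuclideanSpace ℝ (Fin N) → ℝ}
    (hw : ContDiff ℝ 1 w) : H1Ambient Ω :=
  ((memLp_of_continuous hΩ hw.continuous).toLp w,
    fun i => (memLp_of_continuous hΩ (continuous_partialDeriv hw i)).toLp (partialDeriv i w),
    (memLp_surfaceMeasure_of_continuous hΩ hw.continuous).toLp w)

theorem exists_eq_smoothTriple (hΩ : IsBoundedC1Domain Ω) {y : H1Ambient Ω}
    (hy : y ∈ smoothTriples Ω) :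
    ∃ (w : EuclideanSpace ℝ (Fin N) → ℝ) (hw : ContDiff ℝ 1 w), y = smoothTriple hΩ hw := by
  obtain ⟨w, hw, h1, h2, h3⟩ := hy
  refine ⟨w, ?_⟩
  have hw1 : ContDiff ℝ 1 w := hw.of_le (by exact_mod_cast le_top)
  refine ⟨hw1, Prod.ext ?_ (Prod.ext (funext fun i => ?_) ?_)⟩
  · exact Lp.ext (h1.trans (memLp_of_continuous hΩ hw1.continuous).coeFn_toLp.symm)
  · exact Lp.ext ((h2 i).trans
      (memLp_of_continuous hΩ (continuous_partialDeriv hw1 i)).coeFn_toLp.symm)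
  · exact Lp.ext (h3.trans (memLp_surfaceMeasure_of_continuous hΩ hw1.continuous).coeFn_toLp.symm)

theorem smoothTriple_mem (hΩ : IsBoundedC1Domain Ω) {w : EuclideanSpace ℝ (Fin N) → ℝ}
    (hw : ContDiff ℝ ∞ w) (hw1 : ContDiff ℝ 1 w) : smoothTriple hΩ hw1 ∈ smoothTriples Ω :=
  ⟨w, hw, (memLp_of_continuous hΩ hw1.continuous).coeFn_toLp,
    fun i => (memLp_of_continuous hΩ (continuous_partialDeriv hw1 i)).coeFn_toLp,
    (memLp_surfaceMeasure_of_continuous hΩ hw1.continuous).coeFn_toLp⟩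

theorem norm_smoothTriple_grad (hΩ : IsBoundedC1Domain Ω) {w : EuclideanSpace ℝ (Fin N) → ℝ}
    (hw : ContDiff ℝ 1 w) :
    ∑ i, ‖(smoothTriple hΩ hw).2.1 i‖ ^ 2 = ∫ x in Ω, ‖fderiv ℝ w x‖ ^ 2 := by
  simp_rw [norm_fderiv_sq]
  have hi : ∀ i, IntegrableOn (fun x => partialDeriv i w x ^ 2) Ω := fun i =>
    integrableOn_of_continuous hΩ ((continuous_partialDeriv hw i).pow 2)
  rw [integral_finsetSum _ fun i _ => hi i]
  exact Finset.sum_congr rfl fun i _ =>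
    norm_toLp_sq (memLp_of_continuous hΩ (continuous_partialDeriv hw i))

/-- Integration over `∂Ω`. -/
noncomputable def bdryIntegral (Ω : Set (EuclideanSpace ℝ (Fin N)))
    [IsFiniteMeasure (surfaceMeasure Ω)] : L2Bdry Ω →L[ℝ] ℝ :=
  innerSL ℝ ((memLp_const (1 : ℝ)).toLp)

theorem bdryIntegral_toLp [IsFiniteMeasure (surfaceMeasure Ω)] {g : EuclideanSpace ℝ (Fin N) → ℝ}
    (hg : MemLp g 2 (surfaceMeasure Ω)) :
    bdryIntegral Ω (hg.toLp g) = ∫ x, g x ∂(surfaceMeasure Ω) := by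
  rw [bdryIntegral, innerSL_apply_apply, inner_toLp]
  simp

/-- For boundary mean zero, the gradient controls the function and its trace. This combines
Poincaré's inequality and the trace inequality, which pass to the closure of the smooth triples
because both sides are continuous there. -/
theorem trace_inequality_of_mem_closure (hN : 1 ≤ N) (hΩ : IsBoundedC1Domain Ω)
    [IsFiniteMeasure (surfaceMeasure Ω)] :
    ∃ C : ℝ, 0 < C ∧ ∀ y ∈ (smoothTriples Ω).topologicalClosure, bdryIntegral Ω y.2.2 = 0 →
      ‖y.1‖ ^ 2 ≤ C * ∑ i, ‖y.2.1 i‖ ^ 2 ∧ ‖y.2.2‖ ^ 2 ≤ C * ∑ i, ‖y.2.1 i‖ ^ 2 := by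
  obtain ⟨C, hC, hP⟩ := hΩ.poincare hN
  obtain ⟨C', hC', hT⟩ := hΩ.trace_inequality
  have hcl := closure_minimal
    (s := (smoothTriples Ω : Set (H1Ambient Ω)))
    (t := {y | ‖y.1‖ ^ 2 ≤ C * (∑ i, ‖y.2.1 i‖ ^ 2 + (bdryIntegral Ω y.2.2) ^ 2)} ∩
      {y | ‖y.2.2‖ ^ 2 ≤ C' * ((1 + 1⁻¹) * ‖y.1‖ ^ 2) + C' * (1 * ∑ i, ‖y.2.1 i‖ ^ 2)})
    (fun y hy => by
      obtain ⟨w, hw, rfl⟩ := exists_eq_smoothTriple hΩ hy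
      have h1 := hP w hw
      have h2 := hT w hw 1 one_pos
      rw [← norm_smoothTriple_grad hΩ hw, ← norm_toLp_sq (memLp_of_continuous hΩ hw.continuous)]
        at h1 h2
      rw [← norm_toLp_sq (memLp_surfaceMeasure_of_continuous hΩ hw.continuous)] at h2
      rw [← bdryIntegral_toLp (memLp_surfaceMeasure_of_continuous hΩ hw.continuous)] at h1
      exact ⟨h1, h2⟩)
    ((isClosed_le (by fun_prop) (by fun_prop)).inter (isClosed_le (by fun_prop) (by fun_prop)))
  refine ⟨C + (C' * (2 * C) + C'), by positivity, fun y hy hy0 => ?_⟩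
  obtain ⟨h1, h2⟩ := hcl hy
  simp only [mem_ofPred_eq, hy0] at h1 h2
  have hS : 0 ≤ ∑ i, ‖y.2.1 i‖ ^ 2 := Finset.sum_nonneg fun i _ => by positivity
  set S := ∑ i, ‖y.2.1 i‖ ^ 2
  norm_num at h1 h2
  have h3 : C' * (2 * ‖y.1‖ ^ 2) ≤ C' * (2 * (C * S)) := by gcongr
  have h4 : 0 ≤ C' * (2 * C) * S := by positivity
  have h5 : 0 ≤ C' * S := by positivity
  have h6 : 0 ≤ C * S := by positivity
  constructor <;> nlinarith

/-- The sharp Steklov inequality on a ball for Sobolev functions. The inequality with the mean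
subtracted holds for all smooth triples and is a closed condition. -/
theorem steklov_ball_of_mem_closure (hN : 1 ≤ N) {c : EuclideanSpace ℝ (Fin N)} {R : ℝ} (hR : 0 < R)
    [IsFiniteMeasure (surfaceMeasure (Metric.ball c R))] {y : H1Ambient (Metric.ball c R)}
    (hy : y ∈ (smoothTriples (Metric.ball c R)).topologicalClosure)
    (hy0 : bdryIntegral (Metric.ball c R) y.2.2 = 0) :
    ‖y.2.2‖ ^ 2 ≤ R * ∑ i, ‖y.2.1 i‖ ^ 2 := by
  have hB := isBoundedC1Domain_ball c hR
  set σ := surfaceMeasure (Metric.ball c R) with hσ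
  have hcl := closure_minimal
    (s := (smoothTriples (Metric.ball c R) : Set (H1Ambient (Metric.ball c R))))
    (t := {y | ‖y.2.2‖ ^ 2 - (σ.real univ)⁻¹ * (bdryIntegral (Metric.ball c R) y.2.2) ^ 2 ≤
      R * ∑ i, ‖y.2.1 i‖ ^ 2})
    (fun y hy => by
      obtain ⟨w, hw, rfl⟩ := exists_eq_smoothTriple hB hy
      have hi : ∀ {f : EuclideanSpace ℝ (Fin N) → ℝ}, Continuous f → Integrable f σ :=
        fun hf => integrable_surfaceMeasure_of_continuous hB hf
      rw [mem_ofPred_eq, norm_smoothTriple_grad hB hw]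
      change ‖(memLp_surfaceMeasure_of_continuous hB hw.continuous).toLp w‖ ^ 2 -
        (σ.real univ)⁻¹ * (bdryIntegral (Metric.ball c R)
          ((memLp_surfaceMeasure_of_continuous hB hw.continuous).toLp w)) ^ 2 ≤ _
      rw [norm_toLp_sq, bdryIntegral_toLp]
      obtain ⟨h0, h2⟩ := integral_sub_mean_sq (surfaceMeasure_ne_zero hN hB) (hi hw.continuous)
        (hi (hw.continuous.pow 2))
      have h1 := steklov_ball hN hR (c := c) (hw.sub contDiff_const) h0
      simp only [fderiv_sub_const] at h1
      exact h2.symm.le.trans h1)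
    (isClosed_le (by fun_prop) (by fun_prop))
  simpa [hy0] using hcl hy

/-- Compactness of the trace on the closure of the smooth triples. -/
theorem exists_subseq_cauchySeq_trace (hΩ : IsBoundedC1Domain Ω) {y : ℕ → H1Ambient Ω}
    (hy : ∀ n, y n ∈ (smoothTriples Ω).topologicalClosure) {M : ℝ} (hM : ∀ n, ‖y n‖ ≤ M) :
    ∃ φ : ℕ → ℕ, StrictMono φ ∧ CauchySeq fun n => (y (φ n)).2.2 := by
  have h1 : ∀ n : ℕ, ∃ (w : EuclideanSpace ℝ (Fin N) → ℝ) (hw : ContDiff ℝ 1 w),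
      dist (y n) (smoothTriple hΩ hw) < 1 / ((n : ℝ) + 1) := fun n => by
    obtain ⟨z, hz, hd⟩ := Metric.mem_closure_iff.1 (hy n) (1 / ((n : ℝ) + 1)) (by positivity)
    obtain ⟨w, hw, rfl⟩ := exists_eq_smoothTriple hΩ hz
    exact ⟨w, hw, hd⟩
  choose w hw hd using h1
  have hle1 : ∀ n : ℕ, 1 / ((n : ℝ) + 1) ≤ 1 := fun n =>
    (div_le_one (by positivity)).2 (by linarith [n.cast_nonneg (α := ℝ)])
  have hnorm : ∀ n, ‖smoothTriple hΩ (hw n)‖ ≤ M + 1 := fun n => by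
    have h2 := norm_sub_norm_le (smoothTriple hΩ (hw n)) (y n)
    rw [norm_sub_rev, ← dist_eq_norm] at h2
    linarith [hd n, hle1 n, hM n]
  have hM1 : 0 ≤ M + 1 := (norm_nonneg _).trans (hnorm 0)
  have hb1 : ∀ n, ∫ x in Ω, w n x ^ 2 ≤ (N + 1) * (M + 1) ^ 2 := fun n => by
    rw [← norm_toLp_sq (memLp_of_continuous hΩ (hw n).continuous)]
    have h2 : ‖(smoothTriple hΩ (hw n)).1‖ ≤ M + 1 := (norm_fst_le _).trans (hnorm n)
    calc ‖(smoothTriple hΩ (hw n)).1‖ ^ 2 ≤ (M + 1) ^ 2 := by gcongr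
      _ ≤ (N + 1) * (M + 1) ^ 2 := by nlinarith [sq_nonneg (M + 1), N.cast_nonneg (α := ℝ)]
  have hb2 : ∀ n, ∫ x in Ω, ‖fderiv ℝ (w n) x‖ ^ 2 ≤ (N + 1) * (M + 1) ^ 2 := fun n => by
    rw [← norm_smoothTriple_grad hΩ (hw n)]
    have h2 : ∀ i, ‖(smoothTriple hΩ (hw n)).2.1 i‖ ^ 2 ≤ (M + 1) ^ 2 := fun i => by
      have := (norm_le_pi_norm _ i).trans ((norm_fst_le _).trans
        ((norm_snd_le _).trans (hnorm n)))
      gcongr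
    refine (Finset.sum_le_sum fun i _ => h2 i).trans ?_
    rw [Finset.sum_const, Finset.card_univ, Fintype.card_fin, nsmul_eq_mul]
    nlinarith [sq_nonneg (M + 1)]
  obtain ⟨φ, hφ, hcau⟩ := hΩ.rellich_trace hw hb1 hb2
  refine ⟨φ, hφ, ?_⟩
  have h3 := cauchySeq_toLp (fun n => memLp_surfaceMeasure_of_continuous hΩ (hw (φ n)).continuous)
    hcau
  obtain ⟨g, hg⟩ := cauchySeq_tendsto_of_complete h3
  have h4 : Tendsto (fun n => (y (φ n)).2.2) atTop (𝓝 g) := by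
    rw [← tendsto_iff_of_dist]
    · exact hg
    · refine squeeze_zero (fun n => dist_nonneg) (fun n => ?_)
        (tendsto_one_div_add_atTop_nhds_zero_nat (𝕜 := ℝ) |>.comp hφ.tendsto_atTop)
      refine le_trans ?_ (hd (φ n)).le
      rw [dist_comm, dist_eq_norm, dist_eq_norm]
      exact (norm_snd_le (y (φ n) - smoothTriple hΩ (hw (φ n))).2).trans (norm_snd_le _)
  exact h4.cauchySeq

end

/-! ### The space `H²` as a closed subspace of a product of `L²` spaces -/

section

variable {N : ℕ} {Ω : Set (EuclideanSpace ℝ (Fin N))}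

theorem integral_coeFn_mul {X : Type*} [MeasurableSpace X] {μ : Measure X} (u : Lp ℝ 2 μ)
    {f : X → ℝ} (hf : MemLp f 2 μ) : ∫ x, u x * f x ∂μ = ⟪u, hf.toLp f⟫ := by
  rw [L2.inner_def]
  refine integral_congr_ae ?_
  filter_upwards [hf.coeFn_toLp] with x hx
  rw [hx]
  simp [mul_comm]

/-- Being a weak partial derivative is a family of closed linear conditions in `L²`. -/
theorem isWeakPartial_iff (hΩ : IsBoundedC1Domain Ω) {i : Fin N} {u v : L2Dom Ω} :
    IsWeakPartial Ω i u v ↔ ∀ (φ : EuclideanSpace ℝ (Fin N) → ℝ) (hφ : ContDiff ℝ 1 φ),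
      ContDiff ℝ ∞ φ → HasCompactSupport φ → tsupport φ ⊆ Ω →
      ⟪u, (memLp_of_continuous hΩ (continuous_partialDeriv hφ i)).toLp (partialDeriv i φ)⟫ =
        -⟪v, (memLp_of_continuous hΩ hφ.continuous).toLp φ⟫ := by
  refine ⟨fun h φ hφ h1 h2 h3 => ?_, fun h φ h1 h2 h3 => ?_⟩
  · rw [← integral_coeFn_mul, ← integral_coeFn_mul]
    exact h φ h1 h2 h3
  · have hφ : ContDiff ℝ 1 φ := h1.of_le (by exact_mod_cast le_top)
    rw [integral_coeFn_mul _ (memLp_of_continuous hΩ (continuous_partialDeriv hφ i)),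
      integral_coeFn_mul _ (memLp_of_continuous hΩ hφ.continuous)]
    exact h φ hφ h1 h2 h3

/-- The pairs of a function and its weak partial derivative. -/
def weakPartials (hΩ : IsBoundedC1Domain Ω) (i : Fin N) : Submodule ℝ (L2Dom Ω × L2Dom Ω) where
  carrier := {y | IsWeakPartial Ω i y.1 y.2}
  zero_mem' := (isWeakPartial_iff hΩ).2 fun φ hφ _ _ _ => by simp
  add_mem' := by
    intro y z hy hz
    have hy := (isWeakPartial_iff hΩ).1 hy
    have hz := (isWeakPartial_iff hΩ).1 hz
    refine (isWeakPartial_iff hΩ).2 fun φ hφ h1 h2 h3 => ?_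
    rw [Prod.fst_add, Prod.snd_add, inner_add_left, inner_add_left, hy φ hφ h1 h2 h3,
      hz φ hφ h1 h2 h3]
    ring
  smul_mem' := by
    intro c y hy
    have hy := (isWeakPartial_iff hΩ).1 hy
    refine (isWeakPartial_iff hΩ).2 fun φ hφ h1 h2 h3 => ?_
    rw [Prod.smul_fst, Prod.smul_snd, inner_smul_left, inner_smul_left, hy φ hφ h1 h2 h3]
    ring

theorem isClosed_weakPartials (hΩ : IsBoundedC1Domain Ω) (i : Fin N) :
    IsClosed (weakPartials hΩ i : Set (L2Dom Ω × L2Dom Ω)) := by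
  have : (weakPartials hΩ i : Set (L2Dom Ω × L2Dom Ω)) =
      {y | ∀ (φ : EuclideanSpace ℝ (Fin N) → ℝ) (hφ : ContDiff ℝ 1 φ),
      ContDiff ℝ ∞ φ → HasCompactSupport φ → tsupport φ ⊆ Ω →
      ⟪y.1, (memLp_of_continuous hΩ (continuous_partialDeriv hφ i)).toLp (partialDeriv i φ)⟫ =
        -⟪y.2, (memLp_of_continuous hΩ hφ.continuous).toLp φ⟫} :=
    Set.ext fun y => isWeakPartial_iff hΩ
  rw [this]
  simp only [ofPred_forall]
  refine isClosed_iInter fun φ => isClosed_iInter fun hφ => isClosed_iInter fun _ =>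
    isClosed_iInter fun _ => isClosed_iInter fun _ => isClosed_eq ?_ ?_ <;> fun_prop

theorem IsWeakPartial.congr_ae {i : Fin N} {u v u' v' : EuclideanSpace ℝ (Fin N) → ℝ}
    (h : IsWeakPartial Ω i u v) (hu : u =ᵐ[volume.restrict Ω] u')
    (hv : v =ᵐ[volume.restrict Ω] v') : IsWeakPartial Ω i u' v' := by
  intro φ h1 h2 h3
  have e1 : ∫ x in Ω, u' x * partialDeriv i φ x = ∫ x in Ω, u x * partialDeriv i φ x :=
    integral_congr_ae (by filter_upwards [hu] with x hx; rw [hx])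
  have e2 : ∫ x in Ω, v' x * φ x = ∫ x in Ω, v x * φ x :=
    integral_congr_ae (by filter_upwards [hv] with x hx; rw [hx])
  rw [e1, e2]
  exact h φ h1 h2 h3

/-- The space `H²(Ω)`, as a space of quadruples of a function, its gradient, its Hessian and its
trace. That the last component is the trace is expressed by the first, second and fourth components
being an `L²` limit of triples of smooth functions. -/
def h2Graph (hΩ : IsBoundedC1Domain Ω) : Submodule ℝ (H2Ambient Ω) where
  carrier := {x | (∀ i, (x.1, x.2.1 i) ∈ weakPartials hΩ i) ∧
    (∀ i j, (x.2.1 i, x.2.2.1 i j) ∈ weakPartials hΩ j) ∧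
    (x.1, x.2.1, x.2.2.2) ∈ (smoothTriples Ω).topologicalClosure}
  zero_mem' := ⟨fun i => (weakPartials hΩ i).zero_mem, fun _ j => (weakPartials hΩ j).zero_mem,
    ((smoothTriples Ω).topologicalClosure).zero_mem⟩
  add_mem' := fun hx hy => ⟨fun i => (weakPartials hΩ i).add_mem (hx.1 i) (hy.1 i),
    fun i j => (weakPartials hΩ j).add_mem (hx.2.1 i j) (hy.2.1 i j),
    ((smoothTriples Ω).topologicalClosure).add_mem hx.2.2 hy.2.2⟩
  smul_mem' := fun c _ hx => ⟨fun i => (weakPartials hΩ i).smul_mem c (hx.1 i),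
    fun i j => (weakPartials hΩ j).smul_mem c (hx.2.1 i j),
    ((smoothTriples Ω).topologicalClosure).smul_mem c hx.2.2⟩

theorem isClosed_h2Graph (hΩ : IsBoundedC1Domain Ω) :
    IsClosed (h2Graph hΩ : Set (H2Ambient Ω)) := by
  have : (h2Graph hΩ : Set (H2Ambient Ω)) =
      (⋂ i, (fun x : H2Ambient Ω => (x.1, x.2.1 i)) ⁻¹' (weakPartials hΩ i)) ∩
      ((⋂ i, ⋂ j, (fun x : H2Ambient Ω => (x.2.1 i, x.2.2.1 i j)) ⁻¹' (weakPartials hΩ j)) ∩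
      (fun x : H2Ambient Ω => (x.1, x.2.1, x.2.2.2)) ⁻¹' (smoothTriples Ω).topologicalClosure) := by
    ext x
    simp only [mem_inter_iff, mem_iInter, mem_preimage, SetLike.mem_coe]
    rfl
  rw [this]
  refine (isClosed_iInter fun i => (isClosed_weakPartials hΩ i).preimage (by fun_prop)).inter
    ((isClosed_iInter fun i => isClosed_iInter fun j =>
      (isClosed_weakPartials hΩ j).preimage (by fun_prop)).inter
      ((smoothTriples Ω).isClosed_topologicalClosure.preimage (by fun_prop)))

/-- The quadruple of an element of `H²(Ω)` with trace `g`. -/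
noncomputable def H2.quadruple (u : H2 Ω) {g : EuclideanSpace ℝ (Fin N) → ℝ}
    (hg : MemLp g 2 (surfaceMeasure Ω)) : H2Ambient Ω :=
  (u.memLp_toFun.toLp, fun i => (u.memLp_grad i).toLp, fun i j => (u.memLp_hess i j).toLp, hg.toLp)

/-- A function in `H²(Ω)` and its trace form an element of `h2Graph`. -/
theorem quadruple_mem (hΩ : IsBoundedC1Domain Ω) {u : H2 Ω} {g : EuclideanSpace ℝ (Fin N) → ℝ}
    (h : IsTrace u g) : u.quadruple h.1 ∈ h2Graph hΩ := by
  obtain ⟨hg, w, hw, h1, h2, h3⟩ := id h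
  refine ⟨fun i => ?_, fun i j => ?_, ?_⟩
  · exact (u.isWeakPartial_grad i).congr_ae u.memLp_toFun.coeFn_toLp.symm
      (u.memLp_grad i).coeFn_toLp.symm
  · exact (u.isWeakPartial_hess i j).congr_ae (u.memLp_grad i).coeFn_toLp.symm
      (u.memLp_hess i j).coeFn_toLp.symm
  · have hw1 : ∀ n, ContDiff ℝ 1 (w n) := fun n => (hw n).of_le (by exact_mod_cast le_top)
    refine mem_closure_iff_seq_limit.2 ⟨fun n => smoothTriple hΩ (hw1 n),
      fun n => smoothTriple_mem hΩ (hw n) (hw1 n), ?_⟩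
    refine Tendsto.prodMk_nhds ?_ (Tendsto.prodMk_nhds (tendsto_pi_nhds.2 fun i => ?_) ?_)
    · exact (Lp.tendsto_Lp_iff_tendsto_eLpNorm'' _ (fun n => memLp_of_continuous hΩ
        (hw1 n).continuous) _ u.memLp_toFun).2 h1
    · exact (Lp.tendsto_Lp_iff_tendsto_eLpNorm'' _ (fun n => memLp_of_continuous hΩ
        (continuous_partialDeriv (hw1 n) i)) _ (u.memLp_grad i)).2 (h2 i)
    · exact (Lp.tendsto_Lp_iff_tendsto_eLpNorm'' _ (fun n => memLp_surfaceMeasure_of_continuous hΩ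
        (hw1 n).continuous) _ hg).2 h3

/-- Every element of `h2Graph` comes from a function in `H²(Ω)` and a trace of it. -/
theorem exists_isTrace_quadruple (hΩ : IsBoundedC1Domain Ω) {x : H2Ambient Ω}
    (hx : x ∈ h2Graph hΩ) :
    ∃ (u : H2 Ω) (g : EuclideanSpace ℝ (Fin N) → ℝ) (h : IsTrace u g), u.quadruple h.1 = x := by
  obtain ⟨h1, h2, h3⟩ := hx
  let u : H2 Ω :=
    { toFun := x.1
      grad := fun i => x.2.1 i
      hess := fun i j => x.2.2.1 i j
      memLp_toFun := Lp.memLp _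
      memLp_grad := fun i => Lp.memLp _
      memLp_hess := fun i j => Lp.memLp _
      isWeakPartial_grad := h1
      isWeakPartial_hess := h2 }
  obtain ⟨y, hy, hlim⟩ := mem_closure_iff_seq_limit.1 h3
  choose w hw e1 e2 e3 using hy
  have hlim1 := (Prod.tendsto_iff _ _).1 hlim
  have hlim2 := (Prod.tendsto_iff _ _).1 hlim1.2
  have hu : IsTrace u x.2.2.2 := by
    refine ⟨Lp.memLp _, w, hw, ?_, fun i => ?_, ?_⟩
    · refine ((Lp.tendsto_Lp_iff_tendsto_eLpNorm' _ _).1 hlim1.1).congr fun n => ?_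
      exact eLpNorm_congr_ae ((e1 n).sub (ae_eq_refl _))
    · refine ((Lp.tendsto_Lp_iff_tendsto_eLpNorm' _ _).1
        ((tendsto_pi_nhds.1 hlim2.1) i)).congr fun n => ?_
      exact eLpNorm_congr_ae ((e2 n i).sub (ae_eq_refl _))
    · refine ((Lp.tendsto_Lp_iff_tendsto_eLpNorm' _ _).1 hlim2.2).congr fun n => ?_
      exact eLpNorm_congr_ae ((e3 n).sub (ae_eq_refl _))
  refine ⟨u, x.2.2.2, hu, ?_⟩
  refine Prod.ext ?_ (Prod.ext (funext fun i => ?_)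
      (Prod.ext (funext fun i => funext fun j => ?_) ?_))
  · exact Lp.toLp_coeFn x.1 (Lp.memLp _)
  · exact Lp.toLp_coeFn (x.2.1 i) (Lp.memLp _)
  · exact Lp.toLp_coeFn (x.2.2.1 i j) (Lp.memLp _)
  · exact Lp.toLp_coeFn x.2.2.2 (Lp.memLp _)

/-- The bilinear form of the biharmonic Steklov problem. -/
noncomputable def energyForm (Ω : Set (EuclideanSpace ℝ (Fin N))) (τ : ℝ) :
    H2Ambient Ω →L[ℝ] H2Ambient Ω →L[ℝ] ℝ :=
  let snd := ContinuousLinearMap.snd ℝ (L2Dom Ω)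
    ((Fin N → L2Dom Ω) × (Fin N → Fin N → L2Dom Ω) × L2Bdry Ω)
  let grad : Fin N → H2Ambient Ω →L[ℝ] L2Dom Ω := fun i =>
    (ContinuousLinearMap.proj i ∘L ContinuousLinearMap.fst ℝ (Fin N → L2Dom Ω)
      ((Fin N → Fin N → L2Dom Ω) × L2Bdry Ω)) ∘L snd
  let hess : Fin N → Fin N → H2Ambient Ω →L[ℝ] L2Dom Ω := fun i j =>
    (ContinuousLinearMap.proj (R := ℝ) (φ := fun _ : Fin N => L2Dom Ω) j ∘L
      ContinuousLinearMap.proj (R := ℝ) (φ := fun _ : Fin N => Fin N → L2Dom Ω) i ∘L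
      ContinuousLinearMap.fst ℝ (Fin N → Fin N → L2Dom Ω) (L2Bdry Ω) ∘L
      ContinuousLinearMap.snd ℝ (Fin N → L2Dom Ω) ((Fin N → Fin N → L2Dom Ω) × L2Bdry Ω)) ∘L snd
  ∑ i, ∑ j, (innerSL ℝ).bilinearComp (hess i j) (hess i j) +
    τ • ∑ i, (innerSL ℝ).bilinearComp (grad i) (grad i)

theorem energyForm_apply (τ : ℝ) (x y : H2Ambient Ω) :
    energyForm Ω τ x y = ∑ i, ∑ j, ⟪x.2.2.1 i j, y.2.2.1 i j⟫ + τ * ∑ i, ⟪x.2.1 i, y.2.1 i⟫ := by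
  simp [energyForm]

/-- The `L²(∂Ω)` inner product of the traces. -/
noncomputable def traceForm (Ω : Set (EuclideanSpace ℝ (Fin N))) :
    H2Ambient Ω →L[ℝ] H2Ambient Ω →L[ℝ] ℝ :=
  let trace : H2Ambient Ω →L[ℝ] L2Bdry Ω :=
    ContinuousLinearMap.snd ℝ (Fin N → Fin N → L2Dom Ω) (L2Bdry Ω) ∘L
      ContinuousLinearMap.snd ℝ (Fin N → L2Dom Ω) ((Fin N → Fin N → L2Dom Ω) × L2Bdry Ω) ∘L
      ContinuousLinearMap.snd ℝ (L2Dom Ω)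
        ((Fin N → L2Dom Ω) × (Fin N → Fin N → L2Dom Ω) × L2Bdry Ω)
  (innerSL ℝ).bilinearComp trace trace

theorem traceForm_apply (x y : H2Ambient Ω) : traceForm Ω x y = ⟪x.2.2.2, y.2.2.2⟫ := by
  simp [traceForm]

theorem energyForm_quadruple (τ : ℝ) (u φ : H2 Ω) {g h : EuclideanSpace ℝ (Fin N) → ℝ}
    (hg : MemLp g 2 (surfaceMeasure Ω)) (hh : MemLp h 2 (surfaceMeasure Ω)) :
    energyForm Ω τ (u.quadruple hg) (φ.quadruple hh) = energy τ u φ := by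
  have hH : ∀ i j, Integrable (fun x => u.hess i j x * φ.hess i j x) (volume.restrict Ω) :=
    fun i j => (u.memLp_hess i j).integrable_mul (φ.memLp_hess i j)
  have hG : ∀ i, Integrable (fun x => u.grad i x * φ.grad i x) (volume.restrict Ω) :=
    fun i => (u.memLp_grad i).integrable_mul (φ.memLp_grad i)
  rw [energyForm_apply, energy, integral_add
    (integrable_finsetSum _ fun i _ => integrable_finsetSum _ fun j _ => hH i j)
    ((integrable_finsetSum _ fun i _ => hG i).const_mul τ), integral_const_mul,
    integral_finsetSum _ fun i _ => integrable_finsetSum _ fun j _ => hH i j,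
    integral_finsetSum _ fun i _ => hG i]
  congr 1
  · refine Finset.sum_congr rfl fun i _ => ?_
    rw [integral_finsetSum _ fun j _ => hH i j]
    exact Finset.sum_congr rfl fun j _ => inner_toLp (u.memLp_hess i j) (φ.memLp_hess i j)
  · congr 1
    exact Finset.sum_congr rfl fun i _ => inner_toLp (u.memLp_grad i) (φ.memLp_grad i)

theorem traceForm_quadruple (u φ : H2 Ω) {g h : EuclideanSpace ℝ (Fin N) → ℝ}
    (hg : MemLp g 2 (surfaceMeasure Ω)) (hh : MemLp h 2 (surfaceMeasure Ω)) :
    traceForm Ω (u.quadruple hg) (φ.quadruple hh) = ∫ x, g x * h x ∂(surfaceMeasure Ω) := by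
  rw [traceForm_apply]
  exact inner_toLp hg hh

end

/-! ### Affine functions, and functions of boundary mean zero -/

section

variable {N : ℕ} {Ω : Set (EuclideanSpace ℝ (Fin N))}

theorem isWeakPartial_of_contDiff (i : Fin N) {w : EuclideanSpace ℝ (Fin N) → ℝ}
    (hw : ContDiff ℝ 1 w) : IsWeakPartial Ω i w (partialDeriv i w) := by
  intro φ hφ hc hsub
  have hφ1 : ContDiff ℝ 1 φ := hφ.of_le (by exact_mod_cast le_top)
  have hz : ∀ x ∉ Ω, φ x = 0 := fun x hx => image_eq_zero_of_notMem_tsupport fun h => hx (hsub h)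
  have hz' : ∀ x ∉ Ω, partialDeriv i φ x = 0 := fun x hx => by
    have : x ∉ tsupport φ := fun h => hx (hsub h)
    rw [partialDeriv, fderiv_of_notMem_tsupport ℝ this]
    simp
  rw [setIntegral_eq_integral_of_forall_compl_eq_zero fun x hx => by rw [hz' x hx, mul_zero],
    setIntegral_eq_integral_of_forall_compl_eq_zero fun x hx => by rw [hz x hx, mul_zero],
    ← sub_eq_zero, sub_neg_eq_add]
  have hc' : HasCompactSupport (partialDeriv i φ) := hc.fderiv_apply ℝ _
  have h1 : Integrable fun x => w x * partialDeriv i φ x :=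
    (hw.continuous.mul (continuous_partialDeriv hφ1 i)).integrable_of_hasCompactSupport
      hc'.mul_left
  have h2 : Integrable fun x => partialDeriv i w x * φ x :=
    ((continuous_partialDeriv hw i).mul hφ1.continuous).integrable_of_hasCompactSupport
      hc.mul_left
  rw [← integral_add h1 h2, ← integral_fderiv_apply_eq_zero volume (hw.mul hφ1) hc.mul_left
      (EuclideanSpace.single i 1)]
  refine integral_congr_ae (ae_of_all _ fun x => ?_)
  have := fderiv_mul_apply_of_contDiff hw hφ1 x (EuclideanSpace.single i 1)
  simp only [partialDeriv]
  rw [this]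
  ring

theorem partialDeriv_affine (v : EuclideanSpace ℝ (Fin N)) (a : ℝ) (i : Fin N) :
    partialDeriv i (fun x => ⟪v, x⟫ + a) = fun _ => v i := by
  funext x
  have h : HasFDerivAt (fun x : EuclideanSpace ℝ (Fin N) => ⟪v, x⟫ + a) (innerSL ℝ v) x :=
    ((innerSL ℝ v).hasFDerivAt).add_const a
  rw [partialDeriv, h.fderiv]
  simp [EuclideanSpace.inner_single_right]

theorem contDiff_affine (v : EuclideanSpace ℝ (Fin N)) (a : ℝ) {n : WithTop ℕ∞} :
    ContDiff ℝ n (fun x : EuclideanSpace ℝ (Fin N) => ⟪v, x⟫ + a) :=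
  ((innerSL ℝ v).contDiff).add contDiff_const

theorem partialDeriv_const (i : Fin N) (a : ℝ) :
    partialDeriv i (fun _ : EuclideanSpace ℝ (Fin N) => a) = fun _ => 0 := by
  funext x
  simp [partialDeriv]

/-- Affine functions as elements of `H²(Ω)`. -/
noncomputable def affineH2 (hΩ : IsBoundedC1Domain Ω) (v : EuclideanSpace ℝ (Fin N)) (a : ℝ) :
    H2 Ω where
  toFun x := ⟪v, x⟫ + a
  grad i _ := v i
  hess _ _ _ := 0
  memLp_toFun := memLp_of_continuous hΩ (contDiff_affine v a (n := 1)).continuous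
  memLp_grad _ := memLp_of_continuous hΩ continuous_const
  memLp_hess _ _ := memLp_of_continuous hΩ continuous_const
  isWeakPartial_grad i := by
    have := isWeakPartial_of_contDiff (Ω := Ω) i (contDiff_affine v a)
    rwa [partialDeriv_affine] at this
  isWeakPartial_hess i j := by
    have := isWeakPartial_of_contDiff (Ω := Ω) j
      (contDiff_const (c := v i) : ContDiff ℝ 1 fun _ : EuclideanSpace ℝ (Fin N) => v i)
    rwa [partialDeriv_const] at this

theorem isTrace_affineH2 (hΩ : IsBoundedC1Domain Ω) (v : EuclideanSpace ℝ (Fin N)) (a : ℝ) :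
    IsTrace (affineH2 hΩ v a) (fun x => ⟪v, x⟫ + a) := by
  refine ⟨memLp_surfaceMeasure_of_continuous hΩ (contDiff_affine v a (n := 1)).continuous,
    fun _ => fun x => ⟪v, x⟫ + a, fun _ => contDiff_affine v a, ?_, fun i => ?_, ?_⟩
  · simp [affineH2]
  · simp [affineH2, partialDeriv_affine]
  · simp

theorem energy_affineH2_right (τ : ℝ) (hΩ : IsBoundedC1Domain Ω) (u : H2 Ω) (a : ℝ) :
    energy τ u (affineH2 hΩ 0 a) = 0 := by
  simp [energy, affineH2]

theorem IsWeakPartial.ae_eq_zero (hΩ : IsOpen Ω) {i : Fin N} {u v : EuclideanSpace ℝ (Fin N) → ℝ}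
    (h : IsWeakPartial Ω i u v) (hv : MemLp v 2 (volume.restrict Ω))
    (hu : ∀ᵐ x ∂(volume.restrict Ω), u x = 0) : ∀ᵐ x ∂(volume.restrict Ω), v x = 0 := by
  rw [ae_restrict_iff' hΩ.measurableSet]
  refine hΩ.ae_eq_zero_of_integral_contDiff_smul_eq_zero ?_ fun φ hφ hc hsub => ?_
  · refine (locallyIntegrableOn_iff hΩ.isLocallyClosed).2 fun K hK hKc => ?_
    have hfin : IsFiniteMeasure (volume.restrict K) := ⟨by simpa using hKc.measure_lt_top⟩
    exact (hv.mono_measure (Measure.restrict_mono hK le_rfl)).integrable one_le_two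
  · have h1 := h φ hφ hc hsub
    have h2 : ∫ x in Ω, u x * partialDeriv i φ x = 0 := by
      rw [integral_congr_ae (g := fun _ => 0) (by filter_upwards [hu] with x hx; simp [hx])]
      simp
    rw [h2, eq_comm, neg_eq_zero, setIntegral_eq_integral_of_forall_compl_eq_zero] at h1
    · rw [← h1]
      exact integral_congr_ae (ae_of_all _ fun x => by simp [mul_comm])
    · intro x hx
      rw [image_eq_zero_of_notMem_tsupport fun h => hx (hsub h), mul_zero]

theorem energyForm_self (τ : ℝ) (x : H2Ambient Ω) : energyForm Ω τ x x =
    ∑ i, ∑ j, ‖x.2.2.1 i j‖ ^ 2 + τ * ∑ i, ‖x.2.1 i‖ ^ 2 := by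
  simp [energyForm_apply]

theorem traceForm_self (x : H2Ambient Ω) : traceForm Ω x x = ‖x.2.2.2‖ ^ 2 := by
  simp [traceForm_apply]

/-- The elements of `H²(Ω)` with vanishing mean over `∂Ω`. -/
noncomputable def meanZero (hΩ : IsBoundedC1Domain Ω) [IsFiniteMeasure (surfaceMeasure Ω)] :
    Submodule ℝ (H2Ambient Ω) where
  carrier := {x | x ∈ h2Graph hΩ ∧ bdryIntegral Ω x.2.2.2 = 0}
  zero_mem' := ⟨(h2Graph hΩ).zero_mem, map_zero _⟩
  add_mem' := fun hx hy => ⟨(h2Graph hΩ).add_mem hx.1 hy.1, by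
    rw [Prod.snd_add, Prod.snd_add, Prod.snd_add, map_add, hx.2, hy.2, add_zero]⟩
  smul_mem' := fun c _ hx => ⟨(h2Graph hΩ).smul_mem c hx.1, by
    rw [Prod.smul_snd, Prod.smul_snd, Prod.smul_snd, map_smul, hx.2, smul_zero]⟩

theorem isClosed_meanZero (hΩ : IsBoundedC1Domain Ω) [IsFiniteMeasure (surfaceMeasure Ω)] :
    IsClosed (meanZero hΩ : Set (H2Ambient Ω)) :=
  (isClosed_h2Graph hΩ).inter (isClosed_eq (by fun_prop) continuous_const :
    IsClosed {x : H2Ambient Ω | bdryIntegral Ω x.2.2.2 = 0})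

/-- On the mean-zero subspace the energy controls the full norm: the Hessian and the gradient are
part of it, and the gradient controls the function and the trace. -/
theorem energyForm_coercive (hN : 1 ≤ N) {τ : ℝ} (hτ : 0 < τ) (hΩ : IsBoundedC1Domain Ω)
    [IsFiniteMeasure (surfaceMeasure Ω)] :
    ∃ C : ℝ, ∀ x ∈ meanZero hΩ, ‖x‖ ^ 2 ≤ C * energyForm Ω τ x x := by
  obtain ⟨C, hC, h⟩ := trace_inequality_of_mem_closure hN hΩ
  refine ⟨(C + 1) / τ + 1, fun x hx => ?_⟩
  obtain ⟨h1, h2⟩ := h _ hx.1.2.2 hx.2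
  rw [energyForm_self]
  have hS0 : ∀ i ∈ Finset.univ, 0 ≤ ‖x.2.1 i‖ ^ 2 := fun i _ => by positivity
  have hH0 : ∀ i ∈ Finset.univ, 0 ≤ ∑ j, ‖x.2.2.1 i j‖ ^ 2 := fun i _ =>
    Finset.sum_nonneg fun j _ => by positivity
  have hS : ∀ i, ‖x.2.1 i‖ ^ 2 ≤ ∑ i, ‖x.2.1 i‖ ^ 2 := fun i =>
    Finset.single_le_sum hS0 (Finset.mem_univ i)
  have hH : ∀ i j, ‖x.2.2.1 i j‖ ^ 2 ≤ ∑ i, ∑ j, ‖x.2.2.1 i j‖ ^ 2 := fun i j =>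
    (Finset.single_le_sum (f := fun j => ‖x.2.2.1 i j‖ ^ 2) (fun j _ => by positivity)
      (Finset.mem_univ j)).trans (Finset.single_le_sum hH0 (Finset.mem_univ i))
  have hS0 := Finset.sum_nonneg hS0
  have hH0 := Finset.sum_nonneg hH0
  simp only at h1 h2
  generalize ∑ i, ‖x.2.1 i‖ ^ 2 = S at *
  generalize ∑ i, ∑ j, ‖x.2.2.1 i j‖ ^ 2 = H at *
  have hK : C * S + S + H ≤ ((C + 1) / τ + 1) * (H + τ * S) := by
    have e : ((C + 1) / τ + 1) * (H + τ * S) = C * S + S + H + ((C + 1) / τ * H + τ * S) := by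
      field_simp
      ring
    rw [e]
    exact le_add_of_nonneg_right (by positivity)
  have hCS : 0 ≤ C * S := by positivity
  generalize ((C + 1) / τ + 1) * (H + τ * S) = K at *
  have hK0 : 0 ≤ K := by linarith
  have hle : ‖x‖ ≤ √K := by
    refine norm_prod_le_iff.2 ⟨Real.le_sqrt_of_sq_le (by linarith), norm_prod_le_iff.2
      ⟨(pi_norm_le_iff_of_nonneg (Real.sqrt_nonneg _)).2 fun i =>
        Real.le_sqrt_of_sq_le ((hS i).trans (by linarith)), norm_prod_le_iff.2
      ⟨(pi_norm_le_iff_of_nonneg (Real.sqrt_nonneg _)).2 fun i =>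
        (pi_norm_le_iff_of_nonneg (Real.sqrt_nonneg _)).2 fun j =>
        Real.le_sqrt_of_sq_le ((hH i j).trans (by linarith)),
        Real.le_sqrt_of_sq_le (by linarith)⟩⟩⟩
  calc ‖x‖ ^ 2 ≤ √K ^ 2 := by gcongr
    _ = K := Real.sq_sqrt hK0

/-- The boundary form is compact on the mean-zero subspace. -/
theorem traceForm_compact (hΩ : IsBoundedC1Domain Ω) [IsFiniteMeasure (surfaceMeasure Ω)]
    (x : ℕ → H2Ambient Ω) (hx : ∀ n, x n ∈ meanZero hΩ) (hb : ∃ M, ∀ n, ‖x n‖ ≤ M) :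
    ∃ φ : ℕ → ℕ, StrictMono φ ∧ Tendsto (fun q : ℕ × ℕ =>
      traceForm Ω (x (φ q.1) - x (φ q.2)) (x (φ q.1) - x (φ q.2))) atTop (𝓝 0) := by
  obtain ⟨M, hM⟩ := hb
  obtain ⟨φ, hφ, hc⟩ := exists_subseq_cauchySeq_trace hΩ
    (y := fun n => ((x n).1, (x n).2.1, (x n).2.2.2)) (fun n => (hx n).1.2.2) (M := M) (fun n =>
      norm_prod_le_iff.2 ⟨(norm_fst_le (x n)).trans (hM n), norm_prod_le_iff.2
        ⟨((norm_fst_le (x n).2).trans (norm_snd_le (x n))).trans (hM n),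
          (((norm_snd_le (x n).2.2).trans (norm_snd_le (x n).2)).trans
            (norm_snd_le (x n))).trans (hM n)⟩⟩)
  refine ⟨φ, hφ, ?_⟩
  have h1 := (cauchySeq_iff_tendsto_dist_atTop_0.1 hc).pow 2
  rw [zero_pow two_ne_zero] at h1
  refine h1.congr fun q => ?_
  rw [traceForm_self, dist_eq_norm]
  rfl

end

/-! ### The first positive eigenvalue and its bounds -/

section

variable {N : ℕ} {Ω : Set (EuclideanSpace ℝ (Fin N))} {τ : ℝ}

theorem bdryIntegral_quadruple [IsFiniteMeasure (surfaceMeasure Ω)] (u : H2 Ω)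
    {g : EuclideanSpace ℝ (Fin N) → ℝ} (hg : MemLp g 2 (surfaceMeasure Ω)) :
    bdryIntegral Ω (u.quadruple hg).2.2.2 = ∫ x, g x ∂(surfaceMeasure Ω) :=
  bdryIntegral_toLp hg

theorem clm_apply_sub_smul {X : Type*} [NormedAddCommGroup X] [NormedSpace ℝ X]
    (B : X →L[ℝ] X →L[ℝ] ℝ) (u x y : X) (m : ℝ) : B u (x - m • y) = B u x - m * B u y := by
  rw [map_sub, map_smul, smul_eq_mul]

theorem bdryIntegral_sub_smul [IsFiniteMeasure (surfaceMeasure Ω)] (x y : H2Ambient Ω) (m : ℝ) :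
    bdryIntegral Ω (x - m • y).2.2.2 =
      bdryIntegral Ω x.2.2.2 - m * bdryIntegral Ω y.2.2.2 := by
  rw [show (x - m • y).2.2.2 = x.2.2.2 - m • y.2.2.2 from rfl, map_sub, map_smul, smul_eq_mul]

theorem quadruple_mem_meanZero (hΩ : IsBoundedC1Domain Ω) [IsFiniteMeasure (surfaceMeasure Ω)]
    {u : H2 Ω} {g : EuclideanSpace ℝ (Fin N) → ℝ} (h : IsTrace u g)
    (h0 : ∫ x, g x ∂(surfaceMeasure Ω) = 0) : u.quadruple h.1 ∈ meanZero hΩ :=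
  ⟨quadruple_mem hΩ h, by rw [bdryIntegral_quadruple, h0]⟩

/-- An eigenfunction for a positive eigenvalue has vanishing boundary mean, as one sees by testing
with constants, and its trace does not vanish. -/
theorem exists_quadruple_of_mem_positiveEigenvalues (hN : 1 ≤ N) (hτ : 0 < τ)
    (hΩ : IsBoundedC1Domain Ω) [IsFiniteMeasure (surfaceMeasure Ω)] {lam : ℝ}
    (h : lam ∈ positiveEigenvalues τ Ω) :
    ∃ x ∈ meanZero hΩ, energyForm Ω τ x x = lam * traceForm Ω x x ∧ 0 < traceForm Ω x x := by
  obtain ⟨hlam, u, g, hug, hu0, heq⟩ := h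
  have h1 := heq _ _ (isTrace_affineH2 hΩ 0 1)
  rw [energy_affineH2_right] at h1
  have h2 : ∫ x, g x ∂(surfaceMeasure Ω) = 0 := by
    simpa [hlam.ne'] using h1.symm
  have hx := quadruple_mem_meanZero hΩ hug h2
  have hQ : energyForm Ω τ (u.quadruple hug.1) (u.quadruple hug.1) =
      lam * traceForm Ω (u.quadruple hug.1) (u.quadruple hug.1) := by
    rw [energyForm_quadruple, traceForm_quadruple]
    exact heq u g hug
  refine ⟨u.quadruple hug.1, hx, hQ, lt_of_le_of_ne (by rw [traceForm_self]; positivity) fun h0 =>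
      ?_⟩
  obtain ⟨C, hC⟩ := energyForm_coercive hN hτ hΩ
  have h3 := hC _ hx
  rw [hQ, ← h0, mul_zero, mul_zero] at h3
  have h4 : u.quadruple hug.1 = 0 := by simpa using le_antisymm h3 (sq_nonneg _)
  have h5 : u.memLp_toFun.toLp = 0 := congrArg Prod.fst h4
  apply hu0
  have h6 := u.memLp_toFun.coeFn_toLp
  rw [h5] at h6
  filter_upwards [h6, Lp.coeFn_zero ℝ 2 (volume.restrict Ω)] with x e1 e2
  rw [← e1, e2]
  rfl

/-- Coordinates relative to the barycentre of `∂Ω` have vanishing boundary mean. -/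
theorem exists_boundary_barycentre (hN : 1 ≤ N) (hΩ : IsBoundedC1Domain Ω) :
    ∃ m : EuclideanSpace ℝ (Fin N), ∀ v : EuclideanSpace ℝ (Fin N),
      ∫ x, (⟪v, x⟫ + -⟪v, m⟫) ∂(surfaceMeasure Ω) = 0 := by
  have := hΩ.isFiniteMeasure
  have hm : (surfaceMeasure Ω).real univ ≠ 0 := by
    rw [Measure.real, ENNReal.toReal_ne_zero]
    exact ⟨Measure.measure_univ_ne_zero.2 (surfaceMeasure_ne_zero hN hΩ), measure_ne_top _ _⟩
  have hid : Integrable (fun x : EuclideanSpace ℝ (Fin N) => x) (surfaceMeasure Ω) := by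
    obtain ⟨C, hC⟩ := hΩ.isCompact_frontier.exists_bound_of_continuousOn
      (f := fun x : EuclideanSpace ℝ (Fin N) => x) continuousOn_id
    refine Integrable.of_bound continuous_id.aestronglyMeasurable C ?_
    filter_upwards [ae_mem_frontier Ω] with x hx using hC x hx
  refine ⟨((surfaceMeasure Ω).real univ)⁻¹ • ∫ x, x ∂(surfaceMeasure Ω), fun v => ?_⟩
  rw [integral_add (hid.const_inner v) (integrable_const _), integral_inner hid, integral_const,
    inner_smul_right, smul_eq_mul]
  field_simp
  ring

theorem inner_single_add_neg (m x : EuclideanSpace ℝ (Fin N)) (i : Fin N) :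
    ⟪EuclideanSpace.single i (1 : ℝ), x⟫ + -⟪EuclideanSpace.single i (1 : ℝ), m⟫ = (x - m) i := by
  simp [EuclideanSpace.inner_single_left, sub_eq_add_neg]

theorem sum_integral_sq_affine (hΩ : IsBoundedC1Domain Ω) (m : EuclideanSpace ℝ (Fin N)) :
    ∑ i, ∫ x, (⟪EuclideanSpace.single i (1 : ℝ), x⟫ + -⟪EuclideanSpace.single i (1 : ℝ), m⟫) *
      (⟪EuclideanSpace.single i (1 : ℝ), x⟫ + -⟪EuclideanSpace.single i (1 : ℝ), m⟫)
        ∂(surfaceMeasure Ω) = ∫ x, ‖x - m‖ ^ 2 ∂(surfaceMeasure Ω) := by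
  simp_rw [inner_single_add_neg, ← sum_coord_sq, ← sq]
  refine (integral_finsetSum _ fun i _ => integrable_surfaceMeasure_of_continuous hΩ ?_).symm
  fun_prop

/-- The first moment of a domain about any point is positive. -/
theorem integral_norm_sub_pos (hN : 1 ≤ N) (hΩ : IsBoundedC1Domain Ω)
    (m : EuclideanSpace ℝ (Fin N)) : 0 < ∫ x in Ω, ‖x - m‖ := by
  have : Nonempty (Fin N) := ⟨⟨0, hN⟩⟩
  rw [setIntegral_pos_iff_support_of_nonneg_ae (ae_of_all _ fun x => norm_nonneg _)
    (integrableOn_of_continuous hΩ (by fun_prop))]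
  have h1 : Function.support (fun x : EuclideanSpace ℝ (Fin N) => ‖x - m‖) ∩ Ω = Ω \ {m} := by
    ext x
    simp [sub_eq_zero, and_comm]
  rw [h1, measure_sdiff_null (measure_singleton m)]
  exact hΩ.isOpen.measure_pos volume hΩ.isConnected.nonempty

/-- Some coordinate function, centred at the barycentre of the boundary, has a trace different from
zero: otherwise the boundary would have no second moment, contrary to `integral_norm_le`. -/
theorem exists_traceForm_ne_zero (hN : 1 ≤ N) (hΩ : IsBoundedC1Domain Ω)
    [IsFiniteMeasure (surfaceMeasure Ω)] : ∃ x ∈ meanZero hΩ, traceForm Ω x x ≠ 0 := by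
  by_contra! hcon
  obtain ⟨m, hm⟩ := exists_boundary_barycentre hN hΩ
  have h1 := sum_integral_sq_affine hΩ m
  rw [Finset.sum_eq_zero fun i _ => ?_] at h1
  · have h2 := hΩ.integral_norm_le m
    rw [← h1] at h2
    have := integral_norm_sub_pos hN hΩ m
    have h3 : 0 < ((N : ℝ) + 1) * ∫ x in Ω, ‖x - m‖ := by positivity
    linarith
  · have h2 := isTrace_affineH2 hΩ (EuclideanSpace.single i (1 : ℝ))
      (-⟪EuclideanSpace.single i (1 : ℝ), m⟫)
    rw [← traceForm_quadruple _ _ h2.1 h2.1]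
    exact hcon _ (quadruple_mem_meanZero hΩ h2 (hm _))

/-- The eigenvalue equation extends from test functions of mean zero to all of `H²(Ω)` as soon as it
holds for one test function with non-zero mean. -/
theorem energyForm_eq_of_meanZero (hΩ : IsBoundedC1Domain Ω) [IsFiniteMeasure (surfaceMeasure Ω)]
    {lam : ℝ} {x e y : H2Ambient Ω}
    (hx : ∀ v ∈ meanZero hΩ, energyForm Ω τ x v = lam * traceForm Ω x v) (he : e ∈ h2Graph hΩ)
    (hQe : energyForm Ω τ x e = 0) (hbe : traceForm Ω x e = 0)
    (hme : bdryIntegral Ω e.2.2.2 ≠ 0) (hy : y ∈ h2Graph hΩ) :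
    energyForm Ω τ x y = lam * traceForm Ω x y := by
  have h1 := hx (y - (bdryIntegral Ω y.2.2.2 / bdryIntegral Ω e.2.2.2) • e)
    ⟨(h2Graph hΩ).sub_mem hy ((h2Graph hΩ).smul_mem _ he), by
      rw [bdryIntegral_sub_smul, div_mul_cancel₀ _ hme, sub_self]⟩
  rwa [clm_apply_sub_smul, clm_apply_sub_smul, hQe, hbe, mul_zero, sub_zero, sub_zero] at h1

/-- The minimum of the Rayleigh quotient over functions of boundary mean zero is the least positive
eigenvalue. -/
theorem exists_isLeast_positiveEigenvalues (hN : 1 ≤ N) (hτ : 0 < τ) (hΩ : IsBoundedC1Domain Ω)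
    [IsFiniteMeasure (surfaceMeasure Ω)] :
    ∃ lam : ℝ, IsLeast (positiveEigenvalues τ Ω) lam ∧
      ∀ x ∈ meanZero hΩ, lam * traceForm Ω x x ≤ energyForm Ω τ x x := by
  obtain ⟨C, hC⟩ := energyForm_coercive hN hτ hΩ
  obtain ⟨lam, hlam, hlow, x, hx, hbx, hEL⟩ := exists_rayleigh_minimizer (energyForm Ω τ)
    (traceForm Ω) (fun x y => by simp only [energyForm_apply, real_inner_comm])
    (fun x y => by simp only [traceForm_apply, real_inner_comm])
    (fun x => by rw [energyForm_self]; positivity) (fun x => by rw [traceForm_self]; positivity)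
    (meanZero hΩ) (isClosed_meanZero hΩ) hC (traceForm_compact hΩ) (exists_traceForm_ne_zero hN hΩ)
  refine ⟨lam, ⟨⟨hlam, ?_⟩, fun mu hmu => ?_⟩, hlow⟩
  · obtain ⟨u, g, hug, rfl⟩ := exists_isTrace_quadruple hΩ hx.1
    have hg0 : ∫ x, g x ∂(surfaceMeasure Ω) = 0 := by
      rw [← bdryIntegral_quadruple u hug.1]
      exact hx.2
    -- the minimiser is not zero in `Ω`, as its derivatives would vanish and so would its energy,
    -- which is `lam`
    refine ⟨u, g, hug, fun hu0 => ?_, fun φ h hφ => ?_⟩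
    · have hgrad := fun i => (u.isWeakPartial_grad i).ae_eq_zero hΩ.isOpen (u.memLp_grad i) hu0
      have hhess := fun i j => (u.isWeakPartial_hess i j).ae_eq_zero hΩ.isOpen (u.memLp_hess i j)
        (hgrad i)
      have h1 : energy τ u u = 0 := by
        rw [energy, integral_congr_ae (g := fun _ => (0 : ℝ)), integral_zero]
        filter_upwards [ae_all_iff.2 hgrad, ae_all_iff.2 fun i => ae_all_iff.2 (hhess i)]
          with x e1 e2
        simp [e1, e2]
      have h2 := hEL _ hx
      rw [energyForm_quadruple, h1, hbx, mul_one] at h2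
      exact hlam.ne h2
    · have hone := isTrace_affineH2 hΩ 0 1
      have hσ : (surfaceMeasure Ω).real univ ≠ 0 := by
        rw [Measure.real, ENNReal.toReal_ne_zero]
        exact ⟨Measure.measure_univ_ne_zero.2 (surfaceMeasure_ne_zero hN hΩ), measure_ne_top _ _⟩
      have h1 := energyForm_eq_of_meanZero hΩ hEL (quadruple_mem hΩ hone)
        ((energyForm_quadruple τ u _ hug.1 hone.1).trans (energy_affineH2_right τ hΩ u 1))
        ((traceForm_quadruple u _ hug.1 hone.1).trans (by simpa using hg0))
        (by rw [bdryIntegral_quadruple]; simpa using hσ) (quadruple_mem hΩ hφ)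
      rwa [energyForm_quadruple τ u φ hug.1 hφ.1, traceForm_quadruple u φ hug.1 hφ.1] at h1
  · obtain ⟨y, hy, hyQ, hyb⟩ := exists_quadruple_of_mem_positiveEigenvalues hN hτ hΩ hmu
    have h1 := hlow y hy
    rw [hyQ] at h1
    exact le_of_mul_le_mul_right h1 hyb

theorem IsBoundedC1Domain.isLeast_lambda2 (hN : 1 ≤ N) (hτ : 0 < τ) (hΩ : IsBoundedC1Domain Ω) :
    IsLeast (positiveEigenvalues τ Ω) (lambda2 τ Ω) := by
  have := hΩ.isFiniteMeasure
  obtain ⟨lam, h, -⟩ := exists_isLeast_positiveEigenvalues hN hτ hΩ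
  rw [lambda2, h.csInf_eq]
  exact h

/-- The variational upper bound for `λ₂(Ω)`. -/
theorem lambda2_mul_le_energy (hN : 1 ≤ N) (hτ : 0 < τ) (hΩ : IsBoundedC1Domain Ω) {φ : H2 Ω}
    {h : EuclideanSpace ℝ (Fin N) → ℝ} (hφ : IsTrace φ h)
    (h0 : ∫ x, h x ∂(surfaceMeasure Ω) = 0) :
    lambda2 τ Ω * ∫ x, h x * h x ∂(surfaceMeasure Ω) ≤ energy τ φ φ := by
  have := hΩ.isFiniteMeasure
  obtain ⟨lam, hl, hlow⟩ := exists_isLeast_positiveEigenvalues hN hτ hΩ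
  rw [lambda2, hl.csInf_eq, ← traceForm_quadruple φ φ hφ.1 hφ.1,
      ← energyForm_quadruple τ φ φ hφ.1 hφ.1]
  exact hlow _ (quadruple_mem_meanZero hΩ hφ h0)

/-- The coordinate functions, centred at the barycentre of the boundary, are test functions for
`λ₂(Ω)`. -/
theorem exists_lambda2_mul_integral_le (hN : 1 ≤ N) (hτ : 0 < τ) (hΩ : IsBoundedC1Domain Ω) :
    ∃ m : EuclideanSpace ℝ (Fin N),
      lambda2 τ Ω * ∫ x, ‖x - m‖ ^ 2 ∂(surfaceMeasure Ω) ≤ N * (τ * volume.real Ω) := by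
  obtain ⟨m, hm⟩ := exists_boundary_barycentre hN hΩ
  refine ⟨m, ?_⟩
  rw [← sum_integral_sq_affine hΩ m, Finset.mul_sum]
  have h1 : ∀ i : Fin N, energy τ
      (affineH2 hΩ (EuclideanSpace.single i (1 : ℝ)) (-⟪EuclideanSpace.single i (1 : ℝ), m⟫))
      (affineH2 hΩ (EuclideanSpace.single i (1 : ℝ)) (-⟪EuclideanSpace.single i (1 : ℝ), m⟫)) =
      τ * volume.real Ω := fun i => by
    simp [energy, affineH2, mul_comm]
  refine (Finset.sum_le_sum fun i _ => (lambda2_mul_le_energy hN hτ hΩ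
    (isTrace_affineH2 hΩ (EuclideanSpace.single i (1 : ℝ)) _) (hm _)).trans (h1 i).le).trans ?_
  simp

/-- The lower bound for the ball: the Hessian term is dropped, and the trace is controlled by the
gradient with the sharp constant of the Steklov problem for the Laplacian. -/
theorem le_lambda2_ball (hN : 1 ≤ N) (hτ : 0 < τ) (c : EuclideanSpace ℝ (Fin N)) {R : ℝ}
    (hR : 0 < R) : τ / R ≤ lambda2 τ (Metric.ball c R) := by
  have hB := isBoundedC1Domain_ball c hR
  have := hB.isFiniteMeasure
  obtain ⟨x, hx, hQ, hb⟩ := exists_quadruple_of_mem_positiveEigenvalues hN hτ hB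
    (hB.isLeast_lambda2 hN hτ).1
  have h1 := steklov_ball_of_mem_closure hN hR hx.1.2.2 hx.2
  simp only at h1
  rw [energyForm_self, traceForm_self] at hQ
  rw [traceForm_self] at hb
  have h2 : 0 ≤ ∑ i, ∑ j, ‖x.2.2.1 i j‖ ^ 2 :=
    Finset.sum_nonneg fun i _ => Finset.sum_nonneg fun j _ => sq_nonneg _
  generalize ∑ i, ‖x.2.1 i‖ ^ 2 = S at *
  generalize ∑ i, ∑ j, ‖x.2.2.1 i j‖ ^ 2 = H at *
  generalize ‖x.2.2.2‖ ^ 2 = b at *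
  rw [div_le_iff₀ hR]
  refine le_of_mul_le_mul_right ?_ hb
  have h3 : τ * b ≤ τ * (R * S) := mul_le_mul_of_nonneg_left h1 hτ.le
  have h4 : R * (τ * S) ≤ R * (lambda2 τ (Metric.ball c R) * b) :=
    mul_le_mul_of_nonneg_left (by linarith) hR.le
  linarith

end

/-! ### Power inequalities, and first moments of balls -/

section

variable {N : ℕ} {Ω : Set (EuclideanSpace ℝ (Fin N))} {τ : ℝ}

/-- Convexity of `t ↦ t ^ (-d)` around `1`, for `0 ≤ d ≤ 1`. -/
theorem two_le_rpow_add_rpow {d x : ℝ} (hd : 0 ≤ d) (hd1 : d ≤ 1) (hx : 0 ≤ x) (hx1 : x < 1) :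
    2 ≤ (1 + x) ^ (-d) + (1 - x) ^ (-d) := by
  rw [Real.rpow_neg (by linarith), Real.rpow_neg (by linarith)]
  have h1 : (1 + x) ^ d ≤ 1 + d * x := rpow_one_add_le_one_add_mul_self (by linarith) hd hd1
  have h2 : (1 - x) ^ d ≤ 1 - d * x := by
    have := rpow_one_add_le_one_add_mul_self (s := -x) (by linarith) hd hd1
    rw [← sub_eq_add_neg] at this
    linarith
  have h3 : 0 < (1 + x) ^ d := Real.rpow_pos_of_pos (by linarith) _
  have h4 : 0 < (1 - x) ^ d := Real.rpow_pos_of_pos (by linarith) _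
  have hdx : 0 ≤ d * x := mul_nonneg hd hx
  have hdx1 : d * x < 1 := by nlinarith
  calc (2 : ℝ) ≤ (1 + d * x)⁻¹ + (1 - d * x)⁻¹ := by
        rw [← sub_nonneg]
        have : (1 + d * x)⁻¹ + (1 - d * x)⁻¹ - 2 = 2 * (d * x) ^ 2 /
            ((1 + d * x) * (1 - d * x)) := by
          have h5 : 1 + d * x ≠ 0 := by linarith
          have h6 : 1 - d * x ≠ 0 := by linarith
          field_simp
          ring
        rw [this]
        have h6 : 0 < 1 - d * x := by linarith
        positivity
    _ ≤ _ := add_le_add (inv_anti₀ h3 h1) (inv_anti₀ h4 h2)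

/-- The odd part of `(1 + s) ^ a` dominates its linearisation, for `0 < a ≤ 1`. -/
theorem two_mul_le_rpow_sub_rpow {a s : ℝ} (ha : 0 < a) (ha1 : a ≤ 1) (hs : 0 ≤ s) (hs1 : s ≤ 1) :
    2 * a * s ≤ (1 + s) ^ a - (1 - s) ^ a := by
  have hmono : MonotoneOn (fun x : ℝ => (1 + x) ^ a - (1 - x) ^ a - 2 * a * x) (Icc 0 1) := by
    have hder : ∀ x ∈ Ioo (0 : ℝ) 1, HasDerivAt (fun x : ℝ => (1 + x) ^ a - (1 - x) ^ a - 2 * a * x)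
        (a * ((1 + x) ^ (-(1 - a)) + (1 - x) ^ (-(1 - a)) - 2)) x := by
      intro x hx
      have h1 : HasDerivAt (fun x : ℝ => (1 + x) ^ a) (1 * a * (1 + x) ^ (a - 1)) x :=
        ((hasDerivAt_id x).const_add 1).rpow_const (Or.inl (by simp only [id]; linarith [hx.1]))
      have h2 : HasDerivAt (fun x : ℝ => (1 - x) ^ a) (-1 * a * (1 - x) ^ (a - 1)) x :=
        ((hasDerivAt_id x).const_sub 1).rpow_const (Or.inl (by simp only [id]; linarith [hx.2]))
      have h3 := (h1.sub h2).sub ((hasDerivAt_id x).const_mul (2 * a))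
      refine h3.congr_deriv ?_
      rw [neg_sub]
      ring
    refine monotoneOn_of_deriv_nonneg (convex_Icc 0 1) ?_ ?_ ?_
    · exact ((((continuous_const.add continuous_id).rpow_const fun x => Or.inr ha.le).sub
        ((continuous_const.sub continuous_id).rpow_const fun x => Or.inr ha.le)).sub
        (continuous_const.mul continuous_id)).continuousOn
    · rw [interior_Icc]
      exact fun x hx => (hder x hx).differentiableAt.differentiableWithinAt
    · rw [interior_Icc]
      intro x hx
      rw [(hder x hx).deriv]
      have := two_le_rpow_add_rpow (d := 1 - a) (x := x) (by linarith) (by linarith) hx.1.le hx.2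
      exact mul_nonneg ha.le (by linarith)
  have h := hmono (left_mem_Icc.2 zero_le_one) ⟨hs, hs1⟩ hs
  simp only [add_zero, sub_zero, mul_zero, Real.one_rpow, sub_self] at h
  linarith

/-- Quadratic convexity of `t ↦ t ^ (1 + a)` around `1`, with the second derivative at `1` as
constant. Differentiating once reduces it to `two_mul_le_rpow_sub_rpow`. -/
theorem two_add_le_rpow_add_rpow {a s : ℝ} (ha : 0 < a) (ha1 : a ≤ 1) (hs : 0 ≤ s) (hs1 : s ≤ 1) :
    2 + (1 + a) * a * s ^ 2 ≤ (1 + s) ^ (1 + a) + (1 - s) ^ (1 + a) := by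
  have hmono : MonotoneOn (fun x : ℝ => (1 + x) ^ (1 + a) + (1 - x) ^ (1 + a) -
      (1 + a) * a * x ^ 2) (Icc 0 1) := by
    have hder : ∀ x : ℝ, HasDerivAt (fun x : ℝ => (1 + x) ^ (1 + a) + (1 - x) ^ (1 + a) -
        (1 + a) * a * x ^ 2) ((1 + a) * ((1 + x) ^ a - (1 - x) ^ a - 2 * a * x)) x := by
      intro x
      have h1 : HasDerivAt (fun x : ℝ => (1 + x) ^ (1 + a))
          (1 * (1 + a) * (1 + x) ^ (1 + a - 1)) x :=
        ((hasDerivAt_id x).const_add 1).rpow_const (Or.inr (by linarith))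
      have h2 : HasDerivAt (fun x : ℝ => (1 - x) ^ (1 + a))
          (-1 * (1 + a) * (1 - x) ^ (1 + a - 1)) x :=
        ((hasDerivAt_id x).const_sub 1).rpow_const (Or.inr (by linarith))
      have h3 := (h1.add h2).sub ((hasDerivAt_pow 2 x).const_mul ((1 + a) * a))
      refine h3.congr_deriv ?_
      rw [add_sub_cancel_left]
      push_cast
      ring
    refine monotoneOn_of_deriv_nonneg (convex_Icc 0 1)
      (fun x _ => (hder x).continuousAt.continuousWithinAt)
      (fun x _ => (hder x).differentiableAt.differentiableWithinAt) ?_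
    rw [interior_Icc]
    intro x hx
    rw [(hder x).deriv]
    exact mul_nonneg (by linarith)
      (by linarith [two_mul_le_rpow_sub_rpow ha ha1 hx.1.le hx.2.le])
  have h := hmono (left_mem_Icc.2 zero_le_one) ⟨hs, hs1⟩ hs
  simp only [add_zero, sub_zero, Real.one_rpow, ne_eq, OfNat.ofNat_ne_zero, not_false_eq_true,
    zero_pow, mul_zero] at h
  linarith

theorem volume_real_ball (hN : 1 ≤ N) (c : EuclideanSpace ℝ (Fin N)) {r : ℝ} (hr : 0 ≤ r) :
    volume.real (Metric.ball c r) =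
      r ^ N * volume.real (Metric.ball (0 : EuclideanSpace ℝ (Fin N)) 1) := by
  have : Nonempty (Fin N) := ⟨⟨0, hN⟩⟩
  rw [Measure.real, Measure.addHaar_ball volume c hr, ENNReal.toReal_mul,
    ENNReal.toReal_ofReal (by positivity), finrank_euclideanSpace_fin]
  rfl

theorem integral_norm_ball (hN : 1 ≤ N) (c : EuclideanSpace ℝ (Fin N)) {r : ℝ} (hr : 0 ≤ r) :
    ∫ x in Metric.ball c r, ‖x - c‖ =
      N / (N + 1) * volume.real (Metric.ball (0 : EuclideanSpace ℝ (Fin N)) 1) * r ^ (N + 1) := by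
  have : Nonempty (Fin N) := ⟨⟨0, hN⟩⟩
  have h1 : ∫ x in Metric.ball c r, ‖x - c‖ =
      ∫ x : EuclideanSpace ℝ (Fin N), (Iio r).indicator (fun y => y) ‖x‖ := by
    rw [← integral_indicator measurableSet_ball,
      ← integral_sub_right_eq_self (fun x => (Iio r).indicator (fun y => y) ‖x‖) c]
    refine integral_congr_ae (ae_of_all _ fun x => ?_)
    simp [indicator, dist_eq_norm]
  rw [h1, integral_fun_norm_addHaar, finrank_euclideanSpace_fin, nsmul_eq_mul, smul_eq_mul]
  have h2 : ∀ y : ℝ, y ^ (N - 1) • (Iio r).indicator (fun y => y) y =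
      (Iio r).indicator (fun y => y ^ N) y := fun y => by
    by_cases hy : y ∈ Iio r
    · rw [indicator_of_mem hy, indicator_of_mem hy, smul_eq_mul, ← pow_succ, Nat.sub_add_cancel hN]
    · rw [indicator_of_notMem hy, indicator_of_notMem hy, smul_zero]
  simp_rw [h2]
  rw [setIntegral_indicator measurableSet_Iio, Ioi_inter_Iio, ← integral_Ioc_eq_integral_Ioo,
    ← intervalIntegral.integral_of_le hr, integral_pow]
  simp only [ne_eq, Nat.add_eq_zero_iff, one_ne_zero, and_false, not_false_eq_true, zero_pow,
    sub_zero]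
  field_simp

/-- Among all sets of given volume, the centred ball has the least first moment. -/
theorem integral_norm_ball_le {E : Set (EuclideanSpace ℝ (Fin N))} (hE : MeasurableSet E)
    (hEb : Bornology.IsBounded E) (c : EuclideanSpace ℝ (Fin N)) {r : ℝ}
    (hvol : volume.real (Metric.ball c r) = volume.real E) :
    ∫ x in Metric.ball c r, ‖x - c‖ ≤ ∫ x in E, ‖x - c‖ := by
  have hi : ∀ {A : Set (EuclideanSpace ℝ (Fin N))} {f : EuclideanSpace ℝ (Fin N) → ℝ},
      Bornology.IsBounded A → Continuous f → IntegrableOn f A := fun hA hf =>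
    (hf.continuousOn.integrableOn_compact hA.isCompact_closure).mono_set subset_closure
  have hc : Continuous fun x : EuclideanSpace ℝ (Fin N) => ‖x - c‖ := by fun_prop
  have hsub : ∀ {A : Set (EuclideanSpace ℝ (Fin N))}, Bornology.IsBounded A →
      ∫ x in A, (‖x - c‖ - r) = (∫ x in A, ‖x - c‖) - volume.real A * r := fun {A} hA => by
    rw [integral_sub (hi hA hc) (hi hA continuous_const), setIntegral_const, smul_eq_mul]
  -- the ball is the set where `|x - c| - r` is negative
  have h1 : ∫ x in Metric.ball c r, (‖x - c‖ - r) ≤ ∫ x in E, (‖x - c‖ - r) := by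
    rw [← integral_indicator hE, ← integral_indicator measurableSet_ball]
    refine integral_mono ((integrable_indicator_iff measurableSet_ball).2
      (hi Metric.isBounded_ball (hc.sub continuous_const)))
      ((integrable_indicator_iff hE).2 (hi hEb (hc.sub continuous_const))) fun x => ?_
    by_cases hx : x ∈ Metric.ball c r
    · rw [indicator_of_mem hx]
      rw [Metric.mem_ball, dist_eq_norm] at hx
      by_cases hxE : x ∈ E
      · rw [indicator_of_mem hxE]
      · rw [indicator_of_notMem hxE]
        linarith
    · rw [indicator_of_notMem hx]
      rw [Metric.mem_ball, dist_eq_norm, not_lt] at hx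
      by_cases hxE : x ∈ E
      · rw [indicator_of_mem hxE]
        linarith
      · rw [indicator_of_notMem hxE]
  rw [hsub Metric.isBounded_ball, hsub hEb, hvol] at h1
  linarith

end

/-! ### Asymmetry and the first moment -/

section

variable {N : ℕ} {Ω : Set (EuclideanSpace ℝ (Fin N))} {τ : ℝ}

theorem fraenkelAsymmetry_nonneg (Ω : Set (EuclideanSpace ℝ (Fin N))) : 0 ≤
    fraenkelAsymmetry Ω := by
  refine Real.sInf_nonneg ?_
  rintro _ ⟨c, r, -, -, rfl⟩
  exact div_nonneg (integral_nonneg fun x => abs_nonneg _) ENNReal.toReal_nonneg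

/-- A ball of the same volume as `Ω` bounds the asymmetry by twice the fraction of `Ω` outside. -/
theorem fraenkelAsymmetry_mul_le (hΩ : IsOpen Ω) {c : EuclideanSpace ℝ (Fin N)} {r : ℝ}
    (hr : 0 < r) (hvol : volume (Metric.ball c r) = volume Ω) (hpos : 0 < volume.real Ω) :
    fraenkelAsymmetry Ω * volume.real Ω ≤ 2 * volume.real (Ω \ Metric.ball c r) := by
  have hfin : volume Ω ≠ ⊤ := hvol ▸ Metric.isBounded_ball.measure_lt_top.ne
  have hfinB : volume (Metric.ball c r) ≠ ⊤ := hvol ▸ hfin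
  have h1 : fraenkelAsymmetry Ω ≤ (∫ x, |Ω.indicator (fun _ => (1 : ℝ)) x -
      (Metric.ball c r).indicator (fun _ => (1 : ℝ)) x|) / (volume Ω).toReal := by
    refine csInf_le ⟨0, ?_⟩ ⟨c, r, hr, hvol, rfl⟩
    rintro _ ⟨c, r, -, -, rfl⟩
    exact div_nonneg (integral_nonneg fun x => abs_nonneg _) ENNReal.toReal_nonneg
  have hm1 : MeasurableSet (Ω \ Metric.ball c r) := hΩ.measurableSet.diff measurableSet_ball
  have hm2 : MeasurableSet (Metric.ball c r \ Ω) := measurableSet_ball.diff hΩ.measurableSet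
  have h2 : (∫ x, |Ω.indicator (fun _ => (1 : ℝ)) x -
      (Metric.ball c r).indicator (fun _ => (1 : ℝ)) x|) =
      volume.real (Ω \ Metric.ball c r) + volume.real (Metric.ball c r \ Ω) := by
    have e : ∀ x, |Ω.indicator (fun _ => (1 : ℝ)) x -
        (Metric.ball c r).indicator (fun _ => (1 : ℝ)) x| =
        (Ω \ Metric.ball c r).indicator (fun _ => (1 : ℝ)) x +
        (Metric.ball c r \ Ω).indicator (fun _ => (1 : ℝ)) x := fun x => by
      by_cases h3 : x ∈ Ω <;> by_cases h4 : x ∈ Metric.ball c r <;>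
        simp [indicator, h3, h4]
    simp_rw [e]
    rw [integral_add ((integrable_indicator_iff hm1).2 (integrableOn_const
        (measure_ne_top_of_subset sdiff_subset hfin)))
      ((integrable_indicator_iff hm2).2 (integrableOn_const
        (measure_ne_top_of_subset sdiff_subset hfinB))), integral_indicator hm1,
      integral_indicator hm2]
    simp
  have h3 : volume.real (Metric.ball c r \ Ω) = volume.real (Ω \ Metric.ball c r) := by
    have e1 := measureReal_sdiff_add_inter (μ := volume) (s := Ω) (t := Metric.ball c r)
      measurableSet_ball hfin
    have e2 := measureReal_sdiff_add_inter (μ := volume) (s := Metric.ball c r) (t := Ω)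
      hΩ.measurableSet hfinB
    have e3 : volume.real (Metric.ball c r) = volume.real Ω := by rw [Measure.real, hvol]; rfl
    rw [inter_comm] at e2
    linarith
  rw [h2, h3, ← two_mul] at h1
  rwa [← le_div_iff₀ hpos]

/-- The first moment of `Ω`, compared with that of the ball `B` of the same volume. Both `Ω ∩ B` and
`Ω ∪ B` have larger first moments than the centred balls of their volumes, and the moments of
`Ω ∩ B` and `Ω ∪ B` add up to those of `Ω` and `B`. -/
theorem le_integral_norm_sub (hN : 1 ≤ N) (hΩ : IsOpen Ω) (hb : Bornology.IsBounded Ω)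
    (c : EuclideanSpace ℝ (Fin N)) {r s : ℝ} (hr : 0 < r)
    (hvol : volume (Metric.ball c r) = volume Ω)
    (hs : volume.real (Ω \ Metric.ball c r) = s * volume.real Ω) :
    N * r * volume.real Ω *
      ((1 + s) ^ (1 + 1 / (N : ℝ)) + (1 - s) ^ (1 + 1 / (N : ℝ)) - 1) ≤
      (N + 1) * ∫ x in Ω, ‖x - c‖ := by
  have hN0 : (0 : ℝ) < N := by exact_mod_cast hN
  set B := Metric.ball c r with hB
  set κ₁ := volume.real (Metric.ball (0 : EuclideanSpace ℝ (Fin N)) 1) with hκ₁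
  have hfin : volume Ω ≠ ⊤ := hb.measure_lt_top.ne
  have hfinB : volume B ≠ ⊤ := Metric.isBounded_ball.measure_lt_top.ne
  have hBv : volume.real B = volume.real Ω := by rw [Measure.real, hvol]; rfl
  have hκ₁pos : 0 < κ₁ := ENNReal.toReal_pos (Metric.measure_ball_pos _ _ one_pos).ne'
    Metric.isBounded_ball.measure_lt_top.ne
  have hΩv : volume.real Ω = r ^ N * κ₁ := by rw [← hBv, hB, volume_real_ball hN c hr.le]
  have hΩpos : 0 < volume.real Ω := by rw [hΩv]; positivity
  have e1 := measureReal_sdiff_add_inter (μ := volume) (s := Ω) (t := B) measurableSet_ball hfin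
  have e2 := measureReal_union_add_inter (μ := volume) (s := Ω)
      (t := B) measurableSet_ball hfin hfinB
  have hinter : volume.real (Ω ∩ B) = (1 - s) * volume.real Ω := by linarith
  have hunion : volume.real (Ω ∪ B) = (1 + s) * volume.real Ω := by linarith
  have hs0 : 0 ≤ s := by
    have : 0 ≤ s * volume.real Ω := hs ▸ measureReal_nonneg
    exact (mul_nonneg_iff_of_pos_right hΩpos).1 this
  have hs1 : 0 ≤ 1 - s := by
    have : 0 ≤ (1 - s) * volume.real Ω := hinter ▸ measureReal_nonneg
    exact (mul_nonneg_iff_of_pos_right hΩpos).1 this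
  -- the centred ball of volume `t |Ω|` has radius `r t ^ (1 / N)`
  have key : ∀ (E : Set (EuclideanSpace ℝ (Fin N))) (t : ℝ), MeasurableSet E →
      Bornology.IsBounded E → 0 ≤ t → volume.real E = t * volume.real Ω →
      N * r * volume.real Ω * t ^ (1 + 1 / (N : ℝ)) ≤ (N + 1) * ∫ x in E, ‖x - c‖ := by
    intro E t hE hEb ht hEt
    set ρ := r * t ^ (1 / (N : ℝ)) with hρ
    have ht' : 0 ≤ t ^ (1 / (N : ℝ)) := Real.rpow_nonneg ht _
    have hρ0 : 0 ≤ ρ := mul_nonneg hr.le ht'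
    have htN : (t ^ (1 / (N : ℝ))) ^ N = t := by
      rw [one_div]
      exact Real.rpow_inv_natCast_pow ht (by omega)
    have hρv : volume.real (Metric.ball c ρ) = volume.real E := by
      rw [volume_real_ball hN c hρ0, hEt, hΩv, hρ, mul_pow, htN]
      ring
    have h1 := integral_norm_ball_le hE hEb c hρv
    rw [integral_norm_ball hN c hρ0] at h1
    have ht1 : t ^ (1 + 1 / (N : ℝ)) = t * t ^ (1 / (N : ℝ)) := by
      rw [Real.rpow_add_of_nonneg ht zero_le_one (by positivity), Real.rpow_one]
    have h2 : N * r * volume.real Ω * t ^ (1 + 1 / (N : ℝ)) =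
        (N + 1) * (N / (N + 1) * κ₁ * ρ ^ (N + 1)) := by
      rw [ht1, hΩv, hρ, mul_pow, pow_succ (t ^ (1 / (N : ℝ))), htN]
      field_simp
      ring
    rw [h2]
    gcongr
  have k1 := key (Ω ∩ B) (1 - s) (hΩ.measurableSet.inter measurableSet_ball)
    (hb.subset inter_subset_left) hs1 hinter
  have k2 := key (Ω ∪ B) (1 + s) (hΩ.measurableSet.union measurableSet_ball)
    (hb.union Metric.isBounded_ball) (by linarith) hunion
  have k3 : ∫ x in B, ‖x - c‖ = N / (N + 1) * κ₁ * r ^ (N + 1) := integral_norm_ball hN c hr.le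
  have hi : ∀ {A : Set (EuclideanSpace ℝ (Fin N))}, Bornology.IsBounded A →
      IntegrableOn (fun x => ‖x - c‖) A := fun hA =>
    ((by fun_prop : Continuous fun x : EuclideanSpace ℝ (Fin N) => ‖x -
        c‖).continuousOn.integrableOn_compact
      hA.isCompact_closure).mono_set subset_closure
  have k4 : ∫ x in Ω ∪ B, ‖x - c‖ = (∫ x in Ω \ B, ‖x - c‖) + ∫ x in B, ‖x - c‖ := by
    rw [← setIntegral_union disjoint_sdiff_left measurableSet_ball (hi (hb.subset sdiff_subset))
      (hi Metric.isBounded_ball), sdiff_union_self]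
  have k6 := integral_inter_add_sdiff (μ := volume) (f := fun x => ‖x - c‖) (s := Ω)
    (measurableSet_ball (x := c) (ε := r)) (hi hb)
  have k5 : N * r * volume.real Ω = (N + 1) * ∫ x in B, ‖x - c‖ := by
    rw [k3, hΩv]
    field_simp
    ring
  rw [mul_sub, mul_add, mul_one, ← k6]
  rw [k4] at k2
  linarith

end

end BiharmonicSteklov

theorem mainTheorem1 (N : ℕ) (hN : 2 ≤ N) (τ : ℝ) (hτ : 0 < τ)
    (Ω : Set (EuclideanSpace ℝ (Fin N))) (hΩ : BiharmonicSteklov.IsBoundedC1Domain Ω)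
    (c : EuclideanSpace ℝ (Fin N)) (R : ℝ) (hR : 0 < R)
    (hvol : volume (Metric.ball c R) = volume Ω) :
    IsLeast (BiharmonicSteklov.positiveEigenvalues τ Ω) (BiharmonicSteklov.lambda2 τ Ω) ∧
    IsLeast (BiharmonicSteklov.positiveEigenvalues τ (Metric.ball c R))
      (BiharmonicSteklov.lambda2 τ (Metric.ball c R)) ∧
    BiharmonicSteklov.lambda2 τ Ω ≤
      BiharmonicSteklov.lambda2 τ (Metric.ball c R) *
        (1 - BiharmonicSteklov.deltaConst N * BiharmonicSteklov.fraenkelAsymmetry Ω ^ 2) := by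
  open BiharmonicSteklov in
  have hN1 : 1 ≤ N := by omega
  have hN0 : (2 : ℝ) ≤ N := by exact_mod_cast hN
  have hΩl := hΩ.isLeast_lambda2 hN1 hτ
  refine ⟨hΩl, (isBoundedC1Domain_ball c hR).isLeast_lambda2 hN1 hτ, ?_⟩
  obtain ⟨m, hm⟩ := exists_lambda2_mul_integral_le hN1 hτ hΩ
  have hvol' : volume (Metric.ball m R) = volume Ω := by
    rw [← hvol, Measure.addHaar_ball_center, Measure.addHaar_ball_center volume c]
  have hvpos : 0 < volume.real Ω := ENNReal.toReal_pos
    (hΩ.isOpen.measure_pos volume hΩ.isConnected.nonempty).ne' hΩ.isBounded.measure_lt_top.ne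
  set v := volume.real Ω
  set s := volume.real (Ω \ Metric.ball m R) / v with hs
  have hsv : volume.real (Ω \ Metric.ball m R) = s * v := by rw [hs, div_mul_cancel₀ _ hvpos.ne']
  have hs0 : 0 ≤ s := div_nonneg measureReal_nonneg hvpos.le
  have hs1 : s ≤ 1 := (div_le_one hvpos).2
    (measureReal_mono sdiff_subset hΩ.isBounded.measure_lt_top.ne)
  set a := 1 / (N : ℝ) with ha
  have ha0 : 0 < a := by positivity
  have ha1 : a ≤ 1 / 2 := one_div_le_one_div_of_le two_pos hN0
  have hF := two_add_le_rpow_add_rpow ha0 (by linarith) hs0 hs1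
  have hmom := le_integral_norm_sub hN1 hΩ.isOpen hΩ.isBounded m hR hvol' hsv
  rw [← ha] at hmom
  set F := (1 + s) ^ (1 + a) + (1 - s) ^ (1 + a) - 1 with hFdef
  have hbdry := hΩ.integral_norm_le m
  have hball := le_lambda2_ball hN1 hτ c hR
  set L := lambda2 τ Ω
  set L' := lambda2 τ (Metric.ball c R)
  have hL : 0 < L := hΩl.1.1
  -- the upper bound `L ∫_∂Ω |x - m|² ≤ N τ v` and the lower bound `τ / R ≤ L'` for the ball
  have h1 : L * F ≤ L' := by
    refine le_trans ?_ hball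
    rw [le_div_iff₀ hR]
    have h2 : L * (N * R * v * F) ≤ N * (τ * v) :=
      (mul_le_mul_of_nonneg_left (hmom.trans hbdry) hL.le).trans hm
    have h3 : 0 < N * v := by positivity
    refine le_of_mul_le_mul_right ?_ h3
    linarith
  -- `q = 2 ^ (1 / N) - 1` is at most `1 / N` by Bernoulli's inequality
  set q := (2 : ℝ) ^ a - 1 with hq
  have hq0 : 0 ≤ q := sub_nonneg.2 (Real.one_le_rpow one_le_two ha0.le)
  have hqa : q ≤ a := by
    have := rpow_one_add_le_one_add_mul_self (s := 1) (by norm_num) ha0.le (by linarith : a ≤ 1)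
    norm_num at this
    linarith
  set κ := (1 + a) * q / 2 with hκ
  have hκ0 : 0 ≤ κ := by positivity
  have hκ1 : κ ≤ 3 / 8 := by
    have : (1 + a) * q ≤ (1 + 1 / 2) * (1 / 2) := by gcongr; linarith
    linarith
  have hFκ : 1 + 2 * κ * s ^ 2 ≤ F := by
    have : (1 + a) * q * s ^ 2 ≤ (1 + a) * a * s ^ 2 := by gcongr
    rw [hFdef, hκ]
    linarith
  have hA : fraenkelAsymmetry Ω ≤ 2 * s := by
    have := fraenkelAsymmetry_mul_le hΩ.isOpen hR hvol' hvpos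
    rw [hsv, ← mul_assoc] at this
    exact le_of_mul_le_mul_right this hvpos
  have hδ : deltaConst N * fraenkelAsymmetry Ω ^ 2 ≤ κ * s ^ 2 := by
    have hδκ : deltaConst N = κ / 4 := by
      rw [deltaConst, ← ha, hκ, hq, ha]
      field_simp
      ring
    have h2 : fraenkelAsymmetry Ω ^ 2 ≤ (2 * s) ^ 2 :=
      pow_le_pow_left₀ (fraenkelAsymmetry_nonneg Ω) hA 2
    rw [hδκ]
    calc κ / 4 * fraenkelAsymmetry Ω ^ 2 ≤ κ / 4 * (2 * s) ^ 2 := by gcongr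
      _ = κ * s ^ 2 := by ring
  have hs2 : s ^ 2 ≤ 1 := pow_le_one₀ hs0 hs1
  have hκs : κ * s ^ 2 ≤ 3 / 8 := by nlinarith [sq_nonneg s]
  have hκs0 : 0 ≤ κ * s ^ 2 := by positivity
  -- `(1 + 2 z) (1 - z) ≥ 1` for `0 ≤ z ≤ 1 / 2`, here with `z = κ s²`
  have h2 : 1 ≤ F * (1 - κ * s ^ 2) := by
    have : (1 + 2 * κ * s ^ 2) * (1 - κ * s ^ 2) ≤ F * (1 - κ * s ^ 2) :=
      mul_le_mul_of_nonneg_right hFκ (by linarith)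
    nlinarith
  have hL' : 0 ≤ L' := le_trans (by positivity) hball
  calc L = L * 1 := (mul_one _).symm
    _ ≤ L * (F * (1 - κ * s ^ 2)) := mul_le_mul_of_nonneg_left h2 hL.le
    _ = L * F * (1 - κ * s ^ 2) := by ring
    _ ≤ L' * (1 - κ * s ^ 2) := mul_le_mul_of_nonneg_right h1 (by linarith)
    _ ≤ _ := mul_le_mul_of_nonneg_left (by linarith) hL'
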